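/- Let $\Bbbk$ be a field of characteristic $0$. All operads below are dg operads over $\Bbbk$ (homological grading, Koszul sign rule), given by partial compositions $\circ_i$, without units. **The operad $\mathcal O_\infty$.** An operadic tree is a planar rooted tree $\mathcal T$ with $k$ vertices, all with at least one input, indexed by a bijection with $\{1,\dots,k\}$; it belongs to $\mathtt{Tree}(n_1,\dots,n_k;n)$ if the vertex $i$ has $n_i$ inputs and $\mathcal T$ has $n$ input leaves. Its edge-graph $\mathbf H_{\mathcal T}$ is the graph whose vertices are the internal edges of $\mathcal T$, two of them being joined if they share a vertex of $\mathcal T$. A construct of a connected hypergraph $\mathbf H$ with vertex set $H$ is a non-planar decorated rooted tree, defined recursively: its root is decorated by a set $\emptyset\neq X\subseteq H$, and on it are grafted constructs of the connected components of $\mathbf H\setminus X$, one for each. The constructs of $\mathbf H$ are the faces of the hypergraph polytope of $\mathbf H$. The space $\mathcal O_\infty(n_1,\dots,n_k;n)$ has as basis the pairs $(\mathcal T,C)$ with $\mathcal T\in\mathtt{Tree}(n_1,\dots,n_k;n)$ and $C$ a construct of $\mathbf H_{\mathcal T}$, in degree $k-1-|v(C)|$. To $(\mathcal T,C)$ is associated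 the planar tree $\alpha(\mathcal T,C)$, with the vertices of $C$ as vertices and the vertices of $\mathcal T$ as leaves: if a vertex $X$ of $C$ lives on the subtree $\mathcal S$ of $\mathcal T$, its inputs are the vertices of the tree obtained from $\mathcal S$ by collapsing downwards all edges outside $X$, ordered from bottom to top and from left to right, and the child of $X$ living on the subtree $\mathcal S'$ is grafted to the input given by the root vertex of $\mathcal S'$. The composition is $$(\mathcal T_1,C_1)\circ_i(\mathcal T_2,C_2)=(-1)^{\varepsilon}(\mathcal T_1\bullet_i\mathcal T_2,\;C_1\bullet_iC_2),$$ where $\mathcal T_1\bullet_i\mathcal T_2$ is the substitution of the vertex $i$ of $\mathcal T_1$ by $\mathcal T_2$, where $C_1\bullet_iC_2$ is obtained by grafting $C_2$ to that vertex of $C_1$ to which the leaf $i$ of $\alpha(\mathcal T_1,C_1)$ is attached, and where $\varepsilon$ is the number of edges and leaves of $\alpha(\mathcal T_1,C_1)$ on the right of the path from the leaf $i$ to the root, times the number of internal edges and input leaves of $\alpha(\mathcal T_2,C_2)$. The differential is $$d(\mathcal T,C)=\sum_{V,\,X\sqcup Y=V}(-1)^{\delta}\,(\mathcal T,C[X\{Y\}/V]),$$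 summed over the vertices $V$ of $C$ with $|V|\ge 2$ and the decompositions $V=X\sqcup Y$ such that $X\{Y\}$ is a construct of the edge-graph of the tree obtained from $\mathcal T$ by collapsing the edges outside $V$; here $C[X\{Y\}/V]$ is the construct of $\mathbf H_{\mathcal T}$ obtained from $C$ by splitting $V$ into the edge $X\{Y\}$, and $\delta$ is the number of edges and leaves of $\alpha(\mathcal T,C[X\{Y\}/V])$ on the left of, plus the number of internal edges below, that edge. **Linear trees.** An operadic tree with $k$ vertices is linear if each vertex has exactly one input and, for $2\le i\le k$, the vertex $i$ is attached directly on top of the vertex $i-1$. Let $\mathcal A_\infty(k)\subseteq\mathcal O_\infty$ be the span of the $(\mathcal T,C)$ with $\mathcal T$ linear with $k$ vertices. **The operads $A_\infty$ and $\mathit{As}$.** $A_\infty$ is the quasi-free non-symmetric dg operad $\mathcal T\big(\bigoplus_{n\ge2}\mathrm{Span}_\Bbbk(t_n)\big)$, $|t_n|=n-2$, with $$d(t_n)=\sum_{\substack{n=p+q+r,\ k=p+1+r\\ k,q\ge2}}(-1)^{p+qr}\,t_k\circ_{p+1}t_q ,$$ and $\mathit{As}$ is the non-symmetric operad with $\mathit{As}(n)=\mathrm{Span}_\Bbbk(t_n)$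 for $n\ge2$ (and $0$ for $n\leq 1$), $t_m\circ_it_n=t_{m+n-1}$, in degree $0$ with zero differential. A minimal model of a dg operad $P$ is a dg operad $M$ which, as a graded operad, is free on some collection $E$, with $d(E)$ contained in the decomposable elements (combinations of trees with at least two vertices), together with a quasi-isomorphism of dg operads $M\to P$. **Theorem.** For a linear tree with $k$ vertices, $\mathbf H_{\mathcal T}$ is the linear graph with $k-1$ vertices (so that, for $k\geq 2$, its constructs are the faces of the $(k-2)$-dimensional associahedron). The spaces $\mathcal A_\infty(k)\subseteq\mathcal O_\infty(1,\dots,1;1)$ are closed under the compositions and the differential of $\mathcal O_\infty$ and form a monochrome non-symmetric dg operad $\mathcal A_\infty$. This operad is isomorphic to the dg operad $A_\infty$, and it is a minimal model of $\mathit{As}$. -/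

import Mathlib

universe u

namespace OInfinity

/-! ## Non-symmetric dg operads

Operads are given by partial compositions `∘ᵢ` (`1 ≤ i ≤ m`) and have no units.  The arity
components `obj n` and the homogeneous components `deg a` are subspaces of one ambient vector
space `V`, so that `comp i` and `d` are maps on `V`; only their values on the components `obj n`
matter. -/

/-- The data of a non-symmetric dg operad over `𝕜`: arity components, grading, partial compositions
and differential.  The axioms are `IsGradedOperad` and `IsDGOperad`. -/
structure OperadData (𝕜 : Type u) [Field 𝕜] where
  V : Type u
  [addCommGroup : AddCommGroup V]
  [module : Module 𝕜 V]
  /-- the component of arity `n` -/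
  obj : ℕ → Submodule 𝕜 V
  /-- the homogeneous elements of degree `a` -/
  deg : ℤ → Submodule 𝕜 V
  /-- the partial composition `x ∘ᵢ y` is `comp i x y`; inputs are numbered from `1` -/
  comp : ℕ → V →ₗ[𝕜] V →ₗ[𝕜] V
  /-- the differential -/
  d : V →ₗ[𝕜] V

attribute [instance] OperadData.addCommGroup OperadData.module

namespace OperadData

variable {𝕜 : Type u} [Field 𝕜]

/-- The axioms of a (non-unital, non-symmetric) graded operad, with the Koszul sign rule. -/
structure IsGradedOperad (P : OperadData 𝕜) : Prop where
  le_iSup_deg : ∀ n, P.obj n ≤ ⨆ a, P.obj n ⊓ P.deg a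
  independent : ∀ n, iSupIndep fun a => P.obj n ⊓ P.deg a
  comp_mem : ∀ {m n i : ℕ} {x y : P.V}, 1 ≤ i → i ≤ m → x ∈ P.obj m → y ∈ P.obj n →
    P.comp i x y ∈ P.obj (m + n - 1)
  comp_deg : ∀ {m n i : ℕ} {a b : ℤ} {x y : P.V}, 1 ≤ i → i ≤ m →
    x ∈ P.obj m ⊓ P.deg a → y ∈ P.obj n ⊓ P.deg b → P.comp i x y ∈ P.deg (a + b)
  /-- sequential composition -/
  comp_seq : ∀ {m n p i j : ℕ} {x y z : P.V}, 1 ≤ i → i ≤ m → 1 ≤ j → j ≤ n →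
    x ∈ P.obj m → y ∈ P.obj n → z ∈ P.obj p →
    P.comp (i - 1 + j) (P.comp i x y) z = P.comp i x (P.comp j y z)
  /-- parallel composition -/
  comp_par : ∀ {m n p i j : ℕ} {b c : ℤ} {x y z : P.V}, 1 ≤ i → i < j → j ≤ m →
    x ∈ P.obj m → y ∈ P.obj n ⊓ P.deg b → z ∈ P.obj p ⊓ P.deg c →
    P.comp (j - 1 + n) (P.comp i x y) z = (b * c).negOnePow • P.comp i (P.comp j x z) y

/-- The axioms of a dg operad: the differential has degree `-1`, squares to zero and is a derivation
with respect to all partial compositions. -/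
structure IsDGOperad (P : OperadData 𝕜) : Prop extends IsGradedOperad P where
  d_mem : ∀ {n : ℕ} {x : P.V}, x ∈ P.obj n → P.d x ∈ P.obj n
  d_deg : ∀ {n : ℕ} {a : ℤ} {x : P.V}, x ∈ P.obj n ⊓ P.deg a → P.d x ∈ P.deg (a - 1)
  d_d : ∀ {n : ℕ} {x : P.V}, x ∈ P.obj n → P.d (P.d x) = 0
  d_comp : ∀ {m n i : ℕ} {a : ℤ} {x y : P.V}, 1 ≤ i → i ≤ m →
    x ∈ P.obj m ⊓ P.deg a → y ∈ P.obj n →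
    P.d (P.comp i x y) = P.comp i (P.d x) y + a.negOnePow • P.comp i x (P.d y)

/-- Morphisms of graded operads: degree-preserving linear maps in each arity that preserve the
partial compositions. -/
structure IsGradedHom (P Q : OperadData 𝕜) (f : ∀ n, P.obj n →ₗ[𝕜] Q.obj n) : Prop where
  map_deg : ∀ {n : ℕ} {a : ℤ} (x : P.obj n), (x : P.V) ∈ P.deg a → (f n x : Q.V) ∈ Q.deg a
  map_comp : ∀ {m n i : ℕ} (x : P.obj m) (y : P.obj n) (z : P.obj (m + n - 1)), 1 ≤ i → i ≤ m →
    (z : P.V) = P.comp i x y → (f (m + n - 1) z : Q.V) = Q.comp i (f m x) (f n y)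

/-- Morphisms of dg operads. -/
structure IsDGHom (P Q : OperadData 𝕜) (f : ∀ n, P.obj n →ₗ[𝕜] Q.obj n) : Prop
    extends IsGradedHom P Q f where
  map_d : ∀ {n : ℕ} (x y : P.obj n), (y : P.V) = P.d x → (f n y : Q.V) = Q.d (f n x)

/-- Two dg operads are isomorphic. -/
def Isomorphic (P Q : OperadData 𝕜) : Prop :=
  ∃ f : ∀ n, P.obj n →ₗ[𝕜] Q.obj n, IsDGHom P Q f ∧ ∀ n, Function.Bijective (f n)

/-- The cycles of arity `n`. -/
def cycles (P : OperadData 𝕜) (n : ℕ) : Submodule 𝕜 P.V := P.obj n ⊓ LinearMap.ker P.d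

/-- The boundaries of arity `n`. -/
def boundaries (P : OperadData 𝕜) (n : ℕ) : Submodule 𝕜 P.V := (P.obj n).map P.d

/-- The map induced by `f` on homology, `cycles / boundaries`, is injective and surjective in
each arity. -/
def IsQuasiIso (P Q : OperadData 𝕜) (f : ∀ n, P.obj n →ₗ[𝕜] Q.obj n) : Prop :=
  ∀ n, (∀ x : P.obj n, (x : P.V) ∈ P.cycles n → (f n x : Q.V) ∈ Q.boundaries n →
      (x : P.V) ∈ P.boundaries n) ∧
    ∀ y ∈ Q.cycles n, ∃ x : P.obj n, (x : P.V) ∈ P.cycles n ∧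
      y - (f n x : Q.V) ∈ Q.boundaries n

/-- `P` is, as a graded operad, the free operad on its graded subcollection `E`. -/
def IsFreeOn (P : OperadData 𝕜) (E : ℕ → Submodule 𝕜 P.V) : Prop :=
  (∀ n, E n ≤ P.obj n) ∧ (∀ n, E n ≤ ⨆ a, E n ⊓ P.deg a) ∧
    ∀ Q : OperadData 𝕜, Q.IsGradedOperad → ∀ g : ∀ n, E n →ₗ[𝕜] Q.obj n,
      (∀ (n : ℕ) (a : ℤ) (x : E n), (x : P.V) ∈ P.deg a → (g n x : Q.V) ∈ Q.deg a) →
      ∃! f : ∀ n, P.obj n →ₗ[𝕜] Q.obj n, IsGradedHom P Q f ∧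
        ∀ (n : ℕ) (x : P.obj n) (e : E n), (x : P.V) = e → f n x = g n e

/-- The decomposable elements of arity `n`: the span of all `x ∘ᵢ y`.  In a free operad on `E` these
are the combinations of trees with at least two vertices. -/
def decomposables (P : OperadData 𝕜) (n : ℕ) : Submodule 𝕜 P.V :=
  Submodule.span 𝕜 {w | ∃ (m l i : ℕ) (x y : P.V), m + l = n + 1 ∧ 1 ≤ i ∧ i ≤ m ∧
    x ∈ P.obj m ∧ y ∈ P.obj l ∧ w = P.comp i x y}

/-- `M` is a minimal model of `P`: it is free as a graded operad on some `E`, its differential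
sends `E` to decomposable elements, and it comes with a quasi-isomorphism of dg operads to `P`. -/
def IsMinimalModel (M P : OperadData 𝕜) : Prop :=
  M.IsDGOperad ∧ P.IsDGOperad ∧
    (∃ E : ℕ → Submodule 𝕜 M.V, M.IsFreeOn E ∧
      ∀ n, ∀ x ∈ E n, M.d x ∈ M.decomposables n) ∧
    ∃ f : ∀ n, M.obj n →ₗ[𝕜] P.obj n, IsDGHom M P f ∧ IsQuasiIso M P f

end OperadData

/-! ## Hypergraphs and constructs -/

/-- A finite hypergraph on natural numbers. -/
@[ext] structure Hypergraph where
  verts : Finset ℕ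
  edges : Finset (Finset ℕ)

namespace Hypergraph

/-- The hypergraph `H_X` of the hyperedges contained in `X`. -/
def restrict (H : Hypergraph) (X : Finset ℕ) : Hypergraph where
  verts := X
  edges := H.edges.filter (· ⊆ X)

/-- No partition of the vertices into two non-empty parts is respected by all hyperedges. -/
def IsConnected (H : Hypergraph) : Prop :=
  H.verts.Nonempty ∧ ∀ A ∈ H.verts.powerset, A.Nonempty → A ≠ H.verts →
    ∃ Z ∈ H.edges, ¬ Z ⊆ A ∧ ¬ Z ⊆ H.verts \ A

instance (H : Hypergraph) : Decidable H.IsConnected := by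
  unfold IsConnected; infer_instance

/-- The vertex sets of the connected components. -/
def components (H : Hypergraph) : Finset (Finset ℕ) :=
  H.verts.powerset.filter fun K =>
    (H.restrict K).IsConnected ∧ ∀ Z ∈ H.edges, Z ⊆ K ∨ Z ⊆ H.verts \ K

end Hypergraph

/-- Rooted trees whose vertices are decorated by sets.  Constructs are non-planar; which order of
the children represents a non-planar tree is fixed in `CTree.canon`. -/
inductive CTree
  | node (X : Finset ℕ) (children : List CTree) : CTree

namespace CTree

mutual
/-- The list of (the decorations of) the vertices. -/
def verts : CTree → List (Finset ℕ)
  | node X cs => X :: vertsList cs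
def vertsList : List CTree → List (Finset ℕ)
  | [] => []
  | c :: cs => verts c ++ vertsList cs
end

/-- The union of all decorations. -/
def supp (C : CTree) : Finset ℕ := C.verts.foldr (· ∪ ·) ∅

mutual
/-- Renaming of the elements of the decorations. -/
def rename (f : ℕ → ℕ) : CTree → CTree
  | node X cs => node (X.image f) (renameList f cs)
def renameList (f : ℕ → ℕ) : List CTree → List CTree
  | [] => []
  | c :: cs => rename f c :: renameList f cs
end

/-- `IsConstruct H C` says that `C` is a construct of `H`: the root is decorated by a non-empty set
`X` of vertices, and on it are grafted constructs of the connected components of `H ∖ X`, one for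
each component (none if `X` is the set of all vertices). -/
inductive IsConstruct : Hypergraph → CTree → Prop
  | node (H : Hypergraph) (X : Finset ℕ) (cs : List CTree) (hX : X.Nonempty) (hXH : X ⊆ H.verts)
      (hcomp : ((cs.map supp : List (Finset ℕ)) : Multiset (Finset ℕ)) =
        (H.restrict (H.verts \ X)).components.val)
      (hcs : ∀ c ∈ cs, IsConstruct (H.restrict c.supp) c) :
      IsConstruct H (node X cs)

end CTree

/-! ## Operadic trees -/

/-- Planar rooted trees with vertices indexed by natural numbers; `leaf` is an input leaf. -/
inductive OTree
  | leaf : OTree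
  | node (v : ℕ) (inputs : List OTree) : OTree

namespace OTree

/-- The index of the root vertex. -/
def root? : OTree → Option ℕ
  | leaf => none
  | node v _ => some v

mutual
/-- The indices of the vertices, in the left-recursive order (from bottom to top and from left to
right). -/
def vertices : OTree → List ℕ
  | leaf => []
  | node v ts => v :: verticesList ts
def verticesList : List OTree → List ℕ
  | [] => []
  | t :: ts => vertices t ++ verticesList ts
end

mutual
/-- The number of input leaves. -/
def leaves : OTree → ℕ
  | leaf => 1
  | node _ ts => leavesList ts
def leavesList : List OTree → ℕ
  | [] => 0
  | t :: ts => leaves t + leavesList ts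
end

mutual
/-- The pairs (vertex, number of its inputs). -/
def arities : OTree → List (ℕ × ℕ)
  | leaf => []
  | node v ts => (v, ts.length) :: aritiesList ts
def aritiesList : List OTree → List (ℕ × ℕ)
  | [] => []
  | t :: ts => arities t ++ aritiesList ts
end

mutual
/-- The internal edges, as pairs (upper vertex, lower vertex).  An internal edge is named by
its upper vertex. -/
def edges : OTree → List (ℕ × ℕ)
  | leaf => []
  | node v ts => edgesList v ts
def edgesList (v : ℕ) : List OTree → List (ℕ × ℕ)
  | [] => []
  | t :: ts => (root? t).toList.map (fun w => (w, v)) ++ edges t ++ edgesList v ts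
end

/-- `T` is an operadic tree in `Tree(n₁, …, n_k; n)`: it has `k` vertices, indexed bijectively by
`1, …, k`, the vertex `i` has `nᵢ ≥ 1` inputs, and `T` has `n` inputs.  (Two indexed planar trees
are isomorphic if and only if they are equal as elements of `OTree`.) -/
def IsOperadic (ns : List ℕ) (n : ℕ) (T : OTree) : Prop :=
  (∀ m ∈ ns, 1 ≤ m) ∧ T.vertices.Perm (List.range' 1 ns.length) ∧ T ≠ leaf ∧
    (∀ p ∈ T.arities, ns[p.1 - 1]? = some p.2) ∧ T.leaves = n

/-- The lower vertex of the edge named `e`. -/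
def lower (T : OTree) (e : ℕ) : ℕ := (T.edges.lookup e).getD 0

/-- The vertices of the subtree of `T` determined by a set of edges. -/
def span (T : OTree) (K : Finset ℕ) : Finset ℕ := K.biUnion fun e => {e, T.lower e}

/-- The root vertex of the subtree determined by a connected set of edges: the first of its vertices
in the left-recursive order. -/
def rootOf (T : OTree) (K : Finset ℕ) : ℕ := (T.vertices.find? (· ∈ T.span K)).getD 0

/-- The edge-graph `H_T`: its vertices are the internal edges of `T`, and its hyperedges are the
singletons and the pairs of edges that share a vertex of `T`. -/
def edgeGraph (T : OTree) : Hypergraph where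
  verts := (T.edges.map Prod.fst).toFinset
  edges := (((T.edges.map Prod.fst).toFinset ×ˢ (T.edges.map Prod.fst).toFinset).filter
    fun p => ¬ Disjoint (T.span {p.1}) (T.span {p.2})).image fun p => {p.1, p.2}

mutual
/-- The tree obtained by collapsing downwards all internal edges except those in `W`. -/
def contract (W : Finset ℕ) : OTree → OTree
  | leaf => leaf
  | node v ts => node v (contractList W ts)
def contractList (W : Finset ℕ) : List OTree → List OTree
  | [] => []
  | t :: ts =>
    (match contract W t with
      | leaf => [leaf]
      | node w us => if w ∈ W then [node w us] else us) ++ contractList W ts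
end

mutual
/-- Reindexing of the vertices. -/
def relabel (f : ℕ → ℕ) : OTree → OTree
  | leaf => leaf
  | node v ts => node (f v) (relabelList f ts)
def relabelList (f : ℕ → ℕ) : List OTree → List OTree
  | [] => []
  | t :: ts => relabel f t :: relabelList f ts
end

mutual
/-- Replace the leaves of a tree, from left to right, by the trees of the list; the second
component is the unused rest of the list. -/
def fill : OTree → List OTree → OTree × List OTree
  | leaf, [] => (leaf, [])
  | leaf, s :: ss => (s, ss)
  | node v ts, ss => (node v (fillList ts ss).1, (fillList ts ss).2)
def fillList : List OTree → List OTree → List OTree × List OTree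
  | [], ss => ([], ss)
  | t :: ts, ss =>
    ((fill t ss).1 :: (fillList ts (fill t ss).2).1, (fillList ts (fill t ss).2).2)
end

mutual
/-- Replace the vertex `i` by the tree `S`, and reindex all other vertices by `f`. -/
def replace (i : ℕ) (f : ℕ → ℕ) (S : OTree) : OTree → OTree
  | leaf => leaf
  | node v ts =>
    if v = i then (fill S (replaceList i f S ts)).1 else node (f v) (replaceList i f S ts)
def replaceList (i : ℕ) (f : ℕ → ℕ) (S : OTree) : List OTree → List OTree
  | [] => []
  | t :: ts => replace i f S t :: replaceList i f S ts
end

/-- The new index in `T₁ •ᵢ T₂` of a vertex `v ≠ i` of `T₁`, where `T₂` has `l` vertices. -/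
def outer (i l v : ℕ) : ℕ := if v < i then v else v + l - 1

/-- The new index in `T₁ •ᵢ T₂` of a vertex `v` of `T₂`. -/
def inner (i v : ℕ) : ℕ := v + i - 1

/-- The substitution `T₁ •ᵢ T₂` of the vertex indexed by `i` of `T₁` by `T₂`. -/
def subst (T₁ : OTree) (i : ℕ) (T₂ : OTree) : OTree :=
  replace i (outer i T₂.vertices.length) (T₂.relabel (inner i)) T₁

/-- The name in `T₁ •ᵢ T₂` of the edge of `T₁` named `e`; the edge below the vertex `i` becomes
the edge below the root vertex of `T₂`. -/
def edgeName (i : ℕ) (T₂ : OTree) (e : ℕ) : ℕ :=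
  if e = i then inner i (T₂.root?.getD 0) else outer i T₂.vertices.length e

/-- Linear operadic trees with `k` vertices: every vertex has exactly one input, and the vertex `i`
is attached directly on top of the vertex `i - 1`. -/
def IsLinear (k : ℕ) (T : OTree) : Prop :=
  T.IsOperadic (List.replicate k 1) 1 ∧ ∀ i, 2 ≤ i → i ≤ k → (i, i - 1) ∈ T.edges

end OTree

/-- The linear graph with vertices `2, …, k`, whose constructs are the faces of the
`(k - 2)`-dimensional associahedron. -/
def linearGraph (k : ℕ) : Hypergraph where
  verts := Finset.Icc 2 k
  edges := (Finset.Icc 2 k).image (fun i => {i}) ∪ (Finset.Ico 2 k).image (fun i => {i, i + 1})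

namespace CTree

mutual
/-- The representative of a non-planar construct `C` of `H_T` in which, above every vertex, the
children are listed in the left-recursive order of the root vertices of the subtrees of `T` that
they live on. -/
def canon (T : OTree) : CTree → CTree
  | node X cs => node X (T.vertices.filterMap fun u => (canonList T cs).lookup u)
def canonList (T : OTree) : List CTree → List (ℕ × CTree)
  | [] => []
  | c :: cs => (T.rootOf c.supp, canon T c) :: canonList T cs
end

mutual
/-- `C₁ •ᵢ C₂` before the choice of the representative: if, above the root of `C₁`, there is a child
living on a subtree of `T₁` that contains the vertex `i`, continue with that child; otherwise graft
`C₂` to the root.  The edges of `T₁` are renamed by `f`. -/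
def graft (T₁ : OTree) (i : ℕ) (f : ℕ → ℕ) (C₂ : CTree) : CTree → CTree
  | node X cs => node (X.image f) (graftList T₁ i f C₂ cs)
def graftList (T₁ : OTree) (i : ℕ) (f : ℕ → ℕ) (C₂ : CTree) : List CTree → List CTree
  | [] => [C₂]
  | c :: cs =>
    if i ∈ T₁.span c.supp then graft T₁ i f C₂ c :: renameList f cs
    else rename f c :: graftList T₁ i f C₂ cs
end

/-- The construct `C₁ •ᵢ C₂` of the edge-graph of `T₁ •ᵢ T₂`. -/
def bullet (T₁ : OTree) (C₁ : CTree) (i : ℕ) (T₂ : OTree) (C₂ : CTree) : CTree :=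
  canon (T₁.subst i T₂)
    (graft T₁ i (OTree.edgeName i T₂) (C₂.rename (OTree.inner i)) C₁)

mutual
/-- `C[X{Y}/W]` before the choice of the representative: the vertex `W` is split into the edge
`X{Y}`; a child of `W` stays above `Y` if the subtree of `T` it lives on has an edge sharing a
vertex with some edge of `Y`, and above `X` otherwise. -/
def splitAux (T : OTree) (W X Y : Finset ℕ) : CTree → CTree
  | node Z cs =>
    if Z = W then
      node X (node Y (cs.filter fun c => ¬ Disjoint (T.span c.supp) (T.span Y)) ::
        cs.filter fun c => Disjoint (T.span c.supp) (T.span Y))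
    else node Z (splitAuxList T W X Y cs)
def splitAuxList (T : OTree) (W X Y : Finset ℕ) : List CTree → List CTree
  | [] => []
  | c :: cs => splitAux T W X Y c :: splitAuxList T W X Y cs
end

/-- The construct `C[X{Y}/W]`. -/
def split (T : OTree) (W X Y : Finset ℕ) (C : CTree) : CTree := canon T (splitAux T W X Y C)

end CTree

/-! ## The planar trees `α(T, σ, C)` and the counts of edges and leaves that determine the signs -/

/-- Planar rooted trees with indexed leaves and decorated vertices. -/
inductive ATree
  | leaf (v : ℕ) : ATree
  | node (X : Finset ℕ) (inputs : List ATree) : ATree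

namespace ATree

/-- The decoration of the root vertex. -/
def root? : ATree → Option (Finset ℕ)
  | leaf _ => none
  | node X _ => some X

mutual
/-- The number of edges and leaves, the root included. -/
def size : ATree → ℕ
  | leaf _ => 1
  | node _ ts => 1 + sizeList ts
def sizeList : List ATree → ℕ
  | [] => 0
  | t :: ts => size t + sizeList ts
end

mutual
/-- The indices of the input leaves, from left to right. -/
def leaves : ATree → List ℕ
  | leaf v => [v]
  | node _ ts => leavesList ts
def leavesList : List ATree → List ℕ
  | [] => []
  | t :: ts => leaves t ++ leavesList ts
end

mutual
/-- The decorations of the vertices. -/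
def nodes : ATree → List (Finset ℕ)
  | leaf _ => []
  | node X ts => X :: nodesList ts
def nodesList : List ATree → List (Finset ℕ)
  | [] => []
  | t :: ts => nodes t ++ nodesList ts
end

mutual
/-- The number of edges and leaves strictly on the right of the path from the leaf `i` to the
root. -/
def right (i : ℕ) : ATree → ℕ
  | leaf _ => 0
  | node _ ts => rightList i ts
def rightList (i : ℕ) : List ATree → ℕ
  | [] => 0
  | t :: ts => if i ∈ leaves t then right i t + sizeList ts else rightList i ts
end

mutual
/-- The number of edges and leaves on the left of the edge `e` whose upper vertex is decorated by
`Y`, plus the number of internal edges below `e`. -/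
def leftBelow (Y : Finset ℕ) : ATree → ℕ
  | leaf _ => 0
  | node _ ts => leftBelowList Y ts
def leftBelowList (Y : Finset ℕ) : List ATree → ℕ
  | [] => 0
  | t :: ts =>
    if root? t = some Y then 0
    else if Y ∈ nodes t then 1 + leftBelow Y t
    else size t + leftBelowList Y ts
end

end ATree

mutual
/-- The planar tree `α(T, σ, C)`.  A vertex `X` of a construct living on the subtree `S` of `T` has
as inputs the vertices of the tree `S_X`, obtained from `S` by collapsing all edges outside of `X`,
in the left-recursive order.  These vertices are the root of `S` and the upper vertices of the edges
in `X`.  The child of `X` living on the subtree `S'` is grafted to the input `ρ(S')`. -/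
def alpha (T : OTree) : CTree → ATree
  | .node X cs =>
    .node X ((T.vertices.filter fun u => u = T.rootOf (CTree.node X cs).supp ∨ u ∈ X).map
      fun u => ((alphaList T cs).lookup u).getD (.leaf u))
def alphaList (T : OTree) : List CTree → List (ℕ × ATree)
  | [] => []
  | c :: cs => (T.rootOf c.supp, alpha T c) :: alphaList T cs
end

/-! ## The `ℕ`-coloured dg operad `O_∞` -/

section OInf

variable (𝕜 : Type u) [Field 𝕜]

/-- The vector space that contains all components of `O_∞`. -/
abbrev OInfV : Type u := (OTree × CTree) →₀ 𝕜

/-- The component `O_∞(n₁, …, n_k; n)`, spanned by the operadic trees `T` in `Tree(n₁, …, n_k; n)`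
together with a construct of the edge-graph of `T`. -/
def OInfObj (ns : List ℕ) (n : ℕ) : Submodule 𝕜 (OInfV 𝕜) :=
  Finsupp.supported 𝕜 𝕜 {b : OTree × CTree |
    b.1.IsOperadic ns n ∧ CTree.IsConstruct b.1.edgeGraph b.2 ∧ b.2.canon b.1 = b.2}

/-- The elements of degree `a`, where the degree of `(T, C)` is the number of internal edges of `T`
minus the number of vertices of `C`. -/
def OInfDeg (a : ℤ) : Submodule 𝕜 (OInfV 𝕜) :=
  Finsupp.supported 𝕜 𝕜 {b : OTree × CTree |
    (b.1.edges.length : ℤ) - (b.2.verts.length : ℤ) = a}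

/-- The partial composition
`(T₁, C₁) ∘ᵢ (T₂, C₂) = (-1)^ε (T₁ •ᵢ T₂, C₁ •ᵢ C₂)`, where `ε` is the number of edges and leaves of
`α(T₁, C₁)` on the right of the leaf `i`, times the number of edges and leaves of `α(T₂, C₂)` other
than the root. -/
noncomputable def OInfComp (i : ℕ) : OInfV 𝕜 →ₗ[𝕜] OInfV 𝕜 →ₗ[𝕜] OInfV 𝕜 :=
  Finsupp.linearCombination 𝕜 fun b : OTree × CTree =>
    Finsupp.linearCombination 𝕜 fun c : OTree × CTree =>
      Finsupp.single (b.1.subst i c.1, CTree.bullet b.1 b.2 i c.1 c.2)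
        ((-1 : 𝕜) ^ ((alpha b.1 b.2).right i * ((alpha c.1 c.2).size - 1)))

open Classical in
/-- The differential: the signed sum of all `(T, C[X{Y}/W])`, over the vertices `W` of `C` with at
least two elements and the splittings `W = X ⊔ Y` such that `X{Y}` is a construct of the
edge-graph of the tree `T_W`, obtained from `T` by collapsing all edges outside of `W`. -/
noncomputable def OInfD : OInfV 𝕜 →ₗ[𝕜] OInfV 𝕜 :=
  Finsupp.linearCombination 𝕜 fun b : OTree × CTree =>
    ∑ W ∈ b.2.verts.toFinset with 2 ≤ W.card,
      ∑ X ∈ W.powerset with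
          CTree.IsConstruct (b.1.contract W).edgeGraph (.node X [.node (W \ X) []]),
        Finsupp.single (b.1, b.2.split b.1 W X (W \ X))
          ((-1 : 𝕜) ^ (alpha b.1 (b.2.split b.1 W X (W \ X))).leftBelow (W \ X))

/-- The suboperad `𝒜_∞` of `O_∞` determined by the linear operadic trees: its component of arity
`k` is spanned by the linear operadic trees with `k` vertices together with a construct; the
grading, the compositions and the differential are those of `O_∞`. -/
noncomputable def LinearOInf : OperadData 𝕜 where
  V := OInfV 𝕜
  obj k := Finsupp.supported 𝕜 𝕜 {b : OTree × CTree |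
    b.1.IsLinear k ∧ CTree.IsConstruct b.1.edgeGraph b.2 ∧ b.2.canon b.1 = b.2}
  deg := OInfDeg 𝕜
  comp := OInfComp 𝕜
  d := OInfD 𝕜

end OInf

/-! ## The operads `A_∞` and `As` -/

/-- Planar rooted trees, the single leaf included. -/
inductive PTree
  | leaf : PTree
  | node (inputs : List PTree) : PTree

namespace PTree

mutual
/-- The number of leaves. -/
def leaves : PTree → ℕ
  | leaf => 1
  | node ts => leavesList ts
def leavesList : List PTree → ℕ
  | [] => 0
  | t :: ts => leaves t + leavesList ts
end

mutual
/-- The degree, where a vertex with `n` inputs has degree `n - 2`. -/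
def degree : PTree → ℤ
  | leaf => 0
  | node ts => (ts.length : ℤ) - 2 + degreeList ts
def degreeList : List PTree → ℤ
  | [] => 0
  | t :: ts => degree t + degreeList ts
end

/-- Every vertex has at least two inputs. -/
inductive IsReduced : PTree → Prop
  | leaf : IsReduced leaf
  | node (ts : List PTree) (hts : 2 ≤ ts.length) (h : ∀ t ∈ ts, IsReduced t) : IsReduced (node ts)

/-- The corolla with `n` inputs. -/
def corolla (n : ℕ) : PTree := node (List.replicate n leaf)

mutual
/-- Grafting of `s` to the leaf `i`. -/
def graft (i : ℕ) (s : PTree) : PTree → PTree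
  | leaf => s
  | node ts => node (graftList i s ts)
def graftList (i : ℕ) (s : PTree) : List PTree → List PTree
  | [] => []
  | t :: ts => if i ≤ leaves t then graft i s t :: ts else t :: graftList (i - leaves t) s ts
end

mutual
/-- The total degree of the vertices that come after the leaf `i` when the tree is traversed from
bottom to top and from left to right. -/
def degreeAfter (i : ℕ) : PTree → ℤ
  | leaf => 0
  | node ts => degreeAfterList i ts
def degreeAfterList (i : ℕ) : List PTree → ℤ
  | [] => 0
  | t :: ts =>
    if i ≤ leaves t then degreeAfter i t + degreeList ts else degreeAfterList (i - leaves t) ts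
end

/-- The terms of the differential of a tree with root inputs `ts` which come from the root vertex:
`n = p + q + r` inputs are replaced by `p + 1 + r`, with a new vertex with `q` inputs.  The sign
is the one of `d(t_n)`, corrected by moving the new vertex past the first `p` subtrees. -/
def rootTerms (ts : List PTree) : List (ℤˣ × PTree) :=
  (List.range (ts.length + 1)).flatMap fun p =>
    ((List.range (ts.length - p + 1)).filter fun q : ℕ => 2 ≤ q ∧ q < ts.length).map fun q : ℕ =>
      (((p : ℤ) + (q : ℤ) * (ts.length - p - q) + ((q : ℤ) - 2) * degreeList (ts.take p)).negOnePow,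
        node (ts.take p ++ node ((ts.drop p).take q) :: ts.drop (p + q)))

mutual
/-- The terms of the differential of a tree, with their signs. -/
def dTerms : PTree → List (ℤˣ × PTree)
  | leaf => []
  | node ts => rootTerms ts ++
      (dTermsList ts).map fun st => (((ts.length : ℤ) - 2).negOnePow * st.1, node st.2)
def dTermsList : List PTree → List (ℤˣ × List PTree)
  | [] => []
  | t :: ts => (dTerms t).map (fun st => (st.1, st.2 :: ts)) ++
      (dTermsList ts).map fun st => ((degree t).negOnePow * st.1, t :: st.2)
end

end PTree

section AInf

variable (𝕜 : Type u) [Field 𝕜]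

/-- The dg operad `A_∞`: the free graded operad on one generator `t_n` of degree `n - 2` for each
`n ≥ 2`, with basis the planar trees with at least one vertex, all of whose vertices have at least
two inputs.  A tree stands for the tensor product of its vertices, ordered from bottom to top and
from left to right, which determines the signs. -/
noncomputable def AInf : OperadData 𝕜 where
  V := PTree →₀ 𝕜
  obj n := Finsupp.supported 𝕜 𝕜 {t : PTree | t.IsReduced ∧ t ≠ .leaf ∧ t.leaves = n}
  deg a := Finsupp.supported 𝕜 𝕜 {t : PTree | t.degree = a}
  comp i := Finsupp.linearCombination 𝕜 fun t : PTree =>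
    Finsupp.linearCombination 𝕜 fun s : PTree =>
      (s.degree * t.degreeAfter i).negOnePow • Finsupp.single (PTree.graft i s t) (1 : 𝕜)
  d := Finsupp.linearCombination 𝕜 fun t : PTree =>
    (t.dTerms.map fun st => st.1 • Finsupp.single st.2 (1 : 𝕜)).sum

/-- The generator `t_n` of `A_∞`. -/
noncomputable def AInf.t (n : ℕ) : (AInf 𝕜).V := Finsupp.single (PTree.corolla n) (1 : 𝕜)

/-- The non-symmetric associative operad `As`: one-dimensional in every arity `n ≥ 2`, spanned by
`t_n`, with `t_m ∘ᵢ t_n = t_{m+n-1}`, in degree zero and with zero differential. -/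
noncomputable def As : OperadData 𝕜 where
  V := ℕ →₀ 𝕜
  obj n := Finsupp.supported 𝕜 𝕜 {m : ℕ | m = n ∧ 2 ≤ n}
  deg a := if a = 0 then ⊤ else ⊥
  comp _ := Finsupp.linearCombination 𝕜 fun m : ℕ =>
    Finsupp.linearCombination 𝕜 fun n : ℕ => Finsupp.single (m + n - 1) (1 : 𝕜)
  d := 0

end AInf

end OInfinity

namespace OInfinity

-- Grafting of planar trees: leaves, degrees and the two associativity laws.

namespace PTree

-- The vertices of a linear tree behave like the leaves of a planar tree, and its internal edges
-- like the gaps between neighbouring leaves. A reduced planar tree with `k ≥ 2` leaves gives a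
-- construct of the path with `k - 1` vertices: decorate each vertex by the gaps that separate its
-- inputs, and drop the leaves (`PTree.toC`). Removing a set of gaps from a path leaves intervals,
-- one for each input that is not a leaf, so every construct arises in this way
-- (`isConstruct_lin_iff`), and the planar tree is read off again from `α` (`alpha_toC`). Under this
-- correspondence `C₁ •ᵢ C₂` is grafting at the leaf `i` (`bullet_toC`). Splitting a vertex `W` into
-- `X{Y}` means choosing a non-empty proper interval `Y` of gaps in `W`, that is, a block of at
-- least two but not all inputs that moves to a new vertex; these are the terms of the differential
-- of `A_∞`.
--
-- The two operads differ in their signs. `A_∞` reads the vertices of a tree from bottom to top and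
-- from left to right, whereas `O_∞` counts edges and leaves of `α`. The discrepancy is a sign
-- `(-1)^(shift t)` attached to each tree: `shift_graft` shows how it accounts for the signs of
-- compositions, and the field `Matches.sign` does the same for the differential. Hence `t ↦
-- (-1)^(shift t) (lin, toC t)` is an isomorphism (`isEquivalence_toOInfLin`), and it suffices to
-- prove the operad axioms, freeness and the quasi-isomorphism for `A_∞` and to transport them.
--
-- For `A_∞`, the differential is a derivation by a tree induction (`signedSum_dTerms_graft`), so
-- `d² = 0` need only be checked on corollas, where the terms cancel in pairs by the sequential and
-- parallel axioms (`treeD_treeD_gen`). Freeness holds because a tree can be evaluated in any operad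
-- by iterated composition (`treeEval_graft`), and because corollas generate all trees
-- (`basisTrees_induction`).
--
-- The map to `As` sends `t_2` to `t_2` and the other generators to zero. For its effect on
-- homology, pair a tree whose root has inputs `c, d_1, …, d_r` with `r ≥ 2` with the tree whose
-- binary root has inputs `c` and a vertex carrying `d_1, …, d_r`. The second is the leading term of
-- the differential of the first, when right trees are ordered by the number of leaves of their
-- first input (`exists_treeD_eq`). The unpaired trees are binary at the root with a leaf as second
-- input; adding this leaf commutes with `d`, so they form a copy of the complex one arity lower. By
-- induction every cycle is homologous to a multiple of the left comb (`exists_eq_comb_add_treeD`),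
-- and the comb is mapped to the basis element of `As`.

theorem forall_of_node {motive : PTree → Prop} (leaf : motive leaf)
    (node : ∀ ts : List PTree, (∀ t ∈ ts, motive t) → motive (node ts)) : ∀ t, motive t :=
  PTree.rec (motive_1 := motive) (motive_2 := fun ts => ∀ t ∈ ts, motive t) leaf node
    (by simp) (fun t ts ht hts => by simpa using ⟨ht, hts⟩)

@[simp] theorem leaves_leaf : leaves leaf = 1 := rfl
@[simp] theorem leaves_node (ts) : leaves (node ts) = leavesList ts := by simp [leaves]
@[simp] theorem leavesList_nil : leavesList [] = 0 := rfl
@[simp] theorem leavesList_cons (t ts) : leavesList (t :: ts) = leaves t + leavesList ts := by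
  simp [leavesList]
@[simp] theorem degree_leaf : degree leaf = 0 := rfl
theorem degree_node (ts) : degree (node ts) = (ts.length : ℤ) - 2 + degreeList ts := by
  simp [degree]
@[simp] theorem degreeList_nil : degreeList [] = 0 := rfl
@[simp] theorem degreeList_cons (t ts) : degreeList (t :: ts) = degree t + degreeList ts := by
  simp [degreeList]
@[simp] theorem graft_leaf (i s) : graft i s leaf = s := by simp [graft]
@[simp] theorem graft_node (i s ts) : graft i s (node ts) = node (graftList i s ts) := by
  simp [graft]
@[simp] theorem graftList_nil (i s) : graftList i s [] = [] := by simp [graftList]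
theorem graftList_cons (i s t ts) : graftList i s (t :: ts) =
    if i ≤ leaves t then graft i s t :: ts else t :: graftList (i - leaves t) s ts := by
  simp [graftList]
@[simp] theorem degreeAfter_leaf (i) : degreeAfter i leaf = 0 := by simp [degreeAfter]
@[simp] theorem degreeAfter_node (i ts) : degreeAfter i (node ts) = degreeAfterList i ts := by
  simp [degreeAfter]
@[simp] theorem degreeAfterList_nil (i) : degreeAfterList i [] = 0 := by simp [degreeAfterList]
theorem degreeAfterList_cons (i t ts) : degreeAfterList i (t :: ts) =
    if i ≤ leaves t then degreeAfter i t + degreeList ts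
    else degreeAfterList (i - leaves t) ts := by
  simp [degreeAfterList]

@[simp] theorem leavesList_append (as bs) :
    leavesList (as ++ bs) = leavesList as + leavesList bs := by
  induction as with
  | nil => simp
  | cons a as ih => simp [ih, add_assoc]

@[simp] theorem degreeList_append (as bs) :
    degreeList (as ++ bs) = degreeList as + degreeList bs := by
  induction as with
  | nil => simp
  | cons a as ih => simp [ih, add_assoc]

theorem graftList_append_left (s as bs) {i : ℕ} (hi : 1 ≤ i) (h : i ≤ leavesList as) :
    graftList i s (as ++ bs) = graftList i s as ++ bs := by
  induction as generalizing i with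
  | nil => simp at h; omega
  | cons a as ih =>
    simp only [List.cons_append, graftList_cons, leavesList_cons] at h ⊢
    split_ifs with h'
    · rfl
    · rw [ih (by omega) (by omega), List.cons_append]

theorem graftList_append_right (s as bs) {i : ℕ} (h : leavesList as < i) :
    graftList i s (as ++ bs) = as ++ graftList (i - leavesList as) s bs := by
  induction as generalizing i with
  | nil => simp
  | cons a as ih =>
    simp only [List.cons_append, graftList_cons, leavesList_cons] at h ⊢
    rw [if_neg (by omega), ih (by omega), Nat.sub_sub]

theorem degreeAfterList_append_left (as bs) {i : ℕ} (hi : 1 ≤ i) (h : i ≤ leavesList as) :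
    degreeAfterList i (as ++ bs) = degreeAfterList i as + degreeList bs := by
  induction as generalizing i with
  | nil => simp at h; omega
  | cons a as ih =>
    simp only [List.cons_append, degreeAfterList_cons, leavesList_cons] at h ⊢
    split_ifs with h'
    · rw [degreeList_append, add_assoc]
    · rw [ih (by omega) (by omega)]

theorem degreeAfterList_append_right (as bs) {i : ℕ} (h : leavesList as < i) :
    degreeAfterList i (as ++ bs) = degreeAfterList (i - leavesList as) bs := by
  induction as generalizing i with
  | nil => simp
  | cons a as ih =>
    simp only [List.cons_append, degreeAfterList_cons, leavesList_cons] at h ⊢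
    rw [if_neg (by omega), ih (by omega), Nat.sub_sub]

@[simp] theorem length_graftList (i s ts) : (graftList i s ts).length = ts.length := by
  induction ts generalizing i with
  | nil => simp
  | cons a as ih =>
    rw [graftList_cons]
    split_ifs <;> simp [ih]

mutual
theorem leaves_graft (s : PTree) : ∀ (t : PTree) {i : ℕ}, 1 ≤ i → i ≤ leaves t →
    leaves (graft i s t) + 1 = leaves t + leaves s
  | leaf, i, _, _ => by simp; omega
  | node ts, i, h1, h2 => by
    simpa using leavesList_graftList s ts h1 (by simpa using h2)
theorem leavesList_graftList (s : PTree) : ∀ (ts : List PTree) {i : ℕ}, 1 ≤ i →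
    i ≤ leavesList ts → leavesList (graftList i s ts) + 1 = leavesList ts + leaves s
  | [], i, h1, h2 => by simp at h2; omega
  | t :: ts, i, h1, h2 => by
    simp only [leavesList_cons, graftList_cons] at h2 ⊢
    split_ifs with h
    · have := leaves_graft s t h1 h
      simp; omega
    · have := leavesList_graftList s ts (i := i - leaves t) (by omega) (by omega)
      simp; omega
end

mutual
theorem degree_graft (s : PTree) : ∀ (t : PTree) {i : ℕ}, 1 ≤ i → i ≤ leaves t →
    degree (graft i s t) = degree t + degree s
  | leaf, i, _, _ => by simp
  | node ts, i, h1, h2 => by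
    have := degreeList_graftList s ts h1 (by simpa using h2)
    simp [degree_node, this, add_assoc]
theorem degreeList_graftList (s : PTree) : ∀ (ts : List PTree) {i : ℕ}, 1 ≤ i →
    i ≤ leavesList ts → degreeList (graftList i s ts) = degreeList ts + degree s
  | [], i, h1, h2 => by simp at h2; omega
  | t :: ts, i, h1, h2 => by
    simp only [leavesList_cons, graftList_cons] at h2 ⊢
    split_ifs with h
    · have := degree_graft s t h1 h
      simp [this]; ring
    · have := degreeList_graftList s ts (i := i - leaves t) (by omega) (by omega)
      simp [this]; ring
end

theorem isReduced_node_iff (ts) :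
    IsReduced (node ts) ↔ 2 ≤ ts.length ∧ ∀ t ∈ ts, IsReduced t :=
  ⟨fun h => by cases h with | node _ h1 h2 => exact ⟨h1, h2⟩, fun h => .node _ h.1 h.2⟩

mutual
theorem isReduced_graft {s : PTree} (hs : s.IsReduced) : ∀ {t : PTree} (i : ℕ), t.IsReduced →
    (graft i s t).IsReduced
  | leaf, i, _ => by simpa using hs
  | node ts, i, h => by
    rw [isReduced_node_iff] at h
    rw [graft_node, isReduced_node_iff]
    exact ⟨by simpa using h.1, isReduced_of_mem_graftList hs i h.2⟩
theorem isReduced_of_mem_graftList {s : PTree} (hs : s.IsReduced) : ∀ {ts : List PTree} (i : ℕ),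
    (∀ t ∈ ts, t.IsReduced) → ∀ t ∈ graftList i s ts, t.IsReduced
  | [], i, h => by simp
  | t :: ts, i, h => by
    simp only [List.forall_mem_cons] at h
    rw [graftList_cons]
    split_ifs
    · exact List.forall_mem_cons.2 ⟨isReduced_graft hs i h.1, h.2⟩
    · exact List.forall_mem_cons.2 ⟨h.1, isReduced_of_mem_graftList hs _ h.2⟩
end

theorem length_le_leavesList {ts : List PTree} (h : ∀ t ∈ ts, 1 ≤ leaves t) :
    ts.length ≤ leavesList ts := by
  induction ts with
  | nil => simp
  | cons t ts ih =>
    simp only [List.forall_mem_cons] at h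
    have := ih h.2
    simp; omega

theorem IsReduced.one_le_leaves {t : PTree} : t.IsReduced → 1 ≤ t.leaves := by
  induction t using forall_of_node with
  | leaf => simp
  | node ts ih =>
    intro h
    rw [isReduced_node_iff] at h
    have := length_le_leavesList fun t ht => ih t ht (h.2 t ht)
    simp; omega

theorem IsReduced.two_le_leaves {t : PTree} (h : t.IsReduced) (ht : t ≠ PTree.leaf) : 2 ≤ t.leaves := by
  cases t with
  | leaf => exact absurd rfl ht
  | node ts =>
    rw [isReduced_node_iff] at h
    have := length_le_leavesList fun t ht => (h.2 t ht).one_le_leaves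
    simp; omega

mutual
-- Exactly `i - 1` leaves of `t` precede the inserted copy of `s`, so its leaf `j` becomes the leaf
-- `i - 1 + j`.
theorem graft_seq (s u : PTree) {j : ℕ} (hj : 1 ≤ j) (hj' : j ≤ leaves s) : ∀ (t : PTree) {i : ℕ},
    1 ≤ i → i ≤ leaves t → graft (i - 1 + j) u (graft i s t) = graft i (graft j u s) t
  | leaf, i, h1, h2 => by
    have : i = 1 := by simp at h2; omega
    simp [this]
  | node ts, i, h1, h2 => by
    simpa using graftList_seq s u hj hj' ts h1 (by simpa using h2)
theorem graftList_seq (s u : PTree) {j : ℕ} (hj : 1 ≤ j) (hj' : j ≤ leaves s) :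
    ∀ (ts : List PTree) {i : ℕ}, 1 ≤ i → i ≤ leavesList ts →
      graftList (i - 1 + j) u (graftList i s ts) = graftList i (graft j u s) ts
  | [], i, h1, h2 => by simp
  | t :: ts, i, h1, h2 => by
    simp only [leavesList_cons, graftList_cons] at h2 ⊢
    split_ifs with h
    · have := leaves_graft s t h1 h
      rw [graftList_cons, if_pos (by omega), graft_seq s u hj hj' t h1 h]
    · rw [graftList_cons, if_neg (by omega),
        ← graftList_seq s u hj hj' ts (i := i - leaves t) (by omega) (by omega)]
      congr 2; omega
end

mutual
-- After the leaf `j` of the inserted `s` one reads the rest of `s`, and then whatever followed the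
-- leaf `i` of `t`.
theorem degreeAfter_graft_seq (s : PTree) {j : ℕ} (hj : 1 ≤ j) (hj' : j ≤ leaves s) :
    ∀ (t : PTree) {i : ℕ}, 1 ≤ i → i ≤ leaves t →
      degreeAfter (i - 1 + j) (graft i s t) = degreeAfter j s + degreeAfter i t
  | leaf, i, h1, h2 => by
    have : i = 1 := by simp at h2; omega
    simp [this]
  | node ts, i, h1, h2 => by
    simpa using degreeAfterList_graftList_seq s hj hj' ts h1 (by simpa using h2)
theorem degreeAfterList_graftList_seq (s : PTree) {j : ℕ} (hj : 1 ≤ j) (hj' : j ≤ leaves s) :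
    ∀ (ts : List PTree) {i : ℕ}, 1 ≤ i → i ≤ leavesList ts →
      degreeAfterList (i - 1 + j) (graftList i s ts) = degreeAfter j s + degreeAfterList i ts
  | [], i, h1, h2 => by simp at h2; omega
  | t :: ts, i, h1, h2 => by
    simp only [leavesList_cons, graftList_cons, degreeAfterList_cons i] at h2 ⊢
    split_ifs with h
    · have := leaves_graft s t h1 h
      rw [degreeAfterList_cons, if_pos (by omega), degreeAfter_graft_seq s hj hj' t h1 h, add_assoc]
    · rw [degreeAfterList_cons, if_neg (by omega),
        ← degreeAfterList_graftList_seq s hj hj' ts (i := i - leaves t) (by omega) (by omega)]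
      congr 1; omega
end

mutual
-- Graftings at distinct leaves do not interact; inserting `s` on the left only replaces one leaf by
-- `leaves s` of them, which moves `j`.
theorem graft_par (s u : PTree) : ∀ (t : PTree) {i j : ℕ}, 1 ≤ i → i < j → j ≤ leaves t →
    graft (j - 1 + leaves s) u (graft i s t) = graft i s (graft j u t)
  | leaf, i, j, h1, h2, h3 => by simp at h3; omega
  | node ts, i, j, h1, h2, h3 => by
    simpa using graftList_par s u ts h1 h2 (by simpa using h3)
theorem graftList_par (s u : PTree) : ∀ (ts : List PTree) {i j : ℕ}, 1 ≤ i → i < j →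
    j ≤ leavesList ts →
      graftList (j - 1 + leaves s) u (graftList i s ts) = graftList i s (graftList j u ts)
  | [], i, j, h1, h2, h3 => by simp
  | t :: ts, i, j, h1, h2, h3 => by
    simp only [leavesList_cons, graftList_cons i s t, graftList_cons j u t] at h3 ⊢
    by_cases hi : i ≤ leaves t
    · have hl := leaves_graft s t h1 hi
      rw [if_pos hi]
      by_cases hj : j ≤ leaves t
      · have hl' := leaves_graft u t (by omega) hj
        by_cases hu : i ≤ leaves (graft j u t)
        · rw [graftList_cons, if_pos (by omega), if_pos hj, graftList_cons, if_pos hu,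
            graft_par s u t h1 h2 hj]
        · omega
      · rw [graftList_cons, if_neg (by omega), if_neg hj, graftList_cons, if_pos hi]
        congr 2; omega
    · rw [if_neg hi, if_neg (by omega), graftList_cons, if_neg (by omega), graftList_cons,
        if_neg hi, ← graftList_par s u ts (i := i - leaves t) (j := j - leaves t) (by omega)
        (by omega) (by omega)]
      congr 2; omega
end

mutual
-- A tree inserted to the left is read before the leaf `j` and is not counted. The asymmetry with
-- `degreeAfter_graft_of_gt` is the source of the Koszul sign in the parallel axiom.
theorem degreeAfter_graft_of_lt (s : PTree) : ∀ (t : PTree) {i j : ℕ}, 1 ≤ i → i < j →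
    j ≤ leaves t → degreeAfter (j - 1 + leaves s) (graft i s t) = degreeAfter j t
  | leaf, i, j, h1, h2, h3 => by simp at h3; omega
  | node ts, i, j, h1, h2, h3 => by
    simpa using degreeAfterList_graftList_of_lt s ts h1 h2 (by simpa using h3)
theorem degreeAfterList_graftList_of_lt (s : PTree) : ∀ (ts : List PTree) {i j : ℕ}, 1 ≤ i →
    i < j → j ≤ leavesList ts →
      degreeAfterList (j - 1 + leaves s) (graftList i s ts) = degreeAfterList j ts
  | [], i, j, h1, h2, h3 => by simp
  | t :: ts, i, j, h1, h2, h3 => by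
    simp only [leavesList_cons, graftList_cons i s t, degreeAfterList_cons j t] at h3 ⊢
    by_cases hi : i ≤ leaves t
    · have hl := leaves_graft s t h1 hi
      rw [if_pos hi]
      by_cases hj : j ≤ leaves t
      · rw [degreeAfterList_cons, if_pos (by omega), if_pos hj,
          degreeAfter_graft_of_lt s t h1 h2 hj]
      · rw [degreeAfterList_cons, if_neg (by omega), if_neg hj]
        congr 1; omega
    · rw [if_neg hi, if_neg (by omega), degreeAfterList_cons, if_neg (by omega),
        ← degreeAfterList_graftList_of_lt s ts (i := i - leaves t) (j := j - leaves t) (by omega)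
        (by omega) (by omega)]
      congr 1; omega
end

mutual
-- A tree inserted to the right is read after the leaf `i`, so its whole degree is added.
theorem degreeAfter_graft_of_gt (u : PTree) : ∀ (t : PTree) {i j : ℕ}, 1 ≤ i → i < j →
    j ≤ leaves t → 1 ≤ leaves u → degreeAfter i (graft j u t) = degreeAfter i t + degree u
  | leaf, i, j, h1, h2, h3, _ => by simp at h3; omega
  | node ts, i, j, h1, h2, h3, hu => by
    simpa using degreeAfterList_graftList_of_gt u ts h1 h2 (by simpa using h3) hu
theorem degreeAfterList_graftList_of_gt (u : PTree) : ∀ (ts : List PTree) {i j : ℕ}, 1 ≤ i →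
    i < j → j ≤ leavesList ts → 1 ≤ leaves u →
      degreeAfterList i (graftList j u ts) = degreeAfterList i ts + degree u
  | [], i, j, h1, h2, h3, hu => by simp at h3; omega
  | t :: ts, i, j, h1, h2, h3, hu => by
    simp only [leavesList_cons, graftList_cons j u t, degreeAfterList_cons i t] at h3 ⊢
    by_cases hj : j ≤ leaves t
    · have hl := leaves_graft u t (by omega) hj
      rw [if_pos hj, if_pos (by omega), degreeAfterList_cons, if_pos (by omega),
        degreeAfter_graft_of_gt u t h1 h2 hj hu]
      ring
    · rw [if_neg hj, degreeAfterList_cons]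
      by_cases hi : i ≤ leaves t
      · rw [if_pos hi, if_pos hi, degreeList_graftList u ts (by omega) (by omega)]
        ring
      · rw [if_neg hi, if_neg hi, degreeAfterList_graftList_of_gt u ts (i := i - leaves t)
          (j := j - leaves t) (by omega) (by omega) (by omega) hu]
end

end PTree
end OInfinity
namespace OInfinity

-- Linear algebra on spaces with a basis.

section Supported

variable {𝕜 : Type u} [Field 𝕜] {α : Type*}

-- Reduces linear identities on an arity component to its basis elements; the motive may depend on
-- membership, which lets the two arguments of a composition be treated one after the other.
@[elab_as_elim]
theorem supported_induction {S : Set α} {p : ∀ x : α →₀ 𝕜, x ∈ Finsupp.supported 𝕜 𝕜 S → Prop}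
    (zero : p 0 (zero_mem _))
    (add : ∀ x y hx hy, p x hx → p y hy → p (x + y) (add_mem hx hy))
    (smul : ∀ (c : 𝕜) x hx, p x hx → p (c • x) (Submodule.smul_mem _ c hx))
    (single : ∀ a (ha : a ∈ S), p (Finsupp.single a 1) (Finsupp.single_mem_supported 𝕜 1 ha))
    {x : α →₀ 𝕜} (hx : x ∈ Finsupp.supported 𝕜 𝕜 S) : p x hx := by
  have key : ∃ h : x ∈ Finsupp.supported 𝕜 𝕜 S, p x h := by
    have hx' := hx
    rw [Finsupp.supported_eq_span_single] at hx'
    induction hx' using Submodule.span_induction with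
    | mem x h => obtain ⟨a, ha, rfl⟩ := h; exact ⟨_, single a ha⟩
    | zero => exact ⟨_, zero⟩
    | add x y h1 h2 ih1 ih2 =>
      rw [← Finsupp.supported_eq_span_single] at h1 h2
      exact ⟨_, add x y h1 h2 (ih1 h1).2 (ih2 h2).2⟩
    | smul c x h1 ih =>
      rw [← Finsupp.supported_eq_span_single] at h1
      exact ⟨_, smul c x h1 (ih h1).2⟩
  exact key.2

@[elab_as_elim]
theorem basis_induction {p : (α →₀ 𝕜) → Prop} (zero : p 0)
    (add : ∀ x y, p x → p y → p (x + y)) (smul : ∀ (c : 𝕜) x, p x → p (c • x))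
    (single : ∀ a, p (Finsupp.single a 1)) (x : α →₀ 𝕜) : p x := by
  induction x using Finsupp.induction_linear with
  | zero => exact zero
  | add x y h h' => exact add x y h h'
  | single a c => simpa using smul c _ (single a)

theorem supported_le_iSup (S : Set α) (δ : α → ℤ) :
    Finsupp.supported 𝕜 𝕜 S ≤
      ⨆ a, Finsupp.supported 𝕜 𝕜 S ⊓ Finsupp.supported 𝕜 𝕜 {x | δ x = a} := by
  simp only [← Finsupp.supported_inter, ← Finsupp.supported_iUnion]
  exact Finsupp.supported_mono fun x hx => Set.mem_iUnion.2 ⟨δ x, hx, rfl⟩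

theorem iSupIndep_supported (S : Set α) (δ : α → ℤ) :
    iSupIndep fun a => Finsupp.supported 𝕜 𝕜 S ⊓ Finsupp.supported 𝕜 𝕜 {x | δ x = a} := by
  intro a
  have h : (⨆ b, ⨆ (_ : b ≠ a), Finsupp.supported 𝕜 𝕜 S ⊓ Finsupp.supported 𝕜 𝕜 {x | δ x = b}) ≤
      Finsupp.supported 𝕜 𝕜 {x | δ x ≠ a} :=
    iSup₂_le fun b hb => inf_le_right.trans (Finsupp.supported_mono fun x hx hxa =>
      hb (hx.symm.trans hxa))
  refine Disjoint.mono inf_le_right h (Finsupp.disjoint_supported_supported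
    (Set.disjoint_left.2 fun x hx hx' => hx' hx))

theorem units_smul_mem {M : Type*} [AddCommGroup M] [Module 𝕜 M] (N : Submodule 𝕜 M) {x : M}
    (u : ℤˣ) (hx : x ∈ N) : u • x ∈ N := by
  rw [Units.smul_def]; exact zsmul_mem hx _

theorem map_units_smul' {M N : Type*} [AddCommGroup M] [Module 𝕜 M] [AddCommGroup N] [Module 𝕜 N]
    (f : M →ₗ[𝕜] N) (u : ℤˣ) (x : M) : f (u • x) = u • f x := by
  rw [Units.smul_def, Units.smul_def, map_zsmul]

theorem negOnePow_eq_of_even_sub {a b : ℤ} (h : Even (a - b)) : a.negOnePow = b.negOnePow :=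
  (Int.negOnePow_eq_iff a b).2 h

end Supported

-- Planar trees as a graded operad.

section AInfModel

variable (𝕜 : Type u) [Field 𝕜]

/-- The signed grafting of trees, on the vector space spanned by all planar trees. -/
noncomputable def treeComp (i : ℕ) : (PTree →₀ 𝕜) →ₗ[𝕜] (PTree →₀ 𝕜) →ₗ[𝕜] (PTree →₀ 𝕜) :=
  Finsupp.linearCombination 𝕜 fun t : PTree =>
    Finsupp.linearCombination 𝕜 fun s : PTree =>
      (s.degree * t.degreeAfter i).negOnePow • Finsupp.single (PTree.graft i s t) (1 : 𝕜)

/-- The trees that form the basis of `AInf` in arity `n`. -/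
def basisTrees (n : ℕ) : Set PTree := {t | t.IsReduced ∧ t ≠ .leaf ∧ t.leaves = n}

variable {𝕜}

theorem treeComp_single (i : ℕ) (t s : PTree) :
    treeComp 𝕜 i (Finsupp.single t 1) (Finsupp.single s 1) =
      (s.degree * t.degreeAfter i).negOnePow • Finsupp.single (PTree.graft i s t) (1 : 𝕜) := by
  simp [treeComp]

theorem graft_mem_basisTrees {m n i : ℕ} {t s : PTree} (hi : 1 ≤ i) (him : i ≤ m)
    (ht : t ∈ basisTrees m) (hs : s ∈ basisTrees n) :
    PTree.graft i s t ∈ basisTrees (m + n - 1) := by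
  obtain ⟨h1, h2, rfl⟩ := ht
  obtain ⟨h3, h4, rfl⟩ := hs
  refine ⟨PTree.isReduced_graft h3 i h1, ?_, ?_⟩
  · cases t with
    | leaf => exact absurd rfl h2
    | node ts => simp
  · have := PTree.leaves_graft s t hi him; omega

/-- The trees that form the basis of `AInf` in arity `n` and degree `a`. -/
def basisTreesDeg (n : ℕ) (a : ℤ) : Set PTree := basisTrees n ∩ {t | t.degree = a}

variable (𝕜) in
theorem AInf_obj_inf_deg (n : ℕ) (a : ℤ) :
    (AInf 𝕜).obj n ⊓ (AInf 𝕜).deg a = Finsupp.supported 𝕜 𝕜 (basisTreesDeg n a) :=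
  (Finsupp.supported_inter _ _).symm

theorem treeComp_mem {m n i : ℕ} {x y : PTree →₀ 𝕜} (hi : 1 ≤ i) (him : i ≤ m)
    (hx : x ∈ Finsupp.supported 𝕜 𝕜 (basisTrees m))
    (hy : y ∈ Finsupp.supported 𝕜 𝕜 (basisTrees n)) :
    treeComp 𝕜 i x y ∈ Finsupp.supported 𝕜 𝕜 (basisTrees (m + n - 1)) := by
  induction hx using supported_induction with
  | zero => simp
  | add x y _ _ h1 h2 => simpa using add_mem h1 h2
  | smul c x _ h => simpa using Submodule.smul_mem _ c h
  | single t ht =>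
    induction hy using supported_induction with
    | zero => simp
    | add x y _ _ h1 h2 => simpa using add_mem h1 h2
    | smul c x _ h => simpa using Submodule.smul_mem _ c h
    | single s hs =>
      rw [treeComp_single]
      exact units_smul_mem _ _ (Finsupp.single_mem_supported _ _
        (graft_mem_basisTrees hi him ht hs))

theorem treeComp_deg {m n i : ℕ} {a b : ℤ} {x y : PTree →₀ 𝕜} (hi : 1 ≤ i) (him : i ≤ m)
    (hx : x ∈ Finsupp.supported 𝕜 𝕜 (basisTreesDeg m a))
    (hy : y ∈ Finsupp.supported 𝕜 𝕜 (basisTreesDeg n b)) :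
    treeComp 𝕜 i x y ∈ Finsupp.supported 𝕜 𝕜 {t : PTree | t.degree = a + b} := by
  induction hx using supported_induction with
  | zero => simp
  | add x y _ _ h1 h2 => simpa using add_mem h1 h2
  | smul c x _ h => simpa using Submodule.smul_mem _ c h
  | single t ht =>
    induction hy using supported_induction with
    | zero => simp
    | add x y _ _ h1 h2 => simpa using add_mem h1 h2
    | smul c x _ h => simpa using Submodule.smul_mem _ c h
    | single s hs =>
      rw [treeComp_single]
      obtain ⟨⟨h1, h2, rfl⟩, rfl⟩ := ht
      obtain ⟨-, rfl⟩ := hs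
      exact units_smul_mem _ _ (Finsupp.single_mem_supported _ _ (PTree.degree_graft s t hi him))

theorem treeComp_seq {m n i j : ℕ} {x y z : PTree →₀ 𝕜} (hi : 1 ≤ i) (him : i ≤ m)
    (hj : 1 ≤ j) (hjn : j ≤ n)
    (hx : x ∈ Finsupp.supported 𝕜 𝕜 (basisTrees m))
    (hy : y ∈ Finsupp.supported 𝕜 𝕜 (basisTrees n)) :
    treeComp 𝕜 (i - 1 + j) (treeComp 𝕜 i x y) z = treeComp 𝕜 i x (treeComp 𝕜 j y z) := by
  induction hx using supported_induction with
  | zero => simp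
  | add x y _ _ h1 h2 => simp [h1, h2]
  | smul c x _ h => simp [h]
  | single t ht =>
    induction hy using supported_induction with
    | zero => simp
    | add x y _ _ h1 h2 => simp [h1, h2]
    | smul c x _ h => simp [h]
    | single s hs =>
      induction z using basis_induction with
      | zero => simp
      | add x y h1 h2 => simp [h1, h2]
      | smul c x h => simp [h]
      | single u =>
        obtain ⟨h1, h2, rfl⟩ := ht
        obtain ⟨h3, h4, rfl⟩ := hs
        rw [treeComp_single, treeComp_single, map_units_smul', LinearMap.map_smul_of_tower,
          LinearMap.smul_apply, treeComp_single, treeComp_single, smul_smul, smul_smul,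
          ← Int.negOnePow_add, ← Int.negOnePow_add, PTree.graft_seq s u hj hjn t hi him,
          PTree.degreeAfter_graft_seq s hj hjn t hi him, PTree.degree_graft u s hj hjn]
        congr 2; ring

/-- The underlying trees agree; only when the right-hand tree is grafted first does the left-hand
one have to move past it, and this costs the sign of the product of their degrees. -/
theorem treeComp_par {m n p i j : ℕ} {b c : ℤ} {x y z : PTree →₀ 𝕜} (hi : 1 ≤ i) (hij : i < j)
    (hjm : j ≤ m)
    (hx : x ∈ Finsupp.supported 𝕜 𝕜 (basisTrees m))
    (hy : y ∈ Finsupp.supported 𝕜 𝕜 (basisTreesDeg n b))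
    (hz : z ∈ Finsupp.supported 𝕜 𝕜 (basisTreesDeg p c)) :
    treeComp 𝕜 (j - 1 + n) (treeComp 𝕜 i x y) z =
      (b * c).negOnePow • treeComp 𝕜 i (treeComp 𝕜 j x z) y := by
  induction hx using supported_induction with
  | zero => simp
  | add x y _ _ h1 h2 => simp [h1, h2]
  | smul c x _ h =>
    simp only [map_smul, LinearMap.smul_apply, h]
    rw [smul_comm]
  | single t ht =>
    induction hy using supported_induction with
    | zero => simp
    | add x y _ _ h1 h2 => simp [h1, h2]
    | smul c x _ h =>
      simp only [map_smul, LinearMap.smul_apply, h]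
      rw [smul_comm]
    | single s hs =>
      induction hz using supported_induction with
      | zero => simp
      | add x y _ _ h1 h2 => simp [h1, h2]
      | smul c x _ h =>
        simp only [map_smul, LinearMap.smul_apply, h]
        rw [smul_comm]
      | single u hu =>
        obtain ⟨h1, h2, rfl⟩ := ht
        obtain ⟨⟨h3, h4, rfl⟩, rfl⟩ := hs
        obtain ⟨⟨h5, h6, rfl⟩, rfl⟩ := hu
        rw [treeComp_single, treeComp_single, LinearMap.map_smul_of_tower,
          LinearMap.smul_apply, LinearMap.map_smul_of_tower, LinearMap.smul_apply, treeComp_single,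
          treeComp_single, smul_smul, smul_smul, smul_smul,
          ← Int.negOnePow_add, ← Int.negOnePow_add, ← Int.negOnePow_add,
          PTree.graft_par s u t hi hij hjm,
          PTree.degreeAfter_graft_of_lt s t hi hij hjm,
          PTree.degreeAfter_graft_of_gt u t hi hij hjm h5.one_le_leaves]
        congr 1
        apply negOnePow_eq_of_even_sub
        -- The two exponents differ by `-2 |s| |u|`: once from the Koszul sign of the axiom, once
        -- from `degreeAfter_graft_of_gt`.
        refine ⟨-(s.degree * u.degree), ?_⟩
        ring

theorem AInf_isGradedOperad : (AInf 𝕜).IsGradedOperad where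
  le_iSup_deg n := supported_le_iSup (𝕜 := 𝕜) (basisTrees n) PTree.degree
  independent n := iSupIndep_supported (𝕜 := 𝕜) (basisTrees n) PTree.degree
  comp_mem := treeComp_mem
  comp_deg {m n i a b x y} hi him hx hy := by
    rw [AInf_obj_inf_deg] at hx hy
    exact treeComp_deg hi him hx hy
  comp_seq hi him hj hjn hx hy _ := treeComp_seq hi him hj hjn hx hy
  comp_par {m n p i j b c x y z} hi hij hjm hx hy hz := by
    rw [AInf_obj_inf_deg] at hy hz
    exact treeComp_par hi hij hjm hx hy hz

end AInfModel
end OInfinity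
namespace OInfinity

-- The differential on planar trees and the derivation rule.

namespace PTree

/-- The pairs `(p, q)` that index the terms of the differential of a corolla with `n` inputs. -/
def splitIndex (n : ℕ) : List (ℕ × ℕ) :=
  (List.range (n + 1)).flatMap fun p =>
    ((List.range (n - p + 1)).filter fun q : ℕ => 2 ≤ q ∧ q < n).map fun q => (p, q)

theorem mem_splitIndex {n p q : ℕ} : (p, q) ∈ splitIndex n ↔ 2 ≤ q ∧ q < n ∧ p + q ≤ n := by
  simp only [splitIndex, List.mem_flatMap, List.mem_range, List.mem_map, List.mem_filter,
    Prod.mk.injEq, decide_eq_true_eq]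
  constructor
  · rintro ⟨p', hp, q', ⟨h1, h2, h3⟩, rfl, rfl⟩
    omega
  · rintro ⟨h1, h2, h3⟩
    exact ⟨p, by omega, q, ⟨by omega, h1, h2⟩, rfl, rfl⟩

theorem nodup_splitIndex (n : ℕ) : (splitIndex n).Nodup := by
  rw [splitIndex, List.nodup_flatMap]
  refine ⟨fun p _ => ((List.nodup_range).filter _).map fun a b h => (Prod.mk.inj h).2, ?_⟩
  refine (List.nodup_range (n := n + 1)).imp ?_
  intro a b hab
  rw [Function.onFun, List.disjoint_left]
  rintro ⟨p, q⟩ h1 h2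
  simp only [List.mem_map, Prod.mk.injEq] at h1 h2
  obtain ⟨_, _, rfl, _⟩ := h1
  obtain ⟨_, _, rfl, _⟩ := h2
  exact hab rfl

/-- The term of the differential in which the inputs `p + 1, …, p + q` of the root are moved to a
new vertex. -/
def rootTerm (ts : List PTree) (p q : ℕ) : ℤˣ × PTree :=
  (((p : ℤ) + (q : ℤ) * (ts.length - p - q) + ((q : ℤ) - 2) * degreeList (ts.take p)).negOnePow,
    node (ts.take p ++ node ((ts.drop p).take q) :: ts.drop (p + q)))

theorem rootTerms_eq (ts) :
    rootTerms ts = (splitIndex ts.length).map fun pq => rootTerm ts pq.1 pq.2 := by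
  simp only [rootTerms, splitIndex, List.map_flatMap, List.map_map]
  rfl

/-- With the inputs written as a concatenation, the lemmas on grafting into `as ++ bs` become
applicable to the terms of the differential. -/
theorem rootTerm_append (as bs cs : List PTree) :
    rootTerm (as ++ (bs ++ cs)) as.length bs.length =
      (((as.length : ℤ) + (bs.length : ℤ) * cs.length +
        ((bs.length : ℤ) - 2) * degreeList as).negOnePow, node (as ++ node bs :: cs)) := by
  simp only [rootTerm, List.take_left, List.drop_append, List.drop_of_length_le
    (show as.length ≤ as.length + bs.length by omega)]
  simp

theorem exists_append {ts : List PTree} {p q : ℕ} (h : p + q ≤ ts.length) :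
    ∃ as bs cs, ts = as ++ (bs ++ cs) ∧ as.length = p ∧ bs.length = q :=
  ⟨ts.take p, (ts.drop p).take q, (ts.drop p).drop q, by simp, by simp; omega, by simp; omega⟩

@[simp] theorem dTerms_leaf : dTerms leaf = [] := by simp [dTerms]
theorem dTerms_node (ts) : dTerms (node ts) = rootTerms ts ++
    (dTermsList ts).map fun st => (((ts.length : ℤ) - 2).negOnePow * st.1, node st.2) := by
  simp [dTerms]
@[simp] theorem dTermsList_nil : dTermsList [] = [] := by simp [dTermsList]
theorem dTermsList_cons (t ts) : dTermsList (t :: ts) =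
    (dTerms t).map (fun st => (st.1, st.2 :: ts)) ++
      (dTermsList ts).map fun st => ((degree t).negOnePow * st.1, t :: st.2) := by
  simp [dTermsList]

theorem rootTerm_spec {ts : List PTree} {p q : ℕ} (h : p + q ≤ ts.length) :
    leaves (rootTerm ts p q).2 = leavesList ts ∧
      degree (rootTerm ts p q).2 = degree (node ts) - 1 := by
  obtain ⟨as, bs, cs, rfl, rfl, rfl⟩ := exists_append h
  rw [rootTerm_append]
  simp only [degree_node, leaves_node, leavesList_append, leavesList_cons, degreeList_append,
    degreeList_cons, List.length_append, List.length_cons, true_and]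
  push_cast
  ring

theorem rootTerm_isReduced {ts : List PTree} {p q : ℕ} (h : p + q ≤ ts.length) (hq : 2 ≤ q)
    (hq' : q < ts.length) (hts : ∀ t ∈ ts, t.IsReduced) : (rootTerm ts p q).2.IsReduced := by
  obtain ⟨as, bs, cs, rfl, rfl, rfl⟩ := exists_append h
  rw [rootTerm_append]
  simp only [isReduced_node_iff, List.length_append, List.length_cons, List.mem_append,
    List.mem_cons] at hts hq' ⊢
  refine ⟨by omega, ?_⟩
  rintro t (ht | rfl | ht)
  · exact hts t (.inl ht)
  · rw [isReduced_node_iff]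
    exact ⟨hq, fun t ht => hts t (.inr (.inl ht))⟩
  · exact hts t (.inr (.inr ht))

mutual
theorem dTerms_spec : ∀ (t : PTree), ∀ st ∈ dTerms t,
    leaves st.2 = leaves t ∧ degree st.2 = degree t - 1
  | leaf => by simp
  | node ts => by
    have h := dTermsList_spec ts
    intro st hst
    rw [dTerms_node, rootTerms_eq] at hst
    simp only [List.mem_append, List.mem_map] at hst
    rcases hst with ⟨⟨p, q⟩, hpq, rfl⟩ | ⟨st', hst', rfl⟩
    · rw [mem_splitIndex] at hpq
      simpa using rootTerm_spec hpq.2.2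
    · obtain ⟨h1, h2, h3⟩ := h st' hst'
      simp only [leaves_node, h1, degree_node, h2, h3, true_and]
      ring
theorem dTermsList_spec : ∀ (ts : List PTree), ∀ st ∈ dTermsList ts,
    leavesList st.2 = leavesList ts ∧ degreeList st.2 = degreeList ts - 1 ∧
      st.2.length = ts.length
  | [] => by simp
  | t :: ts => by
    have h := dTerms_spec t
    have h' := dTermsList_spec ts
    intro st hst
    rw [dTermsList_cons] at hst
    simp only [List.mem_append, List.mem_map] at hst
    rcases hst with ⟨st', hst', rfl⟩ | ⟨st', hst', rfl⟩
    · obtain ⟨h1, h2⟩ := h st' hst'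
      simp only [leavesList_cons, h1, degreeList_cons, h2, List.length_cons, true_and, and_true]
      ring
    · obtain ⟨h1, h2, h3⟩ := h' st' hst'
      simp only [leavesList_cons, h1, degreeList_cons, h2, List.length_cons, h3, true_and, and_true]
      ring
end

mutual
theorem dTerms_isReduced : ∀ (t : PTree), t.IsReduced → ∀ st ∈ dTerms t, st.2.IsReduced
  | leaf => by simp
  | node ts => by
    intro ht st hst
    rw [isReduced_node_iff] at ht
    rw [dTerms_node, rootTerms_eq] at hst
    simp only [List.mem_append, List.mem_map] at hst
    rcases hst with ⟨⟨p, q⟩, hpq, rfl⟩ | ⟨st', hst', rfl⟩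
    · rw [mem_splitIndex] at hpq
      exact rootTerm_isReduced hpq.2.2 hpq.1 hpq.2.1 ht.2
    · rw [isReduced_node_iff, (dTermsList_spec ts st' hst').2.2]
      exact ⟨ht.1, dTermsList_isReduced ts ht.2 st' hst'⟩
theorem dTermsList_isReduced : ∀ (ts : List PTree), (∀ t ∈ ts, t.IsReduced) →
    ∀ st ∈ dTermsList ts, ∀ t ∈ st.2, t.IsReduced
  | [] => by simp
  | t :: ts => by
    intro hts st hst
    simp only [List.forall_mem_cons] at hts
    rw [dTermsList_cons] at hst
    simp only [List.mem_append, List.mem_map] at hst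
    rcases hst with ⟨st', hst', rfl⟩ | ⟨st', hst', rfl⟩
    · exact List.forall_mem_cons.2 ⟨dTerms_isReduced t hts.1 st' hst', hts.2⟩
    · exact List.forall_mem_cons.2 ⟨hts.1, dTermsList_isReduced ts hts.2 st' hst'⟩
end

theorem dTerms_ne_leaf (t : PTree) : ∀ st ∈ dTerms t, st.2 ≠ leaf := by
  cases t with
  | leaf => simp
  | node ts =>
    intro st hst
    rw [dTerms_node, rootTerms_eq] at hst
    simp only [List.mem_append, List.mem_map] at hst
    rcases hst with ⟨⟨p, q⟩, hpq, rfl⟩ | ⟨st', hst', rfl⟩ <;> simp [rootTerm]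

end PTree

open PTree

section

variable {𝕜 : Type u} [Field 𝕜] {α β : Type*}

/-- The linear combination given by a list of signed basis elements. -/
noncomputable def signedSum (l : List (ℤˣ × α)) : α →₀ 𝕜 :=
  (l.map fun st => st.1 • Finsupp.single st.2 (1 : 𝕜)).sum

@[simp] theorem signedSum_nil : signedSum ([] : List (ℤˣ × α)) = (0 : α →₀ 𝕜) := rfl

theorem signedSum_append (l l' : List (ℤˣ × α)) :
    (signedSum (l ++ l') : α →₀ 𝕜) = signedSum l + signedSum l' := by simp [signedSum]

theorem signedSum_cons (st : ℤˣ × α) (l : List (ℤˣ × α)) :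
    (signedSum (st :: l) : α →₀ 𝕜) = st.1 • Finsupp.single st.2 1 + signedSum l := by
  simp [signedSum]

theorem signedSum_map (ε : ℤˣ) (f : α → β) (l : List (ℤˣ × α)) :
    (signedSum (l.map fun st => (ε * st.1, f st.2)) : β →₀ 𝕜) =
      ε • Finsupp.lmapDomain 𝕜 𝕜 f (signedSum l) := by
  induction l with
  | nil => simp
  | cons st l ih =>
    rw [List.map_cons, signedSum_cons, signedSum_cons, ih, map_add, map_units_smul',
      smul_add, smul_smul]
    simp

theorem signedSum_mem {S : Set α} {l : List (ℤˣ × α)} (h : ∀ st ∈ l, st.2 ∈ S) :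
    (signedSum l : α →₀ 𝕜) ∈ Finsupp.supported 𝕜 𝕜 S := by
  induction l with
  | nil => simp
  | cons st l ih =>
    simp only [List.forall_mem_cons] at h
    rw [signedSum_cons]
    exact add_mem (units_smul_mem _ _ (Finsupp.single_mem_supported _ _ h.1)) (ih h.2)

end

section Differential

variable (𝕜 : Type u) [Field 𝕜]

/-- The differential of `AInf`, on the vector space spanned by all planar trees. -/
noncomputable def treeD : (PTree →₀ 𝕜) →ₗ[𝕜] (PTree →₀ 𝕜) :=
  Finsupp.linearCombination 𝕜 fun t : PTree => signedSum t.dTerms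

/-- The signed grafting into lists of trees. -/
noncomputable def listComp (i : ℕ) :
    (List PTree →₀ 𝕜) →ₗ[𝕜] (PTree →₀ 𝕜) →ₗ[𝕜] (List PTree →₀ 𝕜) :=
  Finsupp.linearCombination 𝕜 fun ts : List PTree =>
    Finsupp.linearCombination 𝕜 fun s : PTree =>
      (s.degree * degreeAfterList i ts).negOnePow • Finsupp.single (graftList i s ts) (1 : 𝕜)

variable {𝕜}

theorem treeD_single (t : PTree) :
    treeD 𝕜 (Finsupp.single t 1) = signedSum t.dTerms := by
  simp [treeD]

theorem listComp_single (i : ℕ) (ts : List PTree) (s : PTree) :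
    listComp 𝕜 i (Finsupp.single ts 1) (Finsupp.single s 1) =
      (s.degree * degreeAfterList i ts).negOnePow • Finsupp.single (graftList i s ts) (1 : 𝕜) := by
  simp [listComp]

theorem signedSum_dTerms_node (ts : List PTree) :
    (signedSum (dTerms (node ts)) : PTree →₀ 𝕜) = signedSum (rootTerms ts) +
      ((ts.length : ℤ) - 2).negOnePow • Finsupp.lmapDomain 𝕜 𝕜 node (signedSum (dTermsList ts)) := by
  rw [dTerms_node, signedSum_append, signedSum_map]

theorem signedSum_dTermsList_cons (t : PTree) (ts : List PTree) :
    (signedSum (dTermsList (t :: ts)) : List PTree →₀ 𝕜) =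
      Finsupp.lmapDomain 𝕜 𝕜 (· :: ts) (signedSum (dTerms t)) +
      (degree t).negOnePow • Finsupp.lmapDomain 𝕜 𝕜 (t :: ·) (signedSum (dTermsList ts)) := by
  rw [dTermsList_cons, signedSum_append, signedSum_map]
  congr 1
  have := signedSum_map (𝕜 := 𝕜) 1 (· :: ts) (dTerms t)
  simpa using this

/-- The root is read before every leaf, so it never contributes to the sign of a grafting. -/
theorem treeComp_lmapDomain_node (i : ℕ) (z : List PTree →₀ 𝕜) (y : PTree →₀ 𝕜) :
    treeComp 𝕜 i (Finsupp.lmapDomain 𝕜 𝕜 node z) y =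
      Finsupp.lmapDomain 𝕜 𝕜 node (listComp 𝕜 i z y) := by
  induction z using basis_induction with
  | zero => simp
  | add z z' h h' => simp only [map_add, LinearMap.add_apply, h, h']
  | smul c z h => simp only [map_smul, LinearMap.smul_apply, h]
  | single ts =>
    induction y using basis_induction with
    | zero => simp
    | add z z' h h' => simp only [map_add, h, h']
    | smul c z h => simp only [map_smul, h]
    | single s =>
      rw [listComp_single, map_units_smul']
      simp [treeComp_single]

theorem listComp_cons_left {i : ℕ} {t : PTree} (ts : List PTree) (s : PTree)
    (hi : i ≤ leaves t) {x : PTree →₀ 𝕜}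
    (hx : x ∈ Finsupp.supported 𝕜 𝕜 {t' | leaves t' = leaves t}) :
    listComp 𝕜 i (Finsupp.lmapDomain 𝕜 𝕜 (· :: ts) x) (Finsupp.single s 1) =
      (s.degree * degreeList ts).negOnePow •
        Finsupp.lmapDomain 𝕜 𝕜 (· :: ts) (treeComp 𝕜 i x (Finsupp.single s 1)) := by
  induction hx using supported_induction with
  | zero => simp
  | add x y _ _ h h' => simp only [map_add, LinearMap.add_apply, smul_add, h, h']
  | smul c x _ h =>
    simp only [map_smul, LinearMap.smul_apply, h]
    rw [smul_comm]
  | single t' ht' =>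
    have ht' : leaves t' = leaves t := ht'
    rw [treeComp_single, map_units_smul', smul_smul, ← Int.negOnePow_add]
    simp only [Finsupp.lmapDomain_apply, Finsupp.mapDomain_single]
    rw [listComp_single, degreeAfterList_cons, graftList_cons, if_pos (by omega),
      if_pos (by omega)]
    congr 2
    ring

theorem listComp_cons_of_le {i : ℕ} {t : PTree} (s : PTree) (hi : i ≤ leaves t) {e : ℤ}
    {z : List PTree →₀ 𝕜} (hz : z ∈ Finsupp.supported 𝕜 𝕜 {ts | degreeList ts = e}) :
    listComp 𝕜 i (Finsupp.lmapDomain 𝕜 𝕜 (t :: ·) z) (Finsupp.single s 1) =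
      (s.degree * (degreeAfter i t + e)).negOnePow •
        Finsupp.lmapDomain 𝕜 𝕜 (graft i s t :: ·) z := by
  induction hz using supported_induction with
  | zero => simp
  | add x y _ _ h h' => simp only [map_add, LinearMap.add_apply, smul_add, h, h']
  | smul c x _ h =>
    simp only [map_smul, LinearMap.smul_apply, h]
    rw [smul_comm]
  | single ts hts =>
    have hts : degreeList ts = e := hts
    simp only [Finsupp.lmapDomain_apply, Finsupp.mapDomain_single]
    rw [listComp_single, degreeAfterList_cons, graftList_cons, if_pos hi, if_pos hi, hts]

theorem listComp_cons_right {i : ℕ} {t : PTree} (ts : List PTree) (s : PTree)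
    (hi : leaves t < i) {x : PTree →₀ 𝕜}
    (hx : x ∈ Finsupp.supported 𝕜 𝕜 {t' | leaves t' = leaves t}) :
    listComp 𝕜 i (Finsupp.lmapDomain 𝕜 𝕜 (· :: ts) x) (Finsupp.single s 1) =
      (s.degree * degreeAfterList (i - leaves t) ts).negOnePow •
        Finsupp.lmapDomain 𝕜 𝕜 (· :: graftList (i - leaves t) s ts) x := by
  induction hx using supported_induction with
  | zero => simp
  | add x y _ _ h h' => simp only [map_add, LinearMap.add_apply, smul_add, h, h']
  | smul c x _ h =>
    simp only [map_smul, LinearMap.smul_apply, h]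
    rw [smul_comm]
  | single t' ht' =>
    have ht' : leaves t' = leaves t := ht'
    simp only [Finsupp.lmapDomain_apply, Finsupp.mapDomain_single]
    rw [listComp_single, degreeAfterList_cons, graftList_cons, if_neg (by omega),
      if_neg (by omega), ht']

theorem listComp_cons_of_lt {i : ℕ} {t : PTree} (hi : leaves t < i) (z : List PTree →₀ 𝕜)
    (y : PTree →₀ 𝕜) :
    listComp 𝕜 i (Finsupp.lmapDomain 𝕜 𝕜 (t :: ·) z) y =
        Finsupp.lmapDomain 𝕜 𝕜 (t :: ·) (listComp 𝕜 (i - leaves t) z y) := by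
  induction z using basis_induction with
  | zero => simp
  | add z z' h h' => simp only [map_add, LinearMap.add_apply, h, h']
  | smul c z h => simp only [map_smul, LinearMap.smul_apply, h]
  | single ts =>
    induction y using basis_induction with
    | zero => simp
    | add z z' h h' => simp only [map_add, h, h']
    | smul c z h => simp only [map_smul, h]
    | single s =>
      rw [listComp_single, map_units_smul']
      simp [listComp_single, degreeAfterList_cons, graftList_cons, hi.not_ge]

theorem listComp_single_cons {i : ℕ} {t : PTree} (ts : List PTree) (hi : i ≤ leaves t) {e : ℤ}
    {y : PTree →₀ 𝕜} (hy : y ∈ Finsupp.supported 𝕜 𝕜 {s | degree s = e}) :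
    listComp 𝕜 i (Finsupp.single (t :: ts) 1) y =
      (e * degreeList ts).negOnePow •
        Finsupp.lmapDomain 𝕜 𝕜 (· :: ts) (treeComp 𝕜 i (Finsupp.single t 1) y) := by
  induction hy using supported_induction with
  | zero => simp
  | add x y _ _ h h' => simp only [map_add, smul_add, h, h']
  | smul c x _ h =>
    simp only [map_smul, h]
    rw [smul_comm]
  | single s hs =>
    have hs : degree s = e := hs
    rw [listComp_single, treeComp_single, map_units_smul', smul_smul, ← Int.negOnePow_add,
      degreeAfterList_cons, graftList_cons, if_pos hi, if_pos hi, hs]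
    simp only [Finsupp.lmapDomain_apply, Finsupp.mapDomain_single]
    congr 2
    ring

/-- The leaf `i` lies before, inside or after the block of inputs that moves to the new vertex. Only
in the first case is the new vertex, of degree `q - 2`, involved: it is read after the leaf, and it
is moved past the subtree that now contains `s`. Both effects contribute `(q - 2) |s|`. -/
theorem rootTerm_graftList {ts : List PTree} {s : PTree} {i p q : ℕ} (hi : 1 ≤ i)
    (hi' : i ≤ leavesList ts) (h : p + q ≤ ts.length) :
    (s.degree * degreeAfterList i ts).negOnePow * (rootTerm (graftList i s ts) p q).1 =
      (rootTerm ts p q).1 * (s.degree * degreeAfter i (rootTerm ts p q).2).negOnePow ∧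
    (rootTerm (graftList i s ts) p q).2 = graft i s (rootTerm ts p q).2 := by
  obtain ⟨as, bs, cs, rfl, rfl, rfl⟩ := exists_append h
  rw [rootTerm_append]
  simp only [leavesList_append] at hi'
  have aux (as' : List PTree) : as' ++ node bs :: cs = as' ++ ([node bs] ++ cs) := rfl
  by_cases h1 : i ≤ leavesList as
  · rw [graftList_append_left _ _ _ hi h1, degreeAfterList_append_left _ _ hi h1,
      ← length_graftList i s as, rootTerm_append, length_graftList]
    simp only [degreeAfter_node, graft_node]
    rw [graftList_append_left _ _ _ hi h1, degreeAfterList_append_left _ _ hi h1]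
    refine ⟨?_, rfl⟩
    rw [← Int.negOnePow_add, ← Int.negOnePow_add, degreeList_graftList s as hi h1]
    apply negOnePow_eq_of_even_sub
    simp only [degreeList_append, degreeList_cons, degree_node]
    refine ⟨0, ?_⟩
    ring
  · push Not at h1
    rw [graftList_append_right _ _ _ h1, degreeAfterList_append_right _ _ h1]
    by_cases h2 : i - leavesList as ≤ leavesList bs
    · rw [graftList_append_left _ _ _ (by omega) h2,
        degreeAfterList_append_left _ _ (by omega) h2,
        ← length_graftList (i - leavesList as) s bs, rootTerm_append, length_graftList]
      simp only [degreeAfter_node, graft_node]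
      rw [graftList_append_right _ _ _ h1, degreeAfterList_append_right _ _ h1, graftList_cons,
        degreeAfterList_cons, leaves_node, if_pos h2, if_pos h2, degreeAfter_node, graft_node,
        mul_comm]
      exact ⟨rfl, rfl⟩
    · push Not at h2
      rw [graftList_append_right _ _ _ h2, degreeAfterList_append_right _ _ h2, rootTerm_append]
      simp only [degreeAfter_node, graft_node]
      rw [graftList_append_right _ _ _ h1, degreeAfterList_append_right _ _ h1, graftList_cons,
        degreeAfterList_cons, leaves_node, if_neg (by omega), if_neg (by omega), length_graftList,
        mul_comm]
      exact ⟨rfl, rfl⟩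

theorem signedSum_rootTerms_graftList {ts : List PTree} {s : PTree} {i : ℕ} (hi : 1 ≤ i)
    (hi' : i ≤ leavesList ts) :
    (s.degree * degreeAfterList i ts).negOnePow •
      (signedSum (rootTerms (graftList i s ts)) : PTree →₀ 𝕜) =
      treeComp 𝕜 i (signedSum (rootTerms ts)) (Finsupp.single s 1) := by
  rw [rootTerms_eq, rootTerms_eq, length_graftList]
  have h : ∀ pq ∈ splitIndex ts.length, pq.1 + pq.2 ≤ ts.length :=
    fun pq h => (mem_splitIndex.1 h).2.2
  generalize splitIndex ts.length = l at h
  induction l with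
  | nil => simp
  | cons pq l ih =>
    obtain ⟨h1, h2⟩ := rootTerm_graftList (s := s) hi hi' (h pq List.mem_cons_self)
    rw [List.map_cons, List.map_cons, signedSum_cons, signedSum_cons, smul_add,
      ih fun pq hpq => h pq (List.mem_cons_of_mem _ hpq), map_add,
      LinearMap.add_apply, LinearMap.map_smul_of_tower, LinearMap.smul_apply, treeComp_single,
      smul_smul, smul_smul, h1, h2]

mutual
-- The derivation rule on basis trees, with the sign of the grafting moved to the left-hand side.
-- Terms at the root of `t` correspond by `signedSum_rootTerms_graftList`; the others lie in the
-- subtrees and are handled by the simultaneous induction on lists.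
theorem signedSum_dTerms_graft (s : PTree) : ∀ (t : PTree) {i : ℕ}, 1 ≤ i → i ≤ leaves t →
    (s.degree * degreeAfter i t).negOnePow • (signedSum (dTerms (graft i s t)) : PTree →₀ 𝕜) =
      treeComp 𝕜 i (signedSum (dTerms t)) (Finsupp.single s 1) +
      t.degree.negOnePow • treeComp 𝕜 i (Finsupp.single t 1) (signedSum (dTerms s))
  | leaf, i, h1, h2 => by
    simp only [graft_leaf, degreeAfter_leaf, mul_zero, Int.negOnePow_zero, one_smul, dTerms_leaf,
      signedSum_nil, map_zero, LinearMap.zero_apply, zero_add, degree_leaf]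
    induction (signedSum (dTerms s) : PTree →₀ 𝕜) using basis_induction with
    | zero => simp
    | add x y h h' => rw [map_add, ← h, ← h']
    | smul c x h => rw [map_smul, ← h]
    | single s => simp [treeComp_single]
  | node ts, i, h1, h2 => by
    rw [leaves_node] at h2
    have ih := signedSum_dTermsList_graftList s ts h1 h2
    rw [graft_node, degreeAfter_node, signedSum_dTerms_node, signedSum_dTerms_node, smul_add,
      signedSum_rootTerms_graftList h1 h2, length_graftList, map_add, LinearMap.add_apply,
      add_assoc, smul_comm, ← map_units_smul', ih, map_add, map_units_smul', smul_add, smul_smul,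
      ← Int.negOnePow_add, ← degree_node, LinearMap.map_smul_of_tower, LinearMap.smul_apply,
      treeComp_lmapDomain_node, ← treeComp_lmapDomain_node i (Finsupp.single ts 1)]
    simp
theorem signedSum_dTermsList_graftList (s : PTree) : ∀ (ts : List PTree) {i : ℕ}, 1 ≤ i →
    i ≤ leavesList ts →
    (s.degree * degreeAfterList i ts).negOnePow •
      (signedSum (dTermsList (graftList i s ts)) : List PTree →₀ 𝕜) =
      listComp 𝕜 i (signedSum (dTermsList ts)) (Finsupp.single s 1) +
      (degreeList ts).negOnePow • listComp 𝕜 i (Finsupp.single ts 1) (signedSum (dTerms s))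
  | [], i, h1, h2 => by simp at h2; omega
  | t :: ts, i, h1, h2 => by
    rw [leavesList_cons] at h2
    have hs : (signedSum (dTerms s) : PTree →₀ 𝕜) ∈
        Finsupp.supported 𝕜 𝕜 {u | degree u = degree s - 1} :=
      signedSum_mem fun st hst => (dTerms_spec s st hst).2
    have ht : (signedSum (dTerms t) : PTree →₀ 𝕜) ∈
        Finsupp.supported 𝕜 𝕜 {u | leaves u = leaves t} :=
      signedSum_mem fun st hst => (dTerms_spec t st hst).1
    have hts : (signedSum (dTermsList ts) : List PTree →₀ 𝕜) ∈
        Finsupp.supported 𝕜 𝕜 {us | degreeList us = degreeList ts - 1} :=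
      signedSum_mem fun st hst => (dTermsList_spec ts st hst).2.1
    rw [degreeAfterList_cons, graftList_cons, signedSum_dTermsList_cons t ts, map_add,
      LinearMap.add_apply, LinearMap.map_smul_of_tower, LinearMap.smul_apply, degreeList_cons]
    split_ifs with h
    · have ih := signedSum_dTerms_graft s t h1 h
      rw [signedSum_dTermsList_cons, listComp_cons_left ts s h ht, listComp_cons_of_le s h hts,
        listComp_single_cons ts h hs, smul_add, mul_add, Int.negOnePow_add,
        mul_comm (Int.negOnePow _), mul_smul, ← map_units_smul', ih, degree_graft s t h1 h]
      rw [map_add, smul_add, map_units_smul']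
      simp only [smul_smul, ← Int.negOnePow_add]
      rw [add_right_comm]
      congr 2
      · congr 1
        apply negOnePow_eq_of_even_sub
        -- Differentiating the later subtrees passes `s` if `s` is grafted first; otherwise `s` is
        -- grafted past subtrees of total degree one lower. The exponents differ by `2 |s|`.
        refine ⟨s.degree, ?_⟩
        ring
      · congr 1
        ring
    · push Not at h
      have ih := signedSum_dTermsList_graftList s ts (i := i - leaves t) (by omega) (by omega)
      have e : Finsupp.single (t :: ts) (1 : 𝕜) =
          Finsupp.lmapDomain 𝕜 𝕜 (t :: ·) (Finsupp.single ts 1) := by simp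
      rw [signedSum_dTermsList_cons, listComp_cons_right ts s h ht, listComp_cons_of_lt h, e,
        listComp_cons_of_lt h, smul_add, smul_comm _ (degree t).negOnePow,
        ← map_units_smul' (Finsupp.lmapDomain 𝕜 𝕜 (t :: ·)), ih,
        map_add, smul_add, Int.negOnePow_add, mul_smul,
        map_units_smul' _ (degreeList ts).negOnePow, add_assoc]
end

theorem treeD_treeComp {m i : ℕ} {a : ℤ} {x : PTree →₀ 𝕜} (hi : 1 ≤ i) (him : i ≤ m)
    (hx : x ∈ Finsupp.supported 𝕜 𝕜 (basisTreesDeg m a)) (y : PTree →₀ 𝕜) :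
    treeD 𝕜 (treeComp 𝕜 i x y) =
      treeComp 𝕜 i (treeD 𝕜 x) y + a.negOnePow • treeComp 𝕜 i x (treeD 𝕜 y) := by
  induction hx using supported_induction with
  | zero => simp
  | add x y _ _ h h' => simp only [map_add, LinearMap.add_apply, h, h', smul_add]; abel
  | smul c x _ h =>
    simp only [map_smul, LinearMap.smul_apply, h, smul_add]
    rw [smul_comm]
  | single t ht =>
    induction y using basis_induction with
    | zero => simp
    | add x y h h' => simp only [map_add, h, h', smul_add]; abel
    | smul c x h =>
      simp only [map_smul, h, smul_add]
      rw [smul_comm]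
    | single s =>
      obtain ⟨⟨-, -, rfl⟩, rfl⟩ := ht
      rw [treeComp_single, map_units_smul', treeD_single, treeD_single, treeD_single,
        signedSum_dTerms_graft s t hi him]

theorem treeD_mem {n : ℕ} {x : PTree →₀ 𝕜} (hx : x ∈ Finsupp.supported 𝕜 𝕜 (basisTrees n)) :
    treeD 𝕜 x ∈ Finsupp.supported 𝕜 𝕜 (basisTrees n) := by
  induction hx using supported_induction with
  | zero => simp
  | add x y _ _ h h' => simpa using add_mem h h'
  | smul c x _ h => simpa using Submodule.smul_mem _ c h
  | single t ht =>
    rw [treeD_single]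
    exact signedSum_mem fun st hst => ⟨dTerms_isReduced t ht.1 st hst, dTerms_ne_leaf t st hst,
      (dTerms_spec t st hst).1.trans ht.2.2⟩

theorem treeD_deg {n : ℕ} {a : ℤ} {x : PTree →₀ 𝕜}
    (hx : x ∈ Finsupp.supported 𝕜 𝕜 (basisTreesDeg n a)) :
    treeD 𝕜 x ∈ Finsupp.supported 𝕜 𝕜 {t : PTree | t.degree = a - 1} := by
  induction hx using supported_induction with
  | zero => simp
  | add x y _ _ h h' => simpa using add_mem h h'
  | smul c x _ h => simpa using Submodule.smul_mem _ c h
  | single t ht =>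
    rw [treeD_single]
    obtain ⟨-, rfl⟩ := ht
    exact signedSum_mem fun st hst => (dTerms_spec t st hst).2

end Differential
end OInfinity
namespace OInfinity
open PTree

-- Corollas, and the vanishing of `d²` on the generators.

namespace PTree

@[simp] theorem leavesList_replicate_leaf (n : ℕ) : leavesList (List.replicate n leaf) = n := by
  induction n with
  | zero => simp
  | succ n ih => simp [List.replicate_succ, ih]; omega

@[simp] theorem degreeList_replicate_leaf (n : ℕ) : degreeList (List.replicate n leaf) = 0 := by
  induction n with
  | zero => simp
  | succ n ih => simp [List.replicate_succ, ih]

theorem dTermsList_replicate_leaf (n : ℕ) : dTermsList (List.replicate n leaf) = [] := by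
  induction n with
  | zero => simp
  | succ n ih => simp [List.replicate_succ, ih, dTermsList_cons]

theorem degreeAfterList_replicate_leaf (i n : ℕ) :
    degreeAfterList i (List.replicate n leaf) = 0 := by
  induction n generalizing i with
  | zero => simp
  | succ n ih => simp [List.replicate_succ, ih, degreeAfterList_cons]

@[simp] theorem leaves_corolla (n : ℕ) : leaves (corolla n) = n := by simp [corolla]

theorem degree_corolla (n : ℕ) : degree (corolla n) = (n : ℤ) - 2 := by
  simp [corolla, degree_node]

@[simp] theorem degreeAfter_corolla (i n : ℕ) : degreeAfter i (corolla n) = 0 := by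
  simp [corolla, degreeAfterList_replicate_leaf]

theorem isReduced_corolla {n : ℕ} (h : 2 ≤ n) : IsReduced (corolla n) := by
  rw [corolla, isReduced_node_iff]
  refine ⟨by simpa, fun t ht => ?_⟩
  rw [List.eq_of_mem_replicate ht]
  exact .leaf

theorem corolla_mem_basisTrees {n : ℕ} (h : 2 ≤ n) : corolla n ∈ basisTrees n :=
  ⟨isReduced_corolla h, by simp [corolla], by simp⟩

theorem corolla_mem_basisTreesDeg {n : ℕ} (h : 2 ≤ n) :
    corolla n ∈ basisTreesDeg n ((n : ℤ) - 2) :=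
  ⟨corolla_mem_basisTrees h, degree_corolla n⟩

theorem graft_append_leaf (as : List PTree) (s : PTree) (bs : List PTree) :
    graft (leavesList as + 1) s (node (as ++ leaf :: bs)) = node (as ++ s :: bs) := by
  rw [graft_node, graftList_append_right _ _ _ (by omega), graftList_cons]
  simp

theorem graft_corolla {n p : ℕ} (s : PTree) (h : p < n) :
    graft (p + 1) s (corolla n) =
      node (List.replicate p leaf ++ s :: List.replicate (n - 1 - p) leaf) := by
  have : List.replicate n leaf = List.replicate p leaf ++ leaf :: List.replicate (n - 1 - p) leaf := by
    rw [← List.replicate_succ, List.replicate_append_replicate]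
    congr 1; omega
  rw [corolla, this]
  simpa using graft_append_leaf (List.replicate p leaf) s (List.replicate (n - 1 - p) leaf)

/-- Leaves have degree zero, so the Koszul correction disappears and the standard sign `(-1)^(p +
qr)` remains. -/
theorem rootTerm_replicate_leaf {n p q : ℕ} (h : p + q ≤ n) (hq : q < n) :
    rootTerm (List.replicate n leaf) p q =
      (((p : ℤ) + q * (n - p - q)).negOnePow, graft (p + 1) (corolla q) (corolla (n - q + 1))) := by
  have e : List.replicate n leaf = List.replicate p leaf ++
      (List.replicate q leaf ++ List.replicate (n - p - q) leaf) := by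
    rw [List.replicate_append_replicate, List.replicate_append_replicate]
    congr 1; omega
  have := rootTerm_append (List.replicate p leaf) (List.replicate q leaf)
    (List.replicate (n - p - q) leaf)
  rw [← e] at this
  simp only [List.length_replicate, degreeList_replicate_leaf, mul_zero, add_zero] at this
  rw [this, graft_corolla _ (by omega), corolla]
  rw [show n - q + 1 - 1 - p = n - p - q by omega, Nat.cast_sub (show q ≤ n - p by omega),
    Nat.cast_sub (show p ≤ n by omega)]

/-- The finite set of the pairs `(p, q)` that index the terms of `d(t_n)`. -/
def splitSet (n : ℕ) : Finset (ℕ × ℕ) := (splitIndex n).toFinset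

theorem mem_splitSet {n : ℕ} {x : ℕ × ℕ} :
    x ∈ splitSet n ↔ 2 ≤ x.2 ∧ x.2 < n ∧ x.1 + x.2 ≤ n := by
  rw [splitSet, List.mem_toFinset, ← mem_splitIndex]

end PTree

section

variable {𝕜 : Type u} [Field 𝕜]

variable (𝕜) in
/-- The corolla as an element of `AInf`. -/
noncomputable def gen (n : ℕ) : PTree →₀ 𝕜 := Finsupp.single (corolla n) 1

theorem treeComp_gen (i m n : ℕ) :
    treeComp 𝕜 i (gen 𝕜 m) (gen 𝕜 n) = Finsupp.single (graft i (corolla n) (corolla m)) 1 := by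
  rw [gen, gen, treeComp_single]
  simp

theorem gen_mem {n : ℕ} (h : 2 ≤ n) : gen 𝕜 n ∈ Finsupp.supported 𝕜 𝕜 (basisTrees n) :=
  Finsupp.single_mem_supported _ _ (corolla_mem_basisTrees h)

theorem gen_mem_deg {n : ℕ} (h : 2 ≤ n) :
    gen 𝕜 n ∈ Finsupp.supported 𝕜 𝕜 (basisTreesDeg n ((n : ℤ) - 2)) :=
  Finsupp.single_mem_supported _ _ (corolla_mem_basisTreesDeg h)

theorem treeD_gen (n : ℕ) : treeD 𝕜 (gen 𝕜 n) = ∑ x ∈ splitSet n,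
    ((x.1 : ℤ) + x.2 * (n - x.1 - x.2)).negOnePow •
      treeComp 𝕜 (x.1 + 1) (gen 𝕜 (n - x.2 + 1)) (gen 𝕜 x.2) := by
  rw [gen, treeD_single, corolla, dTerms_node, dTermsList_replicate_leaf, List.map_nil,
    List.append_nil, rootTerms_eq, List.length_replicate, signedSum, splitSet,
    List.sum_toFinset _ (nodup_splitIndex n), List.map_map]
  congr 1
  refine List.map_congr_left fun x hx => ?_
  rw [mem_splitIndex] at hx
  simp only [Function.comp_apply]
  rw [rootTerm_replicate_leaf hx.2.2 hx.2.1, treeComp_gen]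

/-- The index set of the terms of `d(d(t_n))` in which the first factor is differentiated. -/
def outerSplit (n : ℕ) : Finset (Σ _ : ℕ × ℕ, ℕ × ℕ) :=
  (splitSet n).sigma fun x => splitSet (n - x.2 + 1)

/-- The index set of the terms of `d(d(t_n))` in which the second factor is differentiated. -/
def innerSplit (n : ℕ) : Finset (Σ _ : ℕ × ℕ, ℕ × ℕ) :=
  (splitSet n).sigma fun x => splitSet x.2

variable (𝕜) in
/-- A term of `d(d(t_n))` in which the first factor of `d(t_n)` is differentiated. -/
noncomputable def outerTerm (n : ℕ) (z : Σ _ : ℕ × ℕ, ℕ × ℕ) : PTree →₀ 𝕜 :=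
  (((z.1.1 : ℤ) + z.1.2 * (n - z.1.1 - z.1.2)) +
    ((z.2.1 : ℤ) + z.2.2 * ((n - z.1.2 + 1) - z.2.1 - z.2.2))).negOnePow •
  treeComp 𝕜 (z.1.1 + 1)
    (treeComp 𝕜 (z.2.1 + 1) (gen 𝕜 (n - z.1.2 + 1 - z.2.2 + 1)) (gen 𝕜 z.2.2)) (gen 𝕜 z.1.2)

variable (𝕜) in
/-- A term of `d(d(t_n))` in which the second factor of `d(t_n)` is differentiated. -/
noncomputable def innerTerm (n : ℕ) (z : Σ _ : ℕ × ℕ, ℕ × ℕ) : PTree →₀ 𝕜 :=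
  (((z.1.1 : ℤ) + z.1.2 * (n - z.1.1 - z.1.2)) + (n - z.1.2 + 1) +
    ((z.2.1 : ℤ) + z.2.2 * (z.1.2 - z.2.1 - z.2.2))).negOnePow •
  treeComp 𝕜 (z.1.1 + 1) (gen 𝕜 (n - z.1.2 + 1))
    (treeComp 𝕜 (z.2.1 + 1) (gen 𝕜 (z.1.2 - z.2.2 + 1)) (gen 𝕜 z.2.2))

theorem treeD_treeD_gen_eq (n : ℕ) : treeD 𝕜 (treeD 𝕜 (gen 𝕜 n)) =
    ∑ z ∈ outerSplit n, outerTerm 𝕜 n z + ∑ z ∈ innerSplit n, innerTerm 𝕜 n z := by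
  rw [outerSplit, innerSplit, Finset.sum_sigma, Finset.sum_sigma, ← Finset.sum_add_distrib,
    treeD_gen, map_sum]
  refine Finset.sum_congr rfl fun x hx => ?_
  rw [mem_splitSet] at hx
  obtain ⟨h1, h2, h3⟩ := hx
  rw [map_units_smul', treeD_treeComp (m := n - x.2 + 1) (by omega) (by omega)
    (gen_mem_deg (by omega)), treeD_gen, treeD_gen, map_sum, map_sum, LinearMap.sum_apply, smul_add,
    smul_smul, Finset.smul_sum, Finset.smul_sum]
  congr 1
  · refine Finset.sum_congr rfl fun y hy => ?_
    rw [LinearMap.map_smul_of_tower, LinearMap.smul_apply, smul_smul, ← Int.negOnePow_add,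
      outerTerm]
    push_cast [Nat.cast_sub h2.le]
    rfl
  · refine Finset.sum_congr rfl fun y hy => ?_
    rw [LinearMap.map_smul_of_tower, smul_smul, ← Int.negOnePow_add, ← Int.negOnePow_add,
      innerTerm]
    congr 1
    apply negOnePow_eq_of_even_sub
    push_cast [Nat.cast_sub h2.le]
    -- The derivation rule gives the degree `n - q - 1` of the first factor, whereas `innerTerm` is
    -- written with its arity `n - q + 1`.
    refine ⟨-1, ?_⟩
    ring

/-- If the second composition is made at an input of the vertex `t_q'` that was just inserted, the
sequential axiom turns the term into one where the second factor is differentiated, with the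
opposite sign. -/
theorem sum_outerTerm_sequential (n : ℕ) :
    ∑ z ∈ outerSplit n with z.2.1 ≤ z.1.1 ∧ z.1.1 < z.2.1 + z.2.2, outerTerm 𝕜 n z =
      - ∑ z ∈ innerSplit n, innerTerm 𝕜 n z := by
  rw [← Finset.sum_neg_distrib]
  -- The inner composite has `q' + q - 1` inputs and begins after `p'` inputs of the root; inside
  -- it, the block of size `q` begins after `p - p'` inputs.
  refine Finset.sum_bij' (fun z _ => ⟨(z.2.1, z.2.2 + z.1.2 - 1), (z.1.1 - z.2.1, z.1.2)⟩)
    (fun z _ => ⟨(z.1.1 + z.2.1, z.2.2), (z.1.1, z.1.2 + 1 - z.2.2)⟩) ?_ ?_ ?_ ?_ ?_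
  · rintro ⟨⟨p, q⟩, ⟨p', q'⟩⟩ hz
    simp only [outerSplit, innerSplit, Finset.mem_filter, Finset.mem_sigma, mem_splitSet] at hz ⊢
    omega
  · rintro ⟨⟨p, q⟩, ⟨p', q'⟩⟩ hz
    simp only [outerSplit, innerSplit, Finset.mem_filter, Finset.mem_sigma, mem_splitSet] at hz ⊢
    omega
  · rintro ⟨⟨p, q⟩, ⟨p', q'⟩⟩ hz
    simp only [outerSplit, Finset.mem_filter, Finset.mem_sigma, mem_splitSet] at hz
    simp only [Sigma.mk.injEq, Prod.mk.injEq, heq_eq_eq, and_true, true_and]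
    omega
  · rintro ⟨⟨p, q⟩, ⟨p', q'⟩⟩ hz
    simp only [innerSplit, Finset.mem_sigma, mem_splitSet] at hz
    simp only [Sigma.mk.injEq, Prod.mk.injEq, heq_eq_eq, and_true, true_and]
    omega
  · rintro ⟨⟨p, q⟩, ⟨p', q'⟩⟩ hz
    simp only [outerSplit, Finset.mem_filter, Finset.mem_sigma, mem_splitSet] at hz
    obtain ⟨⟨⟨h1, h2, h3⟩, h4, h5, h6⟩, h7, h8⟩ := hz
    simp only [outerTerm, innerTerm]
    have := treeComp_seq (i := p' + 1) (j := p - p' + 1) (z := gen 𝕜 q) (by omega) (by omega)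
      (by omega) (by omega) (gen_mem (𝕜 := 𝕜) (n := n - q + 1 - q' + 1) (by omega))
      (gen_mem (𝕜 := 𝕜) (n := q') (by omega))
    rw [show p' + 1 - 1 + (p - p' + 1) = p + 1 by omega] at this
    rw [this, show q' + q - 1 - q + 1 = q' by omega,
      show n - (q' + q - 1) + 1 = n - q + 1 - q' + 1 by omega, ← Units.neg_smul]
    congr 1
    rw [← Int.negOnePow_succ]
    apply negOnePow_eq_of_even_sub
    push_cast [Nat.cast_sub h7, Nat.cast_sub (show 1 ≤ q' + q by omega)]
    simp only [Int.even_add, Int.even_sub, Int.even_mul, Int.not_even_one]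
    -- Only the parities of the indices matter for the sign, so all of them are tried.
    by_cases hp : Even (p : ℤ) <;> by_cases hq : Even (q : ℤ) <;> by_cases hp' : Even (p' : ℤ) <;>
      by_cases hq' : Even (q' : ℤ) <;> by_cases hn : Even (n : ℤ) <;> simp [hp, hq, hp', hq', hn]

/-- Two disjoint blocks of inputs can be grouped in either order. The parallel axiom exchanges the
two orders, and the resulting terms have opposite signs. -/
theorem sum_outerTerm_parallel (n : ℕ) :
    ∑ z ∈ outerSplit n with z.1.1 < z.2.1, outerTerm 𝕜 n z =
      - ∑ z ∈ outerSplit n with z.2.1 + z.2.2 ≤ z.1.1, outerTerm 𝕜 n z := by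
  rw [← Finset.sum_neg_distrib]
  -- Once the left block is grafted first, the right one begins `q - 1` inputs later.
  refine Finset.sum_bij' (fun z _ => ⟨(z.2.1 + z.1.2 - 1, z.2.2), z.1⟩)
    (fun z _ => ⟨z.2, (z.1.1 + 1 - z.2.2, z.1.2)⟩) ?_ ?_ ?_ ?_ ?_
  · rintro ⟨⟨p, q⟩, ⟨p', q'⟩⟩ hz
    simp only [outerSplit, Finset.mem_filter, Finset.mem_sigma, mem_splitSet] at hz ⊢
    omega
  · rintro ⟨⟨p, q⟩, ⟨p', q'⟩⟩ hz
    simp only [outerSplit, Finset.mem_filter, Finset.mem_sigma, mem_splitSet] at hz ⊢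
    omega
  · rintro ⟨⟨p, q⟩, ⟨p', q'⟩⟩ hz
    simp only [outerSplit, Finset.mem_filter, Finset.mem_sigma, mem_splitSet] at hz
    simp only [Sigma.mk.injEq, Prod.mk.injEq, heq_eq_eq, and_true, true_and]
    omega
  · rintro ⟨⟨p, q⟩, ⟨p', q'⟩⟩ hz
    simp only [outerSplit, Finset.mem_filter, Finset.mem_sigma, mem_splitSet] at hz
    simp only [Sigma.mk.injEq, Prod.mk.injEq, heq_eq_eq, and_true]
    omega
  · rintro ⟨⟨p, q⟩, ⟨p', q'⟩⟩ hz
    simp only [outerSplit, Finset.mem_filter, Finset.mem_sigma, mem_splitSet] at hz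
    obtain ⟨⟨⟨h1, h2, h3⟩, h4, h5, h6⟩, h7⟩ := hz
    simp only [outerTerm]
    have := treeComp_par (i := p + 1) (j := p' + 1) (by omega) (by omega) (by omega)
      (gen_mem (𝕜 := 𝕜) (n := n - q + 1 - q' + 1) (by omega))
      (gen_mem_deg (𝕜 := 𝕜) (n := q) (by omega)) (gen_mem_deg (𝕜 := 𝕜) (n := q') (by omega))
    rw [show n - q' + 1 - q + 1 = n - q + 1 - q' + 1 by omega,
      show p' + q - 1 + 1 = p' + 1 - 1 + q by omega, this, smul_smul, ← Int.negOnePow_add,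
      ← Units.neg_smul]
    congr 1
    rw [← Int.negOnePow_succ]
    apply negOnePow_eq_of_even_sub
    push_cast [Nat.cast_sub (show 1 ≤ p' + q by omega)]
    simp only [Int.even_add, Int.even_sub, Int.even_mul, Int.not_even_one]
    by_cases hp : Even (p : ℤ) <;> by_cases hq : Even (q : ℤ) <;> by_cases hp' : Even (p' : ℤ) <;>
      by_cases hq' : Even (q' : ℤ) <;> simp [hp, hq, hp', hq']

theorem treeD_treeD_gen (n : ℕ) : treeD 𝕜 (treeD 𝕜 (gen 𝕜 n)) = 0 := by
  rw [treeD_treeD_gen_eq, ← neg_eq_iff_eq_neg.2 (sum_outerTerm_sequential (𝕜 := 𝕜) n),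
    ← Finset.sum_filter_add_sum_filter_not (outerSplit n)
      (fun z => z.2.1 ≤ z.1.1 ∧ z.1.1 < z.2.1 + z.2.2), add_comm, ← add_assoc, neg_add_cancel,
    zero_add, ← Finset.sum_filter_add_sum_filter_not _ (fun z => z.1.1 < z.2.1),
    Finset.filter_filter, Finset.filter_filter]
  have e1 : (outerSplit n).filter (fun z => ¬ (z.2.1 ≤ z.1.1 ∧ z.1.1 < z.2.1 + z.2.2) ∧
      z.1.1 < z.2.1) = (outerSplit n).filter (fun z => z.1.1 < z.2.1) := by
    ext z; simp only [Finset.mem_filter]; exact and_congr_right fun _ => by omega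
  have e2 : (outerSplit n).filter (fun z => ¬ (z.2.1 ≤ z.1.1 ∧ z.1.1 < z.2.1 + z.2.2) ∧
      ¬ z.1.1 < z.2.1) = (outerSplit n).filter (fun z => z.2.1 + z.2.2 ≤ z.1.1) := by
    ext z; simp only [Finset.mem_filter]; exact and_congr_right fun _ => by omega
  rw [e1, e2, sum_outerTerm_parallel, neg_add_cancel]

end
end OInfinity
-- Generation by corollas and the dg operad axioms.
namespace OInfinity
open PTree

/-- A tree is obtained from the corolla of its root by grafting the subtrees that are not leaves,
one after the other. Statements compatible with composition thus need only be checked on generators.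
-/
theorem basisTrees_induction {p : PTree → Prop} (corolla : ∀ n, 2 ≤ n → p (corolla n))
    (graft : ∀ (m n i : ℕ) (t s : PTree), t ∈ basisTrees m → s ∈ basisTrees n → 1 ≤ i → i ≤ m →
      p t → p s → p (graft i s t)) (t : PTree) : t.IsReduced → t ≠ .leaf → p t := by
  induction t using forall_of_node with
  | leaf => simp
  | node ts ih =>
    intro hts _
    rw [isReduced_node_iff] at hts
    -- Here `as` are the subtrees already treated, while the remaining inputs are still leaves; the
    -- lower bound on the length keeps the intermediate trees reduced.
    suffices H : ∀ as : List PTree, (∀ t ∈ as, t.IsReduced) → 2 ≤ as.length + ts.length →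
        p (node (as ++ List.replicate ts.length leaf)) → p (node (as ++ ts)) from
      H [] (by simp) (by simpa using hts.1) (corolla _ hts.1)
    replace hts := hts.2
    clear * - corolla graft ih hts
    induction ts with
    | nil => simp
    | cons t ts ih' =>
      intro as has hl hp
      simp only [List.forall_mem_cons, List.length_cons] at ih hts hl
      have key := ih' ih.2 hts.2 (as ++ [t])
        (by simpa [or_imp, forall_and] using ⟨has, hts.1⟩) (by simp; omega)
      rw [List.append_assoc, List.append_assoc] at key
      refine key ?_
      rw [List.length_cons, List.replicate_succ] at hp
      by_cases ht : t = leaf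
      · rwa [ht]
      · rw [List.singleton_append, ← graft_append_leaf]
        refine graft _ _ _ _ _ ⟨?_, by simp, rfl⟩ ⟨hts.1, ht, rfl⟩ (by omega) (by simp) hp
          (ih.1 hts.1 ht)
        rw [isReduced_node_iff]
        refine ⟨by simp; omega, fun u hu => ?_⟩
        simp only [List.mem_append, List.mem_cons, List.mem_replicate] at hu
        rcases hu with hu | rfl | ⟨-, rfl⟩
        · exact has u hu
        · exact .leaf
        · exact .leaf

section

variable {𝕜 : Type u} [Field 𝕜]

theorem negOnePow_smul_treeComp_single (i : ℕ) (t s : PTree) :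
    (s.degree * t.degreeAfter i).negOnePow • treeComp 𝕜 i (Finsupp.single t 1)
      (Finsupp.single s 1) = Finsupp.single (graft i s t) 1 := by
  rw [treeComp_single, smul_smul, Int.units_mul_self, one_smul]

theorem treeD_mem_deg {n : ℕ} {a : ℤ} {x : PTree →₀ 𝕜}
    (hx : x ∈ Finsupp.supported 𝕜 𝕜 (basisTreesDeg n a)) :
    treeD 𝕜 x ∈ Finsupp.supported 𝕜 𝕜 (basisTreesDeg n (a - 1)) := by
  rw [basisTreesDeg, Finsupp.supported_inter]
  exact ⟨treeD_mem (Finsupp.supported_mono Set.inter_subset_left hx), treeD_deg hx⟩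

theorem single_mem_deg {n : ℕ} {t : PTree} (ht : t ∈ basisTrees n) :
    Finsupp.single t (1 : 𝕜) ∈ Finsupp.supported 𝕜 𝕜 (basisTreesDeg n t.degree) :=
  Finsupp.single_mem_supported _ _ ⟨ht, rfl⟩

/-- In `d²` of a composite the two mixed terms carry the signs of `a` and `a - 1` and cancel, so
vanishing on the corollas propagates to all trees. -/
theorem treeD_treeD {n : ℕ} {x : PTree →₀ 𝕜} (hx : x ∈ Finsupp.supported 𝕜 𝕜 (basisTrees n)) :
    treeD 𝕜 (treeD 𝕜 x) = 0 := by
  induction hx using supported_induction with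
  | zero => simp
  | add x y _ _ h h' => simp only [map_add, h, h', add_zero]
  | smul c x _ h => simp only [map_smul, h, smul_zero]
  | single t ht =>
    refine basisTrees_induction (p := fun t => treeD 𝕜 (treeD 𝕜 (Finsupp.single t 1)) = 0)
      (fun n _ => treeD_treeD_gen n) ?_ t ht.1 ht.2.1
    intro m n i t s ht hs hi him h1 h2
    rw [← negOnePow_smul_treeComp_single, map_units_smul', map_units_smul',
      treeD_treeComp hi him (single_mem_deg ht), map_add, map_units_smul',
      treeD_treeComp hi him (treeD_mem_deg (single_mem_deg ht)),
      treeD_treeComp hi him (single_mem_deg ht), h1, h2, Int.negOnePow_sub]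
    simp

variable (𝕜) in
theorem AInf_isDGOperad : (AInf 𝕜).IsDGOperad where
  toIsGradedOperad := AInf_isGradedOperad
  d_mem := treeD_mem
  d_deg {n a x} hx := by
    rw [AInf_obj_inf_deg] at hx
    exact treeD_deg hx
  d_d := treeD_treeD
  d_comp {m n i a x y} hi him hx _ := by
    rw [AInf_obj_inf_deg] at hx
    exact treeD_treeComp hi him hx y

variable (𝕜) in
theorem AInf_t_mem {n : ℕ} (hn : 2 ≤ n) :
    AInf.t 𝕜 n ∈ (AInf 𝕜).obj n ∧ AInf.t 𝕜 n ∈ (AInf 𝕜).deg (n - 2) :=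
  ⟨gen_mem hn, Finsupp.single_mem_supported _ _ (degree_corolla n)⟩

variable (𝕜) in
theorem AInf_d_t {n : ℕ} : (AInf 𝕜).d (AInf.t 𝕜 n) =
      ∑ q ∈ Finset.Ico 2 n, ∑ p ∈ Finset.range (n - q + 1),
        ((-1 : 𝕜) ^ (p + q * (n - p - q))) •
          (AInf 𝕜).comp (p + 1) (AInf.t 𝕜 (n - q + 1)) (AInf.t 𝕜 q) := by
  rw [Finset.sum_sigma']
  refine (treeD_gen n).trans ?_
  refine Finset.sum_bij' (fun x _ => ⟨x.2, x.1⟩) (fun x _ => (x.2, x.1)) ?_ ?_ ?_ ?_ ?_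
  · intro x hx
    simp only [mem_splitSet, Finset.mem_sigma, Finset.mem_Ico, Finset.mem_range] at hx ⊢
    omega
  · intro x hx
    simp only [mem_splitSet, Finset.mem_sigma, Finset.mem_Ico, Finset.mem_range] at hx ⊢
    omega
  · simp
  · simp
  · intro x hx
    rw [mem_splitSet] at hx
    -- The subtraction in the exponent of the statement is truncated; it agrees with the integral
    -- one because `p + q ≤ n`.
    have e : ((x.1 : ℤ) + x.2 * (n - x.1 - x.2)) = ((x.1 + x.2 * (n - x.1 - x.2) : ℕ) : ℤ) := by
      rw [Nat.cast_add, Nat.cast_mul, Nat.cast_sub (show x.2 ≤ n - x.1 by omega),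
        Nat.cast_sub (show x.1 ≤ n by omega)]
    rw [e, Int.negOnePow_def, Units.smul_def, zpow_natCast]
    push_cast
    rw [← Int.cast_smul_eq_zsmul 𝕜]
    push_cast
    rfl

end

-- Evaluation of trees in an operad, and freeness.

namespace OperadData

variable {𝕜 : Type u} [Field 𝕜] {Q : OperadData 𝕜}

theorem IsGradedOperad.comp_mem_deg (hQ : Q.IsGradedOperad) {m n i : ℕ} {a b : ℤ} {x y : Q.V}
    (hi : 1 ≤ i) (him : i ≤ m) (hx : x ∈ Q.obj m ⊓ Q.deg a) (hy : y ∈ Q.obj n ⊓ Q.deg b) :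
    Q.comp i x y ∈ Q.obj (m + n - 1) ⊓ Q.deg (a + b) :=
  ⟨hQ.comp_mem hi him hx.1 hy.1, hQ.comp_deg hi him hx hy⟩

end OperadData

section Free

variable {𝕜 : Type u} [Field 𝕜] (Q : OperadData 𝕜) (γ : ℕ → Q.V)

/-- The composition of `x` with the value `y` of `t` at the input `o + 1`; the leaf is a unit. -/
noncomputable def composeAt (o : ℕ) (x y : Q.V) : PTree → Q.V
  | .leaf => x
  | .node _ => Q.comp (o + 1) x y

mutual
/-- The value of a tree in an operad, if the corollas are sent to the elements `γ n`. -/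
noncomputable def treeEval : PTree → Q.V
  | .leaf => 0
  | .node ts => treeEvalList ts 0 (γ ts.length)
/-- The composition of `x` with the values of the trees of a list, at the inputs that come after the
first `o` ones. -/
noncomputable def treeEvalList : List PTree → ℕ → Q.V → Q.V
  | [], _, x => x
  | t :: ts, o, x => treeEvalList ts (o + leaves t) (composeAt Q o x (treeEval t) t)
end

@[simp] theorem treeEvalList_nil (o x) : treeEvalList Q γ [] o x = x := by rw [treeEvalList]

theorem treeEval_node (ts) : treeEval Q γ (node ts) = treeEvalList Q γ ts 0 (γ ts.length) := by
  rw [treeEval]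

theorem treeEvalList_leaf_cons (ts o x) :
    treeEvalList Q γ (leaf :: ts) o x = treeEvalList Q γ ts (o + 1) x := by
  rw [treeEvalList, composeAt, leaves_leaf]

theorem treeEvalList_cons {t : PTree} (ht : t ≠ leaf) (ts o x) :
    treeEvalList Q γ (t :: ts) o x =
      treeEvalList Q γ ts (o + leaves t) (Q.comp (o + 1) x (treeEval Q γ t)) := by
  cases t with
  | leaf => exact absurd rfl ht
  | node us => rw [treeEvalList, composeAt]

theorem treeEvalList_smul (u : ℤˣ) (ts o x) :
    treeEvalList Q γ ts o (u • x) = u • treeEvalList Q γ ts o x := by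
  induction ts generalizing o x with
  | nil => simp
  | cons t ts ih =>
    by_cases ht : t = leaf
    · rw [ht, treeEvalList_leaf_cons, treeEvalList_leaf_cons, ih]
    · rw [treeEvalList_cons _ _ ht, treeEvalList_cons _ _ ht, ← ih, LinearMap.map_smul_of_tower,
        LinearMap.smul_apply]

theorem treeEval_corolla (n : ℕ) : treeEval Q γ (corolla n) = γ n := by
  have h : ∀ k o x, treeEvalList Q γ (List.replicate k leaf) o x = x := by
    intro k
    induction k with
    | zero => simp
    | succ k ih => intro o x; rw [List.replicate_succ, treeEvalList_leaf_cons, ih]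
  rw [corolla, treeEval_node, h, List.length_replicate]

variable {Q γ}

mutual
theorem treeEval_mem (hQ : Q.IsGradedOperad)
    (hγ : ∀ n, 2 ≤ n → γ n ∈ Q.obj n ⊓ Q.deg ((n : ℤ) - 2)) : ∀ t : PTree, t.IsReduced → t ≠ .leaf →
    treeEval Q γ t ∈ Q.obj t.leaves ⊓ Q.deg t.degree
  | .leaf, _, h => absurd rfl h
  | .node ts, h, _ => by
    rw [isReduced_node_iff] at h
    rw [treeEval_node, leaves_node, degree_node, ← zero_add (leavesList ts)]
    exact treeEvalList_mem hQ hγ ts h.2 _ _ (by simpa using hγ _ h.1)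
theorem treeEvalList_mem (hQ : Q.IsGradedOperad)
    (hγ : ∀ n, 2 ≤ n → γ n ∈ Q.obj n ⊓ Q.deg ((n : ℤ) - 2)) : ∀ ts : List PTree, (∀ t ∈ ts, t.IsReduced) → ∀ (o : ℕ) {a : ℤ} (x : Q.V),
    x ∈ Q.obj (o + ts.length) ⊓ Q.deg a →
    treeEvalList Q γ ts o x ∈ Q.obj (o + leavesList ts) ⊓ Q.deg (a + degreeList ts)
  | [], _, o, a, x, hx => by simpa using hx
  | t :: ts, h, o, a, x, hx => by
    simp only [List.forall_mem_cons] at h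
    by_cases ht : t = leaf
    · rw [ht, treeEvalList_leaf_cons]
      have := treeEvalList_mem hQ hγ ts h.2 (o + 1) (a := a) x
        (by rwa [List.length_cons, ← add_assoc, add_right_comm] at hx)
      rwa [leavesList_cons, degreeList_cons, leaves_leaf, degree_leaf, zero_add, ← add_assoc]
    · rw [treeEvalList_cons _ _ ht]
      have h1 := treeEval_mem hQ hγ t h.1 ht
      rw [List.length_cons] at hx
      have h2 := hQ.comp_mem_deg (i := o + 1) (by omega) (by omega) hx h1
      rw [show o + (ts.length + 1) + t.leaves - 1 = o + t.leaves + ts.length by omega] at h2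
      have := treeEvalList_mem hQ hγ ts h.2 _ _ h2
      rwa [leavesList_cons, degreeList_cons, ← add_assoc, ← add_assoc]
end

/-- A composition at an input `j ≤ o` commutes, by the parallel axiom, with all compositions still
to be made. Passing the remaining subtrees gives the sign, and the position counter moves by `n -
1`. -/
theorem treeEvalList_comp (hQ : Q.IsGradedOperad)
    (hγ : ∀ n, 2 ≤ n → γ n ∈ Q.obj n ⊓ Q.deg ((n : ℤ) - 2)) {b : ℤ} {n j : ℕ} {y : Q.V} (hy : y ∈ Q.obj n ⊓ Q.deg b) (hj : 1 ≤ j)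
    (ts : List PTree) (hts : ∀ t ∈ ts, t.IsReduced) (o : ℕ) {a : ℤ} (x : Q.V)
    (hx : x ∈ Q.obj (o + ts.length) ⊓ Q.deg a) (hjo : j ≤ o) :
    (b * degreeList ts).negOnePow • treeEvalList Q γ ts (o + n - 1) (Q.comp j x y) =
      Q.comp j (treeEvalList Q γ ts o x) y := by
  induction ts generalizing o x a with
  | nil => simp
  | cons t ts ih =>
    simp only [List.forall_mem_cons] at hts
    rw [List.length_cons] at hx
    by_cases ht : t = leaf
    · rw [ht, treeEvalList_leaf_cons, treeEvalList_leaf_cons,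
        ← ih hts.2 (o + 1) x (a := a) (by rwa [add_assoc, add_comm 1]) (by omega),
        show o + n - 1 + 1 = o + 1 + n - 1 by omega]
      simp
    · have h1 := treeEval_mem hQ hγ t hts.1 ht
      have h2 := hQ.comp_mem_deg (i := o + 1) (by omega) (by omega) hx h1
      rw [show o + (ts.length + 1) + t.leaves - 1 = o + t.leaves + ts.length by omega] at h2
      have h3 := hQ.comp_par (j := o + 1) hj (by omega) (by omega) hx.1 hy h1
      rw [treeEvalList_cons _ _ ht, treeEvalList_cons _ _ ht, ← ih hts.2 _ _ h2 (by omega),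
        show o + n - 1 + 1 = o + 1 - 1 + n by omega, h3, treeEvalList_smul, smul_smul,
        ← Int.negOnePow_add, degreeList_cons,
        show o + n - 1 + t.leaves = o + t.leaves + n - 1 by omega]
      congr 1
      apply negOnePow_eq_of_even_sub
      refine ⟨b * t.degree, ?_⟩
      ring

mutual
-- Evaluation is multiplicative. The sequential axiom moves a composition into the subtree that
-- contains the leaf `i`, and `treeEvalList_comp` moves it past the subtrees on the right; the signs
-- are those of `degreeAfter`.
theorem treeEval_graft (hQ : Q.IsGradedOperad)
    (hγ : ∀ n, 2 ≤ n → γ n ∈ Q.obj n ⊓ Q.deg ((n : ℤ) - 2)) {s : PTree} (hs : s.IsReduced) (hs' : s ≠ .leaf) : ∀ (t : PTree) {i : ℕ},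
    t.IsReduced → t ≠ .leaf → 1 ≤ i → i ≤ t.leaves →
    (s.degree * t.degreeAfter i).negOnePow • treeEval Q γ (graft i s t) =
      Q.comp i (treeEval Q γ t) (treeEval Q γ s)
  | .leaf, _, _, h, _, _ => absurd rfl h
  | .node ts, i, h, _, hi, hi' => by
    rw [isReduced_node_iff] at h
    rw [leaves_node] at hi'
    rw [graft_node, treeEval_node, treeEval_node, degreeAfter_node, length_graftList]
    simpa using treeEvalList_graftList hQ hγ hs hs' ts h.2 hi hi' 0 (γ ts.length)
      (by simpa using hγ _ h.1)
theorem treeEvalList_graftList (hQ : Q.IsGradedOperad)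
    (hγ : ∀ n, 2 ≤ n → γ n ∈ Q.obj n ⊓ Q.deg ((n : ℤ) - 2)) {s : PTree} (hs : s.IsReduced) (hs' : s ≠ .leaf) :
    ∀ (ts : List PTree) {i : ℕ}, (∀ t ∈ ts, t.IsReduced) → 1 ≤ i → i ≤ leavesList ts →
    ∀ (o : ℕ) {a : ℤ} (x : Q.V), x ∈ Q.obj (o + ts.length) ⊓ Q.deg a →
    (s.degree * degreeAfterList i ts).negOnePow • treeEvalList Q γ (graftList i s ts) o x =
      Q.comp (o + i) (treeEvalList Q γ ts o x) (treeEval Q γ s)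
  | [], i, _, hi, hi', _, _, _, _ => by simp at hi'; omega
  | t :: ts, i, h, hi, hi', o, a, x, hx => by
    have h0 := treeEval_mem hQ hγ s hs hs'
    simp only [List.forall_mem_cons] at h
    rw [List.length_cons] at hx
    rw [leavesList_cons] at hi'
    by_cases ht : t = leaf
    · rw [ht, graftList_cons, degreeAfterList_cons, treeEvalList_leaf_cons]
      rw [ht, leaves_leaf] at hi'
      split_ifs with h1
      -- A leaf contributes no composition to the evaluation; grafting onto it creates a new one,
      -- which has to be moved past the later ones.
      · obtain rfl : i = 1 := by simp at h1; omega
        rw [degreeAfter_leaf, zero_add, graft_leaf, treeEvalList_cons _ _ hs',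
          ← treeEvalList_comp hQ hγ h0 (by omega) ts h.2 (o + 1) (a := a) x
          (by rwa [add_assoc, add_comm 1]) le_rfl,
          show o + 1 + s.leaves - 1 = o + s.leaves by omega]
      · have := treeEvalList_graftList hQ hγ hs hs' ts (i := i - 1) h.2 (by rw [leaves_leaf] at h1; omega)
          (by omega) (o + 1) (a := a) x (by rwa [add_assoc, add_comm 1])
        rw [leaves_leaf] at h1
        rw [leaves_leaf, treeEvalList_leaf_cons, this, show o + 1 + (i - 1) = o + i by omega]
    · have h1 := treeEval_mem hQ hγ t h.1 ht
      have h2 := hQ.comp_mem_deg (i := o + 1) (by omega) (by omega) hx h1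
      rw [show o + (ts.length + 1) + t.leaves - 1 = o + t.leaves + ts.length by omega] at h2
      rw [graftList_cons, degreeAfterList_cons, treeEvalList_cons _ _ ht]
      split_ifs with h3
      · have ht' : graft i s t ≠ leaf := by
          cases t with
          | leaf => exact absurd rfl ht
          | node us => simp
        have h4 := treeEval_graft hQ hγ hs hs' t h.1 ht hi h3
        have h5 := hQ.comp_seq (i := o + 1) (j := i) (by omega) (by omega) hi h3 hx.1 h1.1 h0.1
        have h6 := leaves_graft s t hi h3
        rw [treeEvalList_cons _ _ ht',
          ← treeEvalList_comp hQ hγ h0 (by omega) ts h.2 _ _ h2 (by omega),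
          show o + i = o + 1 - 1 + i by omega, h5, ← h4, LinearMap.map_smul_of_tower,
          treeEvalList_smul, smul_smul, ← Int.negOnePow_add,
          show o + t.leaves + s.leaves - 1 = o + (graft i s t).leaves by omega]
        congr 2
        ring
      · rw [treeEvalList_cons _ _ ht, treeEvalList_graftList hQ hγ hs hs' ts (i := i - t.leaves) h.2
          (by omega) (by omega) _ _ h2,
          show o + t.leaves + (i - t.leaves) = o + i by omega]
end

end Free

end OInfinity
namespace OInfinity
open PTree

section Free

variable {𝕜 : Type u} [Field 𝕜] (Q : OperadData 𝕜) (γ : ℕ → Q.V)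

/-- The linear extension of `treeEval`. -/
noncomputable def treeEvalLin : (PTree →₀ 𝕜) →ₗ[𝕜] Q.V :=
  Finsupp.linearCombination 𝕜 (treeEval Q γ)

theorem treeEvalLin_single (t : PTree) :
    treeEvalLin Q γ (Finsupp.single t 1) = treeEval Q γ t := by
  simp [treeEvalLin]

variable {Q γ}

theorem treeEvalLin_mem (hQ : Q.IsGradedOperad)
    (hγ : ∀ n, 2 ≤ n → γ n ∈ Q.obj n ⊓ Q.deg ((n : ℤ) - 2)) {n : ℕ} {x : PTree →₀ 𝕜}
    (hx : x ∈ Finsupp.supported 𝕜 𝕜 (basisTrees n)) : treeEvalLin Q γ x ∈ Q.obj n := by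
  induction hx using supported_induction with
  | zero => simp
  | add x y _ _ h h' => simpa using add_mem h h'
  | smul c x _ h => simpa using Submodule.smul_mem _ c h
  | single t ht =>
    obtain ⟨h1, h2, rfl⟩ := ht
    rw [treeEvalLin_single]
    exact (treeEval_mem hQ hγ t h1 h2).1

theorem treeEvalLin_deg (hQ : Q.IsGradedOperad)
    (hγ : ∀ n, 2 ≤ n → γ n ∈ Q.obj n ⊓ Q.deg ((n : ℤ) - 2)) {n : ℕ} {a : ℤ} {x : PTree →₀ 𝕜}
    (hx : x ∈ Finsupp.supported 𝕜 𝕜 (basisTreesDeg n a)) : treeEvalLin Q γ x ∈ Q.deg a := by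
  induction hx using supported_induction with
  | zero => simp
  | add x y _ _ h h' => simpa using add_mem h h'
  | smul c x _ h => simpa using Submodule.smul_mem _ c h
  | single t ht =>
    obtain ⟨⟨h1, h2, rfl⟩, rfl⟩ := ht
    rw [treeEvalLin_single]
    exact (treeEval_mem hQ hγ t h1 h2).2

theorem treeEvalLin_comp (hQ : Q.IsGradedOperad)
    (hγ : ∀ n, 2 ≤ n → γ n ∈ Q.obj n ⊓ Q.deg ((n : ℤ) - 2)) {m n i : ℕ} (hi : 1 ≤ i) (him : i ≤ m)
    {x y : PTree →₀ 𝕜} (hx : x ∈ Finsupp.supported 𝕜 𝕜 (basisTrees m))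
    (hy : y ∈ Finsupp.supported 𝕜 𝕜 (basisTrees n)) :
    treeEvalLin Q γ (treeComp 𝕜 i x y) = Q.comp i (treeEvalLin Q γ x) (treeEvalLin Q γ y) := by
  induction hx using supported_induction with
  | zero => simp
  | add x y _ _ h h' => simp only [map_add, LinearMap.add_apply, h, h']
  | smul c x _ h => simp only [map_smul, LinearMap.smul_apply, h]
  | single t ht =>
    induction hy using supported_induction with
    | zero => simp
    | add x y _ _ h h' => simp only [map_add, h, h']
    | smul c x _ h => simp only [map_smul, h]
    | single s hs =>
      obtain ⟨h1, h2, rfl⟩ := ht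
      obtain ⟨h3, h4, rfl⟩ := hs
      rw [treeComp_single, map_units_smul', treeEvalLin_single, treeEvalLin_single,
        treeEvalLin_single, treeEval_graft hQ hγ h3 h4 t h1 h2 hi him]

variable (Q γ) in
/-- The restrictions of `treeEvalLin` to the arity components. -/
noncomputable def treeEvalHom (hQ : Q.IsGradedOperad)
    (hγ : ∀ n, 2 ≤ n → γ n ∈ Q.obj n ⊓ Q.deg ((n : ℤ) - 2)) (n : ℕ) :
    (AInf 𝕜).obj n →ₗ[𝕜] Q.obj n :=
  LinearMap.codRestrict _ (LinearMap.domRestrict (treeEvalLin Q γ)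
    (Finsupp.supported 𝕜 𝕜 (basisTrees n))) fun x => treeEvalLin_mem hQ hγ x.2

theorem treeEvalHom_isGradedHom (hQ : Q.IsGradedOperad)
    (hγ : ∀ n, 2 ≤ n → γ n ∈ Q.obj n ⊓ Q.deg ((n : ℤ) - 2)) :
    OperadData.IsGradedHom (AInf 𝕜) Q (treeEvalHom Q γ hQ hγ) where
  map_deg {n a} x hx := by
    have h := Submodule.mem_inf.2 ⟨x.2, hx⟩
    rw [AInf_obj_inf_deg] at h
    exact treeEvalLin_deg hQ hγ h
  map_comp {m n i} x y z hi him h :=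
    (congrArg (treeEvalLin Q γ) h).trans (treeEvalLin_comp hQ hγ hi him x.2 y.2)

/-- Uniqueness in the universal property: both sides agree on corollas and respect grafting. -/
theorem gradedHom_eq_treeEvalLin (hQ : Q.IsGradedOperad)
    (hγ : ∀ n, 2 ≤ n → γ n ∈ Q.obj n ⊓ Q.deg ((n : ℤ) - 2))
    {f : ∀ n, (AInf 𝕜).obj n →ₗ[𝕜] Q.obj n} (hf : OperadData.IsGradedHom (AInf 𝕜) Q f)
    (hfγ : ∀ n (hn : 2 ≤ n), (f n ⟨AInf.t 𝕜 n, (AInf_t_mem 𝕜 hn).1⟩ : Q.V) = γ n)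
    {n : ℕ} (x : (AInf 𝕜).obj n) : (f n x : Q.V) = treeEvalLin Q γ x.1 := by
  obtain ⟨x, hx⟩ := x
  have hx' : x ∈ Finsupp.supported 𝕜 𝕜 (basisTrees n) := hx
  induction hx' using supported_induction with
  | zero =>
    exact (congrArg Subtype.val (map_zero (f n))).trans (map_zero (treeEvalLin Q γ)).symm
  | add x y h1 h2 h h' =>
    have := congrArg (Subtype.val) (map_add (f n) ⟨x, h1⟩ ⟨y, h2⟩)
    exact this.trans ((congrArg₂ (· + ·) (h h1) (h' h2)).trans (map_add (treeEvalLin Q γ) x y).symm)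
  | smul c x h1 h =>
    have := congrArg (Subtype.val) (map_smul (f n) c ⟨x, h1⟩)
    exact this.trans ((congrArg (c • ·) (h h1)).trans (map_smul (treeEvalLin Q γ) c x).symm)
  | single t ht =>
    refine (?_ : _ = treeEval Q γ t).trans (treeEvalLin_single Q γ t).symm
    refine basisTrees_induction (p := fun t => ∀ n (ht : t ∈ basisTrees n),
      (f n ⟨Finsupp.single t 1, Finsupp.single_mem_supported 𝕜 1 ht⟩ : Q.V) = treeEval Q γ t)
      ?_ ?_ t ht.1 ht.2.1 n ht
    · intro k hk n hn
      obtain rfl : k = n := by simpa using hn.2.2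
      rw [treeEval_corolla]
      exact hfγ k hk
    · intro m n i t s ht hs hi him h1 h2 k hk
      obtain rfl : m + n - 1 = k := (graft_mem_basisTrees hi him ht hs).2.2.symm.trans hk.2.2
      let T : (AInf 𝕜).obj m := ⟨_, Finsupp.single_mem_supported 𝕜 1 ht⟩
      let S : (AInf 𝕜).obj n := ⟨_, Finsupp.single_mem_supported 𝕜 1 hs⟩
      let G : (AInf 𝕜).obj (m + n - 1) := ⟨_, Finsupp.single_mem_supported 𝕜 1 hk⟩
      let u : ℤˣ := (s.degree * t.degreeAfter i).negOnePow
      have h3 : (f (m + n - 1) (u • G) : Q.V) = Q.comp i (f m T) (f n S) :=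
        hf.map_comp T S (u • G) hi him (treeComp_single i t s).symm
      have h4 : (f (m + n - 1) (u • G) : Q.V) = u • (f (m + n - 1) G : Q.V) :=
        congrArg Subtype.val (map_units_smul' (f (m + n - 1)) u G)
      rw [h1 m ht, h2 n hs] at h3
      obtain ⟨h5, h6, rfl⟩ := ht
      rw [← treeEval_graft hQ hγ hs.1 hs.2.1 t h5 h6 hi him] at h3
      exact smul_left_cancel u (h4.symm.trans h3)

variable (𝕜) in
theorem AInf_isFreeOn : (AInf 𝕜).IsFreeOn
    (fun n => if 2 ≤ n then Submodule.span 𝕜 {AInf.t 𝕜 n} else ⊥) := by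
  have hmem : ∀ n, 2 ≤ n →
      AInf.t 𝕜 n ∈ (if 2 ≤ n then Submodule.span 𝕜 {AInf.t 𝕜 n} else ⊥) := by
    intro n hn
    rw [if_pos hn]
    exact Submodule.mem_span_singleton_self _
  refine ⟨fun n => ?_, fun n => ?_, ?_⟩
  · beta_reduce
    split_ifs with hn
    · rw [Submodule.span_singleton_le_iff_mem]
      exact (AInf_t_mem 𝕜 hn).1
    · exact bot_le
  · refine le_trans ?_ (le_iSup _ ((n : ℤ) - 2))
    beta_reduce
    split_ifs with hn
    · rw [Submodule.span_singleton_le_iff_mem]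
      exact ⟨Submodule.mem_span_singleton_self _, (AInf_t_mem 𝕜 hn).2⟩
    · exact bot_le
  · intro Q hQ g hg
    -- There are no generators of arity below two; the value chosen there is arbitrary, since
    -- reduced trees never use it.
    obtain ⟨γ, hγ⟩ : ∃ γ : ℕ → Q.V, ∀ n (hn : 2 ≤ n), γ n = g n ⟨AInf.t 𝕜 n, hmem n hn⟩ :=
      ⟨fun n => if hn : 2 ≤ n then g n ⟨AInf.t 𝕜 n, hmem n hn⟩ else 0, fun n hn => dif_pos hn⟩
    have hγ' : ∀ n, 2 ≤ n → γ n ∈ Q.obj n ⊓ Q.deg ((n : ℤ) - 2) := fun n hn => by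
      rw [hγ n hn]
      exact ⟨(g n _).2, hg _ _ _ (AInf_t_mem 𝕜 hn).2⟩
    refine ⟨treeEvalHom Q γ hQ hγ', ⟨treeEvalHom_isGradedHom hQ hγ', ?_⟩, ?_⟩
    · rintro n ⟨x, hx⟩ ⟨e, he⟩ (rfl : x = e)
      apply Subtype.ext
      change treeEvalLin Q γ x = _
      by_cases hn : 2 ≤ n
      · have he' : x ∈ (if 2 ≤ n then Submodule.span 𝕜 {AInf.t 𝕜 n} else ⊥) := he
        rw [if_pos hn] at he'
        obtain ⟨c, rfl⟩ := Submodule.mem_span_singleton.1 he'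
        have h1 : treeEvalLin Q γ (gen 𝕜 n) = γ n := by
          rw [gen, treeEvalLin_single, treeEval_corolla]
        have h2 := congrArg Subtype.val (map_smul (g n) c ⟨AInf.t 𝕜 n, hmem n hn⟩)
        refine (map_smul (treeEvalLin Q γ) c (gen 𝕜 n)).trans ?_
        rw [h1, hγ n hn]
        exact h2.symm
      · have he' : x ∈ (if 2 ≤ n then Submodule.span 𝕜 {AInf.t 𝕜 n} else ⊥) := he
        rw [if_neg hn, Submodule.mem_bot] at he'
        subst he'
        have h2 := congrArg Subtype.val (map_zero (g n))
        exact (map_zero (treeEvalLin Q γ)).trans h2.symm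
    · rintro f ⟨hf, hfg⟩
      funext n
      ext x
      refine gradedHom_eq_treeEvalLin hQ hγ' hf (fun n hn => ?_) x
      rw [hγ n hn]
      exact congrArg Subtype.val (hfg n ⟨AInf.t 𝕜 n, (AInf_t_mem 𝕜 hn).1⟩ ⟨AInf.t 𝕜 n, hmem n hn⟩ rfl)

end Free
end OInfinity
namespace OInfinity
open PTree

-- The operad `As`.

section As

variable (𝕜 : Type u) [Field 𝕜]

/-- The partial composition of `As`. -/
noncomputable def asComp : (ℕ →₀ 𝕜) →ₗ[𝕜] (ℕ →₀ 𝕜) →ₗ[𝕜] (ℕ →₀ 𝕜) :=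
  Finsupp.linearCombination 𝕜 fun m : ℕ =>
    Finsupp.linearCombination 𝕜 fun n : ℕ => Finsupp.single (m + n - 1) (1 : 𝕜)

/-- The basis of `As` in arity `n`. -/
def asBasis (n : ℕ) : Set ℕ := {m | m = n ∧ 2 ≤ n}

variable {𝕜}

theorem asComp_single (m n : ℕ) :
    asComp 𝕜 (Finsupp.single m 1) (Finsupp.single n 1) = Finsupp.single (m + n - 1) 1 := by
  simp [asComp]

theorem asComp_mem {m n : ℕ} {x y : ℕ →₀ 𝕜} (hx : x ∈ Finsupp.supported 𝕜 𝕜 (asBasis m))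
    (hy : y ∈ Finsupp.supported 𝕜 𝕜 (asBasis n)) :
    asComp 𝕜 x y ∈ Finsupp.supported 𝕜 𝕜 (asBasis (m + n - 1)) := by
  induction hx using supported_induction with
  | zero => simp
  | add x y _ _ h1 h2 => simpa using add_mem h1 h2
  | smul c x _ h => simpa using Submodule.smul_mem _ c h
  | single t ht =>
    induction hy using supported_induction with
    | zero => simp
    | add x y _ _ h1 h2 => simpa using add_mem h1 h2
    | smul c x _ h => simpa using Submodule.smul_mem _ c h
    | single s hs =>
      rw [asComp_single]
      obtain ⟨rfl, ht⟩ := ht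
      obtain ⟨rfl, hs⟩ := hs
      exact Finsupp.single_mem_supported _ _ ⟨rfl, by omega⟩

/-- The composition does not depend on the input, so this contains both axioms up to the Koszul
sign. Positivity of the arities makes the truncated subtractions harmless. -/
theorem asComp_assoc {m n p : ℕ} {x y z : ℕ →₀ 𝕜} (hx : x ∈ Finsupp.supported 𝕜 𝕜 (asBasis m))
    (hy : y ∈ Finsupp.supported 𝕜 𝕜 (asBasis n)) (hz : z ∈ Finsupp.supported 𝕜 𝕜 (asBasis p)) :
    asComp 𝕜 (asComp 𝕜 x y) z = asComp 𝕜 x (asComp 𝕜 y z) ∧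
      asComp 𝕜 (asComp 𝕜 x y) z = asComp 𝕜 (asComp 𝕜 x z) y := by
  induction hx using supported_induction with
  | zero => simp
  | add x y _ _ h1 h2 => simp only [map_add, LinearMap.add_apply, ← h1.1, ← h1.2, ← h2.1, ← h2.2,
      and_self]
  | smul c x _ h => simp only [map_smul, LinearMap.smul_apply, ← h.1, ← h.2, and_self]
  | single a ha =>
    induction hy using supported_induction with
    | zero => simp
    | add x y _ _ h1 h2 => simp only [map_add, LinearMap.add_apply, ← h1.1, ← h1.2, ← h2.1, ← h2.2,
        and_self]
    | smul c x _ h => simp only [map_smul, LinearMap.smul_apply, ← h.1, ← h.2, and_self]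
    | single b hb =>
      induction hz using supported_induction with
      | zero => simp
      | add x y _ _ h1 h2 => simp only [map_add, LinearMap.add_apply, ← h1.1, ← h1.2, ← h2.1,
          ← h2.2, and_self]
      | smul c x _ h => simp only [map_smul, LinearMap.smul_apply, ← h.1, ← h.2, and_self]
      | single c hc =>
        simp only [asComp_single]
        obtain ⟨rfl, ha⟩ := ha
        obtain ⟨rfl, hb⟩ := hb
        obtain ⟨rfl, hc⟩ := hc
        constructor <;> congr 1 <;> omega

theorem As_deg_zero : (As 𝕜).deg 0 = ⊤ :=
  if_pos (c := (0 : ℤ) = 0) (t := (⊤ : Submodule 𝕜 (ℕ →₀ 𝕜))) (e := ⊥) rfl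

theorem As_deg_ne_zero {a : ℤ} (ha : a ≠ 0) : (As 𝕜).deg a = ⊥ :=
  if_neg (c := a = 0) (t := ⊤) (e := (⊥ : Submodule 𝕜 (ℕ →₀ 𝕜))) ha

theorem As_eq_zero_of_deg {a : ℤ} (ha : a ≠ 0) {x : (As 𝕜).V} (hx : x ∈ (As 𝕜).deg a) : x = 0 := by
  rwa [As_deg_ne_zero ha, Submodule.mem_bot] at hx

variable (𝕜) in
theorem As_isGradedOperad : (As 𝕜).IsGradedOperad where
  le_iSup_deg n := by
    refine le_trans ?_ (le_iSup _ 0)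
    rw [As_deg_zero, inf_top_eq]
  independent n a := by
    by_cases ha : a = 0
    · refine Disjoint.mono_right (iSup₂_le fun b hb => ?_) disjoint_bot_right
      change (As 𝕜).obj n ⊓ (As 𝕜).deg b ≤ ⊥
      rw [As_deg_ne_zero (fun h => hb (h.trans ha.symm)), inf_bot_eq]
    · refine Disjoint.mono_left ?_ disjoint_bot_left
      change (As 𝕜).obj n ⊓ (As 𝕜).deg a ≤ ⊥
      rw [As_deg_ne_zero ha, inf_bot_eq]
  comp_mem _ _ hx hy := asComp_mem hx hy
  comp_deg {m n i a b x y} _ _ hx hy := by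
    by_cases ha : a = 0
    · by_cases hb : b = 0
      · rw [ha, hb, add_zero, As_deg_zero]
        trivial
      · rw [As_eq_zero_of_deg hb hy.2, map_zero]
        exact zero_mem _
    · rw [As_eq_zero_of_deg ha hx.2, map_zero, LinearMap.zero_apply]
      exact zero_mem _
  comp_seq _ _ _ _ hx hy hz := (asComp_assoc hx hy hz).1
  comp_par {m n p i j b c x y z} _ _ _ hx hy hz := by
    -- Only degree zero contains non-zero elements, so the Koszul sign is trivial or both sides
    -- vanish.
    by_cases hb : b = 0
    · rw [hb, zero_mul, Int.negOnePow_zero, one_smul]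
      exact (asComp_assoc hx hy.1 hz.1).2
    · rw [As_eq_zero_of_deg hb hy.2]
      simp only [map_zero, LinearMap.zero_apply, smul_zero]

variable (𝕜) in
theorem As_isDGOperad : (As 𝕜).IsDGOperad where
  toIsGradedOperad := As_isGradedOperad 𝕜
  d_mem _ := zero_mem _
  d_deg _ := zero_mem _
  d_d _ := rfl
  d_comp {m n i a x y} _ _ _ _ := by
    have h (z : (As 𝕜).V) : (As 𝕜).d z = 0 := rfl
    simp only [h, map_zero, LinearMap.zero_apply, smul_zero, add_zero]

end As

-- The morphism from `A_∞` to `As`.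

section Augmentation

variable (𝕜 : Type u) [Field 𝕜]

/-- The images in `As` of the generators of `AInf`. -/
noncomputable def asGen (n : ℕ) : (As 𝕜).V :=
  (if n = 2 then Finsupp.single 2 1 else 0 : ℕ →₀ 𝕜)

theorem asGen_two : asGen 𝕜 2 = (Finsupp.single 2 1 : ℕ →₀ 𝕜) := if_pos rfl

theorem asGen_ne_two {n : ℕ} (hn : n ≠ 2) : asGen 𝕜 n = 0 := if_neg hn

theorem asGen_mem (n : ℕ) (_ : 2 ≤ n) :
    asGen 𝕜 n ∈ (As 𝕜).obj n ⊓ (As 𝕜).deg ((n : ℤ) - 2) := by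
  by_cases h : n = 2
  · subst h
    rw [asGen_two, show ((2 : ℕ) : ℤ) - 2 = 0 from rfl, As_deg_zero, inf_top_eq]
    exact Finsupp.single_mem_supported _ _ ⟨rfl, le_rfl⟩
  · rw [asGen_ne_two 𝕜 h]
    exact zero_mem _

/-- The map `AInf → As` on the vector space spanned by all trees. -/
noncomputable def augLin : (PTree →₀ 𝕜) →ₗ[𝕜] (As 𝕜).V := treeEvalLin (As 𝕜) (asGen 𝕜)

variable {𝕜}

theorem augLin_gen (n : ℕ) : augLin 𝕜 (gen 𝕜 n) = asGen 𝕜 n := by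
  rw [augLin, gen, treeEvalLin_single, treeEval_corolla]

theorem augLin_comp {m n i : ℕ} (hi : 1 ≤ i) (him : i ≤ m)
    {x y : PTree →₀ 𝕜} (hx : x ∈ Finsupp.supported 𝕜 𝕜 (basisTrees m))
    (hy : y ∈ Finsupp.supported 𝕜 𝕜 (basisTrees n)) :
    augLin 𝕜 (treeComp 𝕜 i x y) = (As 𝕜).comp i (augLin 𝕜 x) (augLin 𝕜 y) :=
  treeEvalLin_comp (As_isGradedOperad 𝕜) (asGen_mem 𝕜) hi him hx hy

/-- A composite of two generators has non-zero image only if both are binary. This happens only for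
`n = 3`, where the two bracketings occur with opposite signs and have the same image. -/
theorem augLin_treeD_gen (n : ℕ) : augLin 𝕜 (treeD 𝕜 (gen 𝕜 n)) = 0 := by
  have h : augLin 𝕜 (treeD 𝕜 (gen 𝕜 n)) = ∑ x ∈ splitSet n,
      ((x.1 : ℤ) + x.2 * (n - x.1 - x.2)).negOnePow •
      (As 𝕜).comp (x.1 + 1) (asGen 𝕜 (n - x.2 + 1)) (asGen 𝕜 x.2) := by
    rw [treeD_gen, map_sum]
    refine Finset.sum_congr rfl fun x hx => ?_
    rw [mem_splitSet] at hx
    rw [map_units_smul', augLin_comp (m := n - x.2 + 1) (by omega) (by omega)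
      (gen_mem (by omega)) (gen_mem hx.1), augLin_gen, augLin_gen]
  rw [h]
  by_cases hn : n = 3
  · subst hn
    have e : splitSet 3 = {(0, 2), (1, 2)} := by decide
    obtain ⟨w, e'⟩ : ∃ w, ∀ i, (As 𝕜).comp i (asGen 𝕜 2) (asGen 𝕜 2) = w :=
      ⟨asComp 𝕜 (asGen 𝕜 2) (asGen 𝕜 2), fun i => rfl⟩
    rw [e, Finset.sum_pair (by decide)]
    simp only [Nat.reduceSub, Nat.reduceAdd, e']
    norm_num [Units.smul_def, Int.negOnePow_def]
  · refine Finset.sum_eq_zero fun x hx => ?_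
    rw [mem_splitSet] at hx
    by_cases h2 : x.2 = 2
    · rw [asGen_ne_two 𝕜 (show n - x.2 + 1 ≠ 2 by omega), map_zero, LinearMap.zero_apply, smul_zero]
    · rw [asGen_ne_two 𝕜 h2, map_zero, smul_zero]

theorem augLin_treeD {n : ℕ} {x : PTree →₀ 𝕜} (hx : x ∈ Finsupp.supported 𝕜 𝕜 (basisTrees n)) :
    augLin 𝕜 (treeD 𝕜 x) = 0 := by
  induction hx using supported_induction with
  | zero => simp
  | add x y _ _ h h' => simp only [map_add, h, h', add_zero]
  | smul c x _ h => simp only [map_smul, h, smul_zero]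
  | single t ht =>
    refine basisTrees_induction (p := fun t => augLin 𝕜 (treeD 𝕜 (Finsupp.single t 1)) = 0)
      (fun n _ => augLin_treeD_gen n) ?_ t ht.1 ht.2.1
    intro m n i t s ht hs hi him h1 h2
    have ht' : Finsupp.single t (1 : 𝕜) ∈ _ := Finsupp.single_mem_supported 𝕜 1 ht
    have hs' : Finsupp.single s (1 : 𝕜) ∈ _ := Finsupp.single_mem_supported 𝕜 1 hs
    rw [← negOnePow_smul_treeComp_single, map_units_smul', map_units_smul',
      treeD_treeComp hi him (single_mem_deg ht), map_add, map_units_smul',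
      augLin_comp hi him (treeD_mem ht') hs', augLin_comp hi him ht' (treeD_mem hs'), h1, h2]
    simp only [map_zero, LinearMap.zero_apply, smul_zero, add_zero]

end Augmentation

-- The homology of `A_∞`.

section Acyclicity

namespace PTree

/-- The tree `node [t, leaf]`. -/
def addLeaf (t : PTree) : PTree := node [t, leaf]

/-- The left comb with `n + 1` leaves. -/
def comb : ℕ → PTree
  | 0 => leaf
  | n + 1 => addLeaf (comb n)

/-- The number of leaves of the first child of the root. -/
def firstLeaves : PTree → ℕ
  | leaf => 0
  | node [] => 0
  | node (c :: _) => leaves c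

/-- Binary root, and the second child of the root is not a leaf. -/
def IsRight (t : PTree) : Prop := ∃ c ds, t = node [c, node ds]

theorem addLeaf_injective : Function.Injective addLeaf := fun a b h => by
  simpa [addLeaf] using h

theorem leaves_comb (n : ℕ) : leaves (comb n) = n + 1 := by
  induction n with
  | zero => rfl
  | succ n ih => simp [comb, addLeaf, ih]

theorem isReduced_addLeaf {t : PTree} : (addLeaf t).IsReduced ↔ t.IsReduced := by
  rw [addLeaf, isReduced_node_iff]
  simp [IsReduced.leaf]

theorem isReduced_comb (n : ℕ) : (comb n).IsReduced := by
  induction n with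
  | zero => exact .leaf
  | succ n ih => exact isReduced_addLeaf.2 ih

theorem comb_mem_basisTrees (n : ℕ) : comb (n + 1) ∈ basisTrees (n + 2) :=
  ⟨isReduced_comb _, by simp [comb, addLeaf], leaves_comb _⟩

theorem addLeaf_mem_basisTrees {n : ℕ} {t : PTree} (ht : t ∈ basisTrees n) :
    addLeaf t ∈ basisTrees (n + 1) :=
  ⟨isReduced_addLeaf.2 ht.1, by simp [addLeaf], by simp [addLeaf, ht.2.2]⟩

theorem not_isRight_of_length {ts : List PTree} (h : 3 ≤ ts.length) : ¬ IsRight (node ts) := by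
  rintro ⟨c, ds, hc⟩
  rw [node.inj hc] at h
  simp at h

end PTree

variable {𝕜 : Type u} [Field 𝕜]

/-- The added root is binary: it has no terms of its own and degree zero, and the added leaf has
zero differential. -/
theorem treeD_lmapDomain_addLeaf (x : PTree →₀ 𝕜) :
    treeD 𝕜 (Finsupp.lmapDomain 𝕜 𝕜 addLeaf x) =
      Finsupp.lmapDomain 𝕜 𝕜 addLeaf (treeD 𝕜 x) := by
  induction x using basis_induction with
  | zero => simp
  | add x y h h' => simp only [map_add, h, h']
  | smul c x h => simp only [map_smul, h]
  | single t =>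
    rw [Finsupp.lmapDomain_apply, Finsupp.mapDomain_single, treeD_single, treeD_single, addLeaf,
      signedSum_dTerms_node, signedSum_dTermsList_cons, signedSum_dTermsList_cons]
    have e : splitIndex 2 = [] := by decide
    simp only [rootTerms_eq, List.length_cons, List.length_nil, Nat.reduceAdd, e, List.map_nil,
      signedSum_nil, dTermsList_nil, dTerms_leaf, map_zero, smul_zero, add_zero, zero_add]
    simp only [Nat.cast_ofNat, sub_self, Int.negOnePow_zero, one_smul]
    rw [← LinearMap.comp_apply, ← Finsupp.lmapDomain_comp]
    rfl

theorem treeD_comb (n : ℕ) : treeD 𝕜 (Finsupp.single (comb n) 1) = 0 := by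
  induction n with
  | zero => simp [treeD_single, comb]
  | succ n ih =>
    have := treeD_lmapDomain_addLeaf (Finsupp.single (comb n) (1 : 𝕜))
    rwa [ih, map_zero, Finsupp.lmapDomain_apply, Finsupp.mapDomain_single] at this

theorem augLin_comb (n : ℕ) : augLin 𝕜 (Finsupp.single (comb (n + 1)) 1) =
    (Finsupp.single (n + 2) 1 : ℕ →₀ 𝕜) := by
  induction n with
  | zero => exact (augLin_gen 2).trans (asGen_two 𝕜)
  | succ n ih =>
    rw [augLin, treeEvalLin_single] at ih ⊢
    rw [comb, addLeaf, treeEval_node, treeEvalList_cons _ _ (comb_mem_basisTrees n).2.1,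
      treeEvalList_leaf_cons, treeEvalList_nil, ih]
    refine (asComp_single 2 (n + 2)).trans ?_
    congr 1; omega

/-- The differential of a tree whose root has at least three inputs. -/
theorem exists_treeD_eq {n : ℕ} {c : PTree} {ds : List PTree} (hds : 2 ≤ ds.length)
    (ht : node (c :: ds) ∈ basisTrees n) : ∃ (u : ℤˣ) (y : PTree →₀ 𝕜),
    treeD 𝕜 (Finsupp.single (node (c :: ds)) 1) = u • Finsupp.single (node [c, node ds]) 1 + y ∧
    y ∈ Finsupp.supported 𝕜 𝕜 {t' | t' ∈ basisTrees n ∧ (t'.IsRight → c.leaves < t'.firstLeaves)} := by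
  have hr := ht.1
  rw [isReduced_node_iff, List.forall_mem_cons] at hr
  -- The leading term: all inputs of the root except the first move to the new vertex.
  have hmem : (1, ds.length) ∈ splitSet (ds.length + 1) := by
    rw [mem_splitSet]; simp only; omega
  have h1 : rootTerm (c :: ds) 1 ds.length =
      (rootTerm (c :: ds) 1 ds.length |>.1, node [c, node ds]) := by
    simp [rootTerm]
  rw [treeD_single, signedSum_dTerms_node, rootTerms_eq, signedSum, List.map_map,
    ← List.sum_toFinset _ (nodup_splitIndex _), List.length_cons, ← splitSet,
    ← Finset.add_sum_erase _ _ hmem, add_assoc]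
  refine ⟨(rootTerm (c :: ds) 1 ds.length).1, _, congrArg₂ (· + ·) ?_ rfl, ?_⟩
  · simp only [Function.comp_apply]
    rw [h1]
  · refine add_mem (sum_mem fun x hx => ?_) (units_smul_mem _ _ ?_)
    · rw [Finset.mem_erase, mem_splitSet] at hx
      obtain ⟨p, q⟩ := x
      obtain ⟨hne, h2, h3, h4⟩ := hx
      simp only at h2 h3 h4
      have h4' : p + q ≤ (c :: ds).length := by simpa using h4
      refine units_smul_mem _ _ (Finsupp.single_mem_supported _ _ ⟨⟨?_, by simp [rootTerm], ?_⟩, ?_⟩)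
      · exact rootTerm_isReduced h4' h2 (by simpa using h3) (by simpa using hr.2)
      · exact (rootTerm_spec h4').1.trans ht.2.2
      -- The other block of this size consists of all inputs but the last; the new first input then
      -- contains `c` and at least one more leaf. A smaller block leaves at least three inputs at
      -- the root, so it cannot give a right tree.
      · by_cases hq : q = ds.length
        · obtain rfl : p = 0 := by
            by_contra hp
            exact hne (Prod.ext (show p = 1 by omega) hq)
          intro _
          obtain ⟨q, rfl⟩ : ∃ q', q = q' + 1 := ⟨q - 1, by omega⟩
          have h5 := length_le_leavesList (ts := ds.take q)
            fun t ht => (hr.2.2 t (List.mem_of_mem_take ht)).one_le_leaves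
          rw [List.length_take] at h5
          simp only [rootTerm, List.take_zero, List.drop_zero, List.nil_append, firstLeaves,
            leaves_node, List.take_succ_cons, leavesList_cons]
          omega
        · intro h
          refine absurd h (not_isRight_of_length ?_)
          simp only [List.length_append, List.length_take, List.length_cons, List.length_drop]
          omega
    · rw [Finsupp.lmapDomain_apply]
      -- Terms that come from the subtrees do not change the number of inputs of the root, so they
      -- are not right trees.
      have key : (signedSum (dTermsList (c :: ds)) : List PTree →₀ 𝕜) ∈ Finsupp.supported 𝕜 𝕜
          {ts | node ts ∈ basisTrees n ∧ ts.length = ds.length + 1} := by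
        refine signedSum_mem fun st hst => ?_
        obtain ⟨h2, h3, h4⟩ := dTermsList_spec _ st hst
        refine ⟨⟨?_, by simp, h2.trans ht.2.2⟩, h4⟩
        rw [isReduced_node_iff, h4]
        exact ⟨hr.1, dTermsList_isReduced _ (by simpa using hr.2) st hst⟩
      generalize (signedSum (dTermsList (c :: ds)) : List PTree →₀ 𝕜) = z at key
      rw [← Finsupp.lmapDomain_apply 𝕜 𝕜]
      induction key using supported_induction with
      | zero => simp
      | add x y _ _ h h' => rw [map_add]; exact add_mem h h'
      | smul c x _ h => rw [map_smul]; exact Submodule.smul_mem _ c h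
      | single ts hts =>
        rw [Finsupp.lmapDomain_apply, Finsupp.mapDomain_single]
        exact Finsupp.single_mem_supported _ _
          ⟨hts.1, fun h => absurd h (not_isRight_of_length (by rw [hts.2]; omega))⟩

theorem firstLeaves_le {n : ℕ} {t : PTree} (ht : t ∈ basisTrees n) : t.firstLeaves ≤ n := by
  obtain ⟨-, -, rfl⟩ := ht
  match t with
  | leaf => simp [firstLeaves]
  | node [] => simp [firstLeaves]
  | node (c :: ds) => simp [firstLeaves]

/-- By `exists_treeD_eq`, subtracting a boundary replaces a right tree by trees that are not right
or have more leaves in the first input. That number is at most `n`, so the procedure ends. -/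
theorem exists_sub_treeD_not_isRight {n : ℕ} {x : PTree →₀ 𝕜}
    (hx : x ∈ Finsupp.supported 𝕜 𝕜 (basisTrees n)) :
    ∃ z ∈ Finsupp.supported 𝕜 𝕜 (basisTrees n),
      x - treeD 𝕜 z ∈ Finsupp.supported 𝕜 𝕜 {t | t ∈ basisTrees n ∧ ¬ t.IsRight} := by
  -- The number `m` bounds how far the first input is from having more than `n` leaves; for `m = 0`
  -- no right trees are left.
  suffices H : ∀ m, ∀ x ∈ Finsupp.supported 𝕜 𝕜
      {t | t ∈ basisTrees n ∧ (t.IsRight → n < t.firstLeaves + m)},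
      ∃ z ∈ Finsupp.supported 𝕜 𝕜 (basisTrees n),
      x - treeD 𝕜 z ∈ Finsupp.supported 𝕜 𝕜 {t | t ∈ basisTrees n ∧ ¬ t.IsRight} by
    refine H (n + 1) x (Finsupp.supported_mono ?_ hx)
    exact fun t ht => ⟨ht, fun _ => by omega⟩
  clear hx x
  intro m
  induction m with
  | zero =>
    intro x hx
    refine ⟨0, zero_mem _, ?_⟩
    rw [map_zero, sub_zero]
    refine Finsupp.supported_mono ?_ hx
    exact fun t ht => ⟨ht.1, fun h => (ht.2 h).not_ge (firstLeaves_le ht.1)⟩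
  | succ m ih =>
    intro x hx
    induction hx using supported_induction with
    | zero => exact ⟨0, zero_mem _, by simp⟩
    | add x y _ _ h h' =>
      obtain ⟨z, hz, h⟩ := h
      obtain ⟨z', hz', h'⟩ := h'
      refine ⟨z + z', add_mem hz hz', ?_⟩
      rw [map_add, add_sub_add_comm]
      exact add_mem h h'
    | smul c x _ h =>
      obtain ⟨z, hz, h⟩ := h
      refine ⟨c • z, Submodule.smul_mem _ c hz, ?_⟩
      rw [map_smul, ← smul_sub]
      exact Submodule.smul_mem _ c h
    | single t ht =>
      by_cases hr : t.IsRight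
      · obtain ⟨c, ds, rfl⟩ := hr
        have hn := ht.2 ⟨c, ds, rfl⟩
        have ht1 := ht.1.1
        have ht2 := ht.1.2.2
        rw [isReduced_node_iff] at ht1
        simp only [List.forall_mem_cons, List.not_mem_nil, false_imp_iff, implies_true, and_true,
          isReduced_node_iff] at ht1
        have hL : node (c :: ds) ∈ basisTrees n := by
          refine ⟨?_, by simp, by simpa using ht2⟩
          rw [isReduced_node_iff, List.forall_mem_cons]
          exact ⟨by simp; omega, ht1.2.1, ht1.2.2.2⟩
        obtain ⟨u, y, h1, h2⟩ := exists_treeD_eq (𝕜 := 𝕜) ht1.2.2.1 hL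
        have h2' : y ∈ Finsupp.supported 𝕜 𝕜
            {t | t ∈ basisTrees n ∧ (t.IsRight → n < t.firstLeaves + m)} := by
          refine Finsupp.supported_mono ?_ h2
          refine fun t ht => ⟨ht.1, fun h => ?_⟩
          have := ht.2 h
          simp only [firstLeaves] at hn
          omega
        obtain ⟨z, hz, h3⟩ := ih (-(u • y)) (neg_mem (units_smul_mem _ _ h2'))
        refine ⟨z + u • Finsupp.single (node (c :: ds)) 1,
          add_mem hz (units_smul_mem _ _ (Finsupp.single_mem_supported _ _ hL)), ?_⟩
        rw [map_add, map_units_smul', h1, smul_add, smul_smul, Int.units_mul_self, one_smul]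
        convert h3 using 1
        abel
      · refine ⟨0, zero_mem _, ?_⟩
        rw [map_zero, sub_zero]
        exact Finsupp.single_mem_supported _ _ ⟨ht.1, hr⟩

theorem cases_of_not_isRight {n : ℕ} {t : PTree} (ht : t ∈ basisTrees n) (h : ¬ t.IsRight) :
    (∃ c, t = addLeaf c) ∨ ∃ c ds, 2 ≤ ds.length ∧ t = node (c :: ds) := by
  have h1 := ht.1
  match t with
  | leaf => exact absurd rfl ht.2.1
  | node [] => simp [isReduced_node_iff] at h1
  | node [c] => simp [isReduced_node_iff] at h1
  | node [c, leaf] => exact .inl ⟨c, rfl⟩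
  | node [c, node ds] => exact absurd ⟨c, ds, rfl⟩ h
  | node (c :: d :: e :: ds) => exact .inr ⟨c, d :: e :: ds, by simp, rfl⟩

/-- Among the trees in the support whose root has at least three inputs, one with smallest first
input would have a leading term that nothing else in `d x` can cancel. -/
theorem mem_supported_addLeaf_of_treeD_eq_zero {n : ℕ} {x : PTree →₀ 𝕜}
    (hx : x ∈ Finsupp.supported 𝕜 𝕜 {t | t ∈ basisTrees n ∧ ¬ t.IsRight}) (hd : treeD 𝕜 x = 0) :
    x ∈ Finsupp.supported 𝕜 𝕜 {t | t ∈ basisTrees n ∧ ∃ c, t = addLeaf c} := by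
  classical
  rw [Finsupp.mem_supported] at hx ⊢
  by_contra hcon
  obtain ⟨t₁, ht₁, ht₁'⟩ := Set.not_subset.1 hcon
  have hne : (x.support.filter fun t => ¬ ∃ c, t = addLeaf c).Nonempty := by
    refine ⟨t₁, Finset.mem_filter.2 ⟨ht₁, fun h => ht₁' ⟨(hx ht₁).1, h⟩⟩⟩
  obtain ⟨t₀, ht₀, hmin⟩ := Finset.exists_min_image _ firstLeaves hne
  rw [Finset.mem_filter] at ht₀
  obtain ⟨c, ds, hds, rfl⟩ := (cases_of_not_isRight (hx ht₀.1).1 (hx ht₀.1).2).resolve_left ht₀.2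
  have hsum : treeD 𝕜 x = ∑ t ∈ x.support, x t • treeD 𝕜 (Finsupp.single t 1) := by
    conv_lhs => rw [← Finsupp.sum_single x]
    rw [Finsupp.sum, map_sum]
    refine Finset.sum_congr rfl fun t _ => ?_
    rw [← map_smul, Finsupp.smul_single, smul_eq_mul, mul_one]
  have hcoef := congrArg (fun z : PTree →₀ 𝕜 => z (node [c, node ds])) hsum
  simp only [hd, Finsupp.coe_zero, Pi.zero_apply, Finsupp.finsetSum_apply, Finsupp.smul_apply] at hcoef
  -- Trees of the form `addLeaf` have their differential in the range of `addLeaf`. Any other tree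
  -- has a different leading term, and its remaining right terms have a first input strictly larger
  -- than the minimum.
  rw [Finset.sum_eq_single (node (c :: ds))] at hcoef
  · obtain ⟨u, y, h1, h2⟩ := exists_treeD_eq (𝕜 := 𝕜) hds (hx ht₀.1).1
    have hy : y (node [c, node ds]) = 0 := by
      by_contra hy
      exact lt_irrefl _ ((h2 (Finsupp.mem_support_iff.2 hy)).2 ⟨c, ds, rfl⟩)
    rw [h1, Finsupp.add_apply, hy, add_zero, Units.smul_def, Finsupp.smul_apply,
      Finsupp.single_eq_same] at hcoef
    have hx0 : x (node (c :: ds)) ≠ 0 := Finsupp.mem_support_iff.1 ht₀.1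
    rcases Int.units_eq_one_or u with rfl | rfl <;> simp at hcoef <;>
      first | exact hx0 hcoef | exact hx0 hcoef.symm
  · intro t ht htne
    rw [smul_eq_mul, mul_eq_zero]
    right
    rcases cases_of_not_isRight (hx ht).1 (hx ht).2 with ⟨c', rfl⟩ | ⟨c', ds', hds', rfl⟩
    · have := treeD_lmapDomain_addLeaf (Finsupp.single c' (1 : 𝕜))
      rw [Finsupp.lmapDomain_apply, Finsupp.mapDomain_single] at this
      rw [this, Finsupp.lmapDomain_apply]
      refine Finsupp.mapDomain_of_notMem_range _ _ ?_
      rintro ⟨e, he⟩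
      simp [addLeaf] at he
    · obtain ⟨u, y, h1, h2⟩ := exists_treeD_eq (𝕜 := 𝕜) hds' (hx ht).1
      have hle := hmin _ (Finset.mem_filter.2 ⟨ht, by
        rintro ⟨e, he⟩
        simp only [addLeaf, node.injEq, List.cons.injEq] at he
        rw [he.2] at hds'
        simp at hds'⟩)
      have hy : y (node [c, node ds]) = 0 := by
        by_contra hy
        have := (h2 (Finsupp.mem_support_iff.2 hy)).2 ⟨c, ds, rfl⟩
        simp only [firstLeaves] at hle this
        omega
      rw [h1, Finsupp.add_apply, hy, add_zero, Units.smul_def, Finsupp.smul_apply,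
        Finsupp.single_eq_of_ne, smul_zero]
      intro h
      apply htne
      simp only [node.injEq, List.cons.injEq, and_true] at h ⊢
      exact ⟨h.1.symm, h.2.symm⟩
  · intro h
    exact absurd ht₀.1 h

theorem exists_eq_addLeaf {n : ℕ} {x : PTree →₀ 𝕜}
    (hx : x ∈ Finsupp.supported 𝕜 𝕜 {t | t ∈ basisTrees n ∧ ∃ c, t = addLeaf c}) :
    ∃ y ∈ Finsupp.supported 𝕜 𝕜 {t | t.IsReduced ∧ t.leaves + 1 = n},
      x = Finsupp.lmapDomain 𝕜 𝕜 addLeaf y := by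
  induction hx using supported_induction with
  | zero => exact ⟨0, zero_mem _, by simp⟩
  | add x y _ _ h h' =>
    obtain ⟨z, hz, rfl⟩ := h
    obtain ⟨z', hz', rfl⟩ := h'
    exact ⟨z + z', add_mem hz hz', (map_add _ _ _).symm⟩
  | smul c x _ h =>
    obtain ⟨z, hz, rfl⟩ := h
    exact ⟨c • z, Submodule.smul_mem _ c hz, (map_smul _ _ _).symm⟩
  | single t ht =>
    obtain ⟨⟨h1, h2, h3⟩, c, rfl⟩ := ht
    refine ⟨Finsupp.single c 1, Finsupp.single_mem_supported _ _ ⟨isReduced_addLeaf.1 h1, ?_⟩, ?_⟩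
    · simpa [addLeaf] using h3
    · rw [Finsupp.lmapDomain_apply, Finsupp.mapDomain_single]

theorem lmapDomain_addLeaf_mem {n : ℕ} {x : PTree →₀ 𝕜}
    (hx : x ∈ Finsupp.supported 𝕜 𝕜 (basisTrees n)) :
    Finsupp.lmapDomain 𝕜 𝕜 addLeaf x ∈ Finsupp.supported 𝕜 𝕜 (basisTrees (n + 1)) := by
  induction hx using supported_induction with
  | zero => simp
  | add x y _ _ h h' => rw [map_add]; exact add_mem h h'
  | smul c x _ h => rw [map_smul]; exact Submodule.smul_mem _ c h
  | single t ht =>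
    rw [Finsupp.lmapDomain_apply, Finsupp.mapDomain_single]
    exact Finsupp.single_mem_supported _ _ (addLeaf_mem_basisTrees ht)

/-- Every cycle of `AInf` is homologous to a multiple of the left comb. -/
theorem exists_eq_comb_add_treeD (n : ℕ) (x : PTree →₀ 𝕜)
    (hx : x ∈ Finsupp.supported 𝕜 𝕜 (basisTrees (n + 2))) (hd : treeD 𝕜 x = 0) :
    ∃ (c : 𝕜), ∃ z ∈ Finsupp.supported 𝕜 𝕜 (basisTrees (n + 2)),
      x = c • Finsupp.single (comb (n + 1)) 1 + treeD 𝕜 z := by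
  induction n generalizing x with
  | zero =>
    -- In arity two the corolla is the only reduced tree.
    have : basisTrees (0 + 2) ⊆ {comb 1} := by
      rintro t ⟨h1, h2, h3⟩
      cases t with
      | leaf => exact absurd rfl h2
      | node ts =>
        rw [isReduced_node_iff] at h1
        rw [leaves_node] at h3
        match ts with
        | [] => simp at h1
        | [_] => simp at h1
        | [a, b] =>
          simp only [List.forall_mem_cons, List.not_mem_nil, false_imp_iff, implies_true,
            and_true] at h1
          have ha := h1.2.1.one_le_leaves
          have hb := h1.2.2.one_le_leaves
          simp only [leavesList_cons, leavesList_nil] at h3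
          have ha' : a = leaf := by
            by_contra h; have := h1.2.1.two_le_leaves h; omega
          have hb' : b = leaf := by
            by_contra h; have := h1.2.2.two_le_leaves h; omega
          rw [ha', hb']
          rfl
        | a :: b :: c :: ds =>
          have := length_le_leavesList fun t ht => (h1.2 t ht).one_le_leaves
          simp only [List.length_cons] at this
          omega
    have hx' := Finsupp.supported_mono this hx
    rw [Finsupp.supported_eq_span_single, Set.image_singleton, Submodule.mem_span_singleton] at hx'
    obtain ⟨c, rfl⟩ := hx'
    exact ⟨c, 0, zero_mem _, by simp⟩
  | succ n ih =>
    obtain ⟨z, hz, h1⟩ := exists_sub_treeD_not_isRight hx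
    have h2 := mem_supported_addLeaf_of_treeD_eq_zero h1
      (by rw [map_sub, hd, treeD_treeD hz, sub_zero])
    obtain ⟨y, hy, h3⟩ := exists_eq_addLeaf h2
    have hy' : y ∈ Finsupp.supported 𝕜 𝕜 (basisTrees (n + 2)) := by
      refine Finsupp.supported_mono (fun t ht => ?_) hy
      have h4 : t.leaves + 1 = n + 1 + 2 := ht.2
      refine ⟨ht.1, ?_, by omega⟩
      rintro rfl
      simp at h4
    -- Adding a leaf is injective and commutes with `d`, so the cycle descends to the lower arity.
    have hdy : treeD 𝕜 y = 0 := by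
      apply Finsupp.mapDomain_injective addLeaf_injective
      rw [Finsupp.mapDomain_zero, ← Finsupp.lmapDomain_apply 𝕜 𝕜, ← treeD_lmapDomain_addLeaf, ← h3,
        map_sub, hd, treeD_treeD hz, sub_zero]
    obtain ⟨c, w, hw, h5⟩ := ih y hy' hdy
    refine ⟨c, Finsupp.lmapDomain 𝕜 𝕜 addLeaf w + z, add_mem (lmapDomain_addLeaf_mem hw) hz, ?_⟩
    rw [map_add, treeD_lmapDomain_addLeaf, ← add_assoc, ← sub_eq_iff_eq_add, h3, h5, map_add,
      map_smul, Finsupp.lmapDomain_apply, Finsupp.mapDomain_single]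
    rfl

theorem two_le_of_ne_zero {n : ℕ} {x : PTree →₀ 𝕜}
    (hx : x ∈ Finsupp.supported 𝕜 𝕜 (basisTrees n)) (h : x ≠ 0) : 2 ≤ n := by
  obtain ⟨t, ht⟩ := Finsupp.support_nonempty_iff.2 h
  obtain ⟨h1, h2, rfl⟩ := hx ht
  exact h1.two_le_leaves h2

variable (𝕜) in
/-- The morphism `AInf → As`. -/
noncomputable def augHom (n : ℕ) : (AInf 𝕜).obj n →ₗ[𝕜] (As 𝕜).obj n :=
  treeEvalHom (As 𝕜) (asGen 𝕜) (As_isGradedOperad 𝕜) (asGen_mem 𝕜) n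

variable (𝕜) in
theorem augHom_isDGHom : OperadData.IsDGHom (AInf 𝕜) (As 𝕜) (augHom 𝕜) where
  toIsGradedHom := treeEvalHom_isGradedHom (As_isGradedOperad 𝕜) (asGen_mem 𝕜)
  map_d x _ h := (congrArg (augLin 𝕜) h).trans (augLin_treeD x.2)

variable (𝕜) in
-- In arity at least two every cycle is a multiple of the comb up to a boundary, and the image of
-- the comb is the basis element of `As`, which detects the multiple. In lower arities both
-- components vanish.
theorem augHom_isQuasiIso : OperadData.IsQuasiIso (AInf 𝕜) (As 𝕜) (augHom 𝕜) := by
  intro n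
  constructor
  · rintro ⟨x, hx⟩ hc ⟨b, -, hb⟩
    have hb0 : augLin 𝕜 x = 0 := hb.symm
    have hd : treeD 𝕜 x = 0 := hc.2
    have hx : x ∈ Finsupp.supported 𝕜 𝕜 (basisTrees n) := hx
    by_cases h0 : x = 0
    · exact ⟨0, zero_mem _, (map_zero _).trans h0.symm⟩
    · obtain ⟨n, rfl⟩ := Nat.exists_eq_add_of_le' (two_le_of_ne_zero hx h0)
      obtain ⟨c, z, hz, hxz⟩ := exists_eq_comb_add_treeD n x hx hd
      rw [hxz, map_add, augLin_treeD hz, add_zero, map_smul, augLin_comb] at hb0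
      have hb1 : c • (Finsupp.single (n + 2) 1 : ℕ →₀ 𝕜) = 0 := hb0
      rw [Finsupp.smul_single, smul_eq_mul, mul_one, Finsupp.single_eq_zero] at hb1
      rw [hb1, zero_smul, zero_add] at hxz
      exact ⟨z, hz, hxz.symm⟩
  · rintro (y : ℕ →₀ 𝕜) ⟨hy, -⟩
    have hy : y ∈ Finsupp.supported 𝕜 𝕜 (asBasis n) := hy
    by_cases hn : 2 ≤ n
    · have hy' := Finsupp.supported_mono (show asBasis n ⊆ {n} from fun m hm => hm.1) hy
      rw [Finsupp.supported_eq_span_single, Set.image_singleton, Submodule.mem_span_singleton] at hy'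
      obtain ⟨c, rfl⟩ := hy'
      obtain ⟨n, rfl⟩ := Nat.exists_eq_add_of_le' hn
      have hm : c • Finsupp.single (comb (n + 1)) (1 : 𝕜) ∈
          Finsupp.supported 𝕜 𝕜 (basisTrees (n + 2)) :=
        Submodule.smul_mem _ c (Finsupp.single_mem_supported _ _ (comb_mem_basisTrees n))
      refine ⟨⟨_, hm⟩, ⟨hm, ?_⟩, ?_⟩
      · exact (map_smul (treeD 𝕜) c _).trans
          ((congrArg (c • ·) (treeD_comb (n + 1))).trans (smul_zero c))
      · have h1 : augLin 𝕜 (c • Finsupp.single (comb (n + 1)) (1 : 𝕜)) =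
            c • (Finsupp.single (n + 2) 1 : ℕ →₀ 𝕜) :=
          (map_smul (augLin 𝕜) c _).trans (congrArg (c • ·) (augLin_comb n))
        exact (congrArg (· ∈ (As 𝕜).boundaries (n + 2)) (sub_eq_zero.2 h1.symm)).mpr (zero_mem _)
    · have hy' := Finsupp.supported_mono (show asBasis n ⊆ ∅ from fun m hm => absurd hm.2 hn) hy
      rw [Finsupp.supported_empty, Submodule.mem_bot] at hy'
      refine ⟨0, zero_mem _, ?_⟩
      rw [map_zero]
      exact (congrArg (· ∈ (As 𝕜).boundaries n) ((sub_zero _).trans hy')).mpr (zero_mem _)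

end Acyclicity
end OInfinity
namespace OInfinity

-- Linear trees as chains, and their edge-graphs.

namespace OTree

/-- The tree whose vertices have one input each, and are indexed by the entries of the list, from
bottom to top. -/
def chain : List ℕ → OTree
  | [] => leaf
  | v :: vs => node v [chain vs]

/-- The linear tree with `n` vertices. -/
def lin (n : ℕ) : OTree := chain (List.range' 1 n)

theorem forall_of_node {motive : OTree → Prop} (leaf : motive leaf)
    (node : ∀ (v : ℕ) (ts : List OTree), (∀ t ∈ ts, motive t) → motive (node v ts)) :
    ∀ t, motive t :=
  OTree.rec (motive_1 := motive) (motive_2 := fun ts => ∀ t ∈ ts, motive t) leaf node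
    (by simp) (fun t ts ht hts => by simpa using ⟨ht, hts⟩)

theorem vertices_chain (vs : List ℕ) : (chain vs).vertices = vs := by
  induction vs with
  | nil => simp [chain, vertices]
  | cons v vs ih => simp [chain, vertices, verticesList, ih]

theorem leaves_chain (vs : List ℕ) : (chain vs).leaves = 1 := by
  induction vs with
  | nil => simp [chain, leaves]
  | cons v vs ih => simp [chain, leaves, leavesList, ih]

theorem arities_chain (vs : List ℕ) : (chain vs).arities = vs.map fun v => (v, 1) := by
  induction vs with
  | nil => simp [chain, arities]
  | cons v vs ih => simp [chain, arities, aritiesList, ih]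

theorem edges_chain_cons (v : ℕ) (vs : List ℕ) :
    (chain (v :: vs)).edges = vs.head?.toList.map (fun w => (w, v)) ++ (chain vs).edges := by
  cases vs with
  | nil => simp [chain, edges, edgesList, root?]
  | cons w vs => simp [chain, edges, edgesList, root?]

theorem eq_chain_vertices (T : OTree) (h : ∀ p ∈ T.arities, p.2 = 1) : T = chain T.vertices := by
  induction T using forall_of_node with
  | leaf => simp [chain, vertices]
  | node v ts ih =>
    rw [arities, List.forall_mem_cons] at h
    obtain ⟨t, rfl⟩ := List.length_eq_one_iff.1 h.1
    have := ih t (by simp) (by simpa [aritiesList] using h.2)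
    rw [vertices, verticesList, verticesList, List.append_nil, chain, ← this]

/-- The bottom vertex of a chain is not the upper vertex of any edge, while every index greater than
`a` is; hence the bottom vertex is `a`, and it can be removed. -/
theorem eq_range'_of_perm {vs : List ℕ} {a k : ℕ} (h : vs.Perm (List.range' a k))
    (he : ∀ i, a < i → i < a + k → (i, i - 1) ∈ (chain vs).edges) : vs = List.range' a k := by
  induction k generalizing a vs with
  | zero => simpa using h
  | succ k ih =>
    cases vs with
    | nil => simp at h
    | cons v ws =>
      have hnd : (v :: ws).Nodup := h.nodup_iff.2 List.nodup_range'
      rw [edges_chain_cons] at he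
      have hsub : ∀ (us : List ℕ) (i j : ℕ), (i, j) ∈ (chain us).edges → i ∈ us := by
        intro us
        induction us with
        | nil => simp [chain, edges]
        | cons u us ih =>
          intro i j hij
          rw [edges_chain_cons, List.mem_append] at hij
          rcases hij with hij | hij
          · simp only [List.mem_map, Option.mem_toList, Prod.mk.injEq] at hij
            obtain ⟨w, hw, rfl, -⟩ := hij
            exact List.mem_cons_of_mem _ (List.mem_of_head? hw)
          · exact List.mem_cons_of_mem _ (ih i j hij)
      -- Otherwise `v` would be the upper vertex of an edge and occur a second time in the list.
      have hva : v = a := by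
        by_contra hne
        have hv : v ∈ List.range' a (k + 1) := h.subset List.mem_cons_self
        rw [List.mem_range'_1] at hv
        have := he v (by omega) (by omega)
        rw [← edges_chain_cons] at this
        rw [edges_chain_cons, List.mem_append] at this
        refine (List.nodup_cons.1 hnd).1 ?_
        rcases this with h1 | h1
        · simp only [List.mem_map, Option.mem_toList, Prod.mk.injEq] at h1
          obtain ⟨w, hw, rfl, -⟩ := h1
          exact List.mem_of_head? hw
        · exact hsub _ _ _ h1
      subst hva
      rw [List.range'_succ, List.perm_cons] at h
      rw [List.range'_succ, ← ih h]
      intro i h1 h2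
      have := he i (by omega) (by omega)
      rw [List.mem_append] at this
      refine this.resolve_left fun h3 => ?_
      simp only [List.mem_map, Option.mem_toList, Prod.mk.injEq] at h3
      obtain ⟨w, hw, -, h4⟩ := h3
      omega

theorem edges_chain_range' (a n : ℕ) :
    (chain (List.range' a n)).edges = (List.range' (a + 1) (n - 1)).map fun i => (i, i - 1) := by
  induction n generalizing a with
  | zero => simp [chain, edges]
  | succ n ih =>
    rw [List.range'_succ, edges_chain_cons, ih]
    cases n with
    | zero => simp
    | succ n => simp [List.range'_succ]

theorem edges_lin (n : ℕ) : (lin n).edges = (List.range' 2 (n - 1)).map fun i => (i, i - 1) :=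
  edges_chain_range' 1 n

theorem vertices_lin (n : ℕ) : (lin n).vertices = List.range' 1 n := vertices_chain _

theorem isLinear_lin {k : ℕ} (hk : 1 ≤ k) : IsLinear k (lin k) := by
  refine ⟨⟨?_, ?_, ?_, ?_, leaves_chain _⟩, ?_⟩
  · intro m hm
    rw [List.eq_of_mem_replicate hm]
  · rw [vertices_lin, List.length_replicate]
  · obtain ⟨k, rfl⟩ := Nat.exists_eq_add_of_le' hk
    simp [lin, List.range'_succ, chain]
  · intro p hp
    rw [lin, arities_chain, List.mem_map] at hp
    obtain ⟨v, hv, rfl⟩ := hp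
    rw [List.mem_range'_1] at hv
    rw [List.getElem?_replicate, if_pos (by simp only; omega)]
  · intro i h1 h2
    rw [edges_lin, List.mem_map]
    exact ⟨i, by rw [List.mem_range'_1]; omega, rfl⟩

theorem isLinear_iff {k : ℕ} {T : OTree} : IsLinear k T ↔ 1 ≤ k ∧ T = lin k := by
  constructor
  · rintro ⟨⟨h1, h2, h3, h4, h5⟩, h6⟩
    rw [List.length_replicate] at h2
    have hT := eq_chain_vertices T fun p hp => by
      have := h4 p hp
      rw [List.getElem?_replicate] at this
      split_ifs at this
      simpa using this.symm
    have hv : T.vertices = List.range' 1 k := by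
      refine eq_range'_of_perm h2 fun i hi hi' => ?_
      rw [← hT]
      exact h6 i (by omega) (by omega)
    rw [hv] at hT
    refine ⟨?_, hT⟩
    by_contra hk
    obtain rfl : k = 0 := by omega
    exact h3 hT
  · rintro ⟨hk, rfl⟩
    exact isLinear_lin hk

end OTree

/-- The graph on a finite set of natural numbers in which consecutive elements are joined. -/
def pathGraph (V : Finset ℕ) : Hypergraph where
  verts := V
  edges := ((V ×ˢ V).filter fun p => p.1 ≤ p.2 ∧ ∀ z ∈ V, ¬ (p.1 < z ∧ z < p.2)).image
    fun p => {p.1, p.2}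

theorem mem_edges_pathGraph {V Z : Finset ℕ} : Z ∈ (pathGraph V).edges ↔
    ∃ a b, a ∈ V ∧ b ∈ V ∧ a ≤ b ∧ (∀ z ∈ V, ¬ (a < z ∧ z < b)) ∧ Z = {a, b} := by
  simp only [pathGraph, Finset.mem_image, Finset.mem_filter, Finset.mem_product, Prod.exists]
  constructor
  · rintro ⟨a, b, ⟨⟨ha, hb⟩, hab, h⟩, rfl⟩
    exact ⟨a, b, ha, hb, hab, h, rfl⟩
  · rintro ⟨a, b, ha, hb, hab, h, rfl⟩
    exact ⟨a, b, ⟨⟨ha, hb⟩, hab, h⟩, rfl⟩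

namespace OTree

theorem edges_chain_eq_zip (v : ℕ) (vs : List ℕ) :
    (chain (v :: vs)).edges = vs.zip (v :: vs) := by
  induction vs generalizing v with
  | nil => simp [chain, edges, edgesList, root?]
  | cons w vs ih => rw [edges_chain_cons, ih]; simp

theorem map_fst_edges_chain (v : ℕ) (vs : List ℕ) :
    (chain (v :: vs)).edges.map Prod.fst = vs := by
  rw [edges_chain_eq_zip, List.map_fst_zip (by simp)]

theorem lower_chain_cons_cons {v w : ℕ} {vs : List ℕ} (e : ℕ) :
    (chain (v :: w :: vs)).lower e = if e = w then v else (chain (w :: vs)).lower e := by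
  simp only [lower, edges_chain_eq_zip, List.zip_cons_cons, List.lookup_cons]
  by_cases h : e = w
  · simp [h]
  · rw [beq_eq_false_iff_ne.2 h, if_neg h]

/-- The lower vertex is the predecessor in the list. This is expressed by the order instead of by
positions, to fit the definition of `pathGraph`. -/
theorem lower_chain_mem {v e : ℕ} {vs : List ℕ} (h : (v :: vs).Pairwise (· < ·)) (he : e ∈ vs) :
    (chain (v :: vs)).lower e ∈ v :: vs ∧ (chain (v :: vs)).lower e < e ∧
      ∀ z ∈ v :: vs, ¬ ((chain (v :: vs)).lower e < z ∧ z < e) := by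
  induction vs generalizing v with
  | nil => simp at he
  | cons w vs ih =>
    rw [lower_chain_cons_cons]
    have hvw : v < w := (List.pairwise_cons.1 h).1 w (by simp)
    have hw := (List.pairwise_cons.1 (List.pairwise_cons.1 h).2).1
    split_ifs with h1
    · subst h1
      refine ⟨by simp, hvw, ?_⟩
      intro z hz
      simp only [List.mem_cons] at hz
      rcases hz with rfl | rfl | hz
      · omega
      · omega
      · have := hw z hz; omega
    · have he' : e ∈ vs := by simpa [h1] using he
      obtain ⟨h2, h3, h4⟩ := ih (List.pairwise_cons.1 h).2 he'
      refine ⟨List.mem_cons_of_mem _ h2, h3, ?_⟩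
      intro z hz
      rcases List.mem_cons.1 hz with rfl | hz
      · have : z < (chain (w :: vs)).lower e := (List.pairwise_cons.1 h).1 _ h2
        omega
      · exact h4 z hz

theorem span_singleton (T : OTree) (e : ℕ) : T.span {e} = {e, T.lower e} := by
  simp [span]

/-- The edge `e` joins `e` to its predecessor, so two edges share a vertex exactly when nothing lies
strictly between their names. Arbitrary increasing indices are allowed because contracted trees have
gaps in their indices. -/
theorem edgeGraph_chain {v : ℕ} {vs : List ℕ} (h : (v :: vs).Pairwise (· < ·)) :
    (chain (v :: vs)).edgeGraph = pathGraph vs.toFinset := by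
  have hv := (List.pairwise_cons.1 h).1
  ext x
  · simp only [edgeGraph, map_fst_edges_chain, pathGraph]
  · rw [mem_edges_pathGraph]
    simp only [edgeGraph, map_fst_edges_chain, Finset.mem_image, Finset.mem_filter,
      Finset.mem_product, List.mem_toFinset, Prod.exists, span_singleton]
    constructor
    · rintro ⟨a, b, ⟨⟨ha, hb⟩, hab⟩, rfl⟩
      obtain ⟨h1, h2, h3⟩ := lower_chain_mem h ha
      obtain ⟨h4, h5, h6⟩ := lower_chain_mem h hb
      rw [Finset.not_disjoint_iff] at hab
      obtain ⟨z, hz, hz'⟩ := hab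
      simp only [Finset.mem_insert, Finset.mem_singleton] at hz hz'
      have h7 := h3 b (List.mem_cons_of_mem _ hb)
      have h8 := h6 a (List.mem_cons_of_mem _ ha)
      have h9 := h3 _ h4
      have h10 := h6 _ h1
      rcases le_total a b with hle | hle
      · refine ⟨a, b, ha, hb, hle, fun z hz => ?_, rfl⟩
        have := h6 z (List.mem_cons_of_mem _ hz)
        omega
      · refine ⟨b, a, hb, ha, hle, fun z hz => ?_, Finset.pair_comm _ _⟩
        have := h3 z (List.mem_cons_of_mem _ hz)
        omega
    · rintro ⟨a, b, ha, hb, hab, hz, rfl⟩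
      refine ⟨a, b, ⟨⟨ha, hb⟩, ?_⟩, rfl⟩
      rw [Finset.not_disjoint_iff]
      refine ⟨a, by simp, ?_⟩
      simp only [Finset.mem_insert, Finset.mem_singleton]
      rcases hab.eq_or_lt with rfl | hlt
      · exact .inl rfl
      · right
        obtain ⟨h4, h5, h6⟩ := lower_chain_mem h hb
        have h7 := h6 a (List.mem_cons_of_mem _ ha)
        rcases List.mem_cons.1 h4 with h8 | h8
        · have := hv a ha
          omega
        · have := hz _ h8
          omega

theorem edgeGraph_lin (n : ℕ) : (lin n).edgeGraph = pathGraph (Finset.Icc 2 n) := by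
  cases n with
  | zero => rfl
  | succ n =>
    rw [lin, List.range'_succ, edgeGraph_chain]
    · congr 1
      ext z
      simp only [List.mem_toFinset, List.mem_range'_1, Finset.mem_Icc]
      omega
    · rw [← List.range'_succ]
      exact List.pairwise_lt_range'

theorem linearGraph_eq (n : ℕ) : linearGraph n = pathGraph (Finset.Icc 2 n) := by
  ext x
  · simp [linearGraph, pathGraph]
  · rw [mem_edges_pathGraph]
    simp only [linearGraph, Finset.mem_union, Finset.mem_image, Finset.mem_Icc, Finset.mem_Ico]
    constructor
    · rintro (⟨a, ha, rfl⟩ | ⟨a, ha, rfl⟩)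
      · exact ⟨a, a, ha, ha, le_rfl, fun z _ => by omega, by simp⟩
      · exact ⟨a, a + 1, by omega, by omega, by omega, fun z _ => by omega, rfl⟩
    · rintro ⟨a, b, ha, hb, hab, h, rfl⟩
      rcases hab.eq_or_lt with rfl | hlt
      · exact .inl ⟨a, ha, by simp⟩
      · have := h (a + 1) (by omega)
        obtain rfl : b = a + 1 := by omega
        exact .inr ⟨a, by omega, rfl⟩

theorem IsLinear.edgeGraph_eq {k : ℕ} {T : OTree} (h : T.IsLinear k) :
    T.edgeGraph = linearGraph k := by
  rw [(isLinear_iff.1 h).2, edgeGraph_lin, linearGraph_eq]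

theorem lower_lin {n e : ℕ} (h : 2 ≤ e) (he : e ≤ n) : (lin n).lower e = e - 1 := by
  obtain ⟨n, rfl⟩ : ∃ m, n = m + 1 := ⟨n - 1, by omega⟩
  have hp : (1 :: List.range' 2 n).Pairwise (· < ·) := by
    have := List.pairwise_lt_range' (s := 1) (n := n + 1)
    rwa [List.range'_succ] at this
  obtain ⟨h1, h2, h3⟩ := lower_chain_mem hp (e := e) (by rw [List.mem_range'_1]; omega)
  have h4 := h3 (e - 1) (by rw [List.mem_cons, List.mem_range'_1]; omega)
  rw [lin, List.range'_succ]
  change (chain (1 :: List.range' 2 n)).lower e = _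
  omega

theorem mem_span_lin {n z : ℕ} {K : Finset ℕ} (hK : K ⊆ Finset.Icc 2 n) :
    z ∈ (lin n).span K ↔ z ∈ K ∨ z + 1 ∈ K := by
  simp only [span, Finset.mem_biUnion, Finset.mem_insert, Finset.mem_singleton]
  constructor
  · rintro ⟨e, he, rfl | rfl⟩
    · exact .inl he
    · have := Finset.mem_Icc.1 (hK he)
      rw [lower_lin this.1 this.2, Nat.sub_add_cancel (by omega)]
      exact .inr he
  · rintro (h | h)
    · exact ⟨z, h, .inl rfl⟩
    · refine ⟨z + 1, h, .inr ?_⟩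
      have := Finset.mem_Icc.1 (hK h)
      rw [lower_lin this.1 this.2, Nat.add_sub_cancel]

theorem span_lin_Icc {n a b : ℕ} (ha : 1 ≤ a) (hab : a < b) (hb : b ≤ n) :
    (lin n).span (Finset.Icc (a + 1) b) = Finset.Icc a b := by
  ext z
  rw [mem_span_lin (Finset.Icc_subset_Icc (by omega) hb)]
  simp only [Finset.mem_Icc]
  omega

theorem rootOf_lin_Icc {n a b : ℕ} (ha : 1 ≤ a) (hab : a < b) (hb : b ≤ n) :
    (lin n).rootOf (Finset.Icc (a + 1) b) = a := by
  rw [rootOf, span_lin_Icc ha hab hb, vertices_lin]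
  have : (List.range' 1 n) = List.range' 1 (a - 1) ++ a :: List.range' (a + 1) (n - a) := by
    obtain ⟨c, rfl⟩ := Nat.exists_eq_add_of_le ha
    rw [← List.range'_succ, Nat.add_sub_cancel_left, List.range'_append_1]
    congr 1; omega
  rw [this, List.find?_append, List.find?_eq_none.2, Option.none_or, List.find?_cons_of_pos]
  · rfl
  · simp; omega
  · intro z hz
    rw [List.mem_range'_1] at hz
    simp; omega

/-- Collapsing an edge downwards removes its upper vertex, which is also its name; the bottom vertex
always stays. -/
theorem contract_chain (W : Finset ℕ) (v : ℕ) (vs : List ℕ) :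
    (chain (v :: vs)).contract W = chain (v :: vs.filter (· ∈ W)) := by
  induction vs generalizing v with
  | nil => simp [chain, contract, contractList]
  | cons w vs ih =>
    rw [chain, contract, contractList, ih, chain]
    by_cases hw : w ∈ W
    · simp [hw, chain, contractList]
    · simp [hw, chain, contractList]

theorem edgeGraph_contract_lin {n : ℕ} {W : Finset ℕ} (hn : 1 ≤ n) (hW : W ⊆ Finset.Icc 2 n) :
    ((lin n).contract W).edgeGraph = pathGraph W := by
  obtain ⟨n, rfl⟩ := Nat.exists_eq_add_of_le' hn
  rw [lin, List.range'_succ, contract_chain, edgeGraph_chain]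
  · congr 1
    ext z
    simp only [List.mem_toFinset, List.mem_filter, List.mem_range'_1, decide_eq_true_eq]
    constructor
    · exact fun h => h.2
    · intro h
      have := Finset.mem_Icc.1 (hW h)
      exact ⟨by omega, h⟩
  · have := List.pairwise_lt_range' (s := 1) (n := n + 1)
    rw [List.range'_succ] at this
    exact this.sublist (List.filter_sublist.cons_cons _)

end OTree

-- Connectedness and components, in particular in a path.

namespace Hypergraph

theorem mem_components {H : Hypergraph} {K : Finset ℕ} : K ∈ H.components ↔
    K ⊆ H.verts ∧ (H.restrict K).IsConnected ∧ ∀ Z ∈ H.edges, Z ⊆ K ∨ Z ⊆ H.verts \ K := by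
  simp [components]

/-- Otherwise `K ∩ K'` would be a non-empty proper part of `K` respected by all hyperedges, against
the connectedness of `K`. -/
theorem subset_of_mem_components {H : Hypergraph} {K K' : Finset ℕ} (hK : K ∈ H.components)
    (hK' : K' ∈ H.components) {v : ℕ} (hv : v ∈ K) (hv' : v ∈ K') : K ⊆ K' := by
  rw [mem_components] at hK hK'
  by_contra hcon
  obtain ⟨Z, hZ, h1, h2⟩ := hK.2.1.2 (K ∩ K') (Finset.mem_powerset.2 Finset.inter_subset_left)
    ⟨v, Finset.mem_inter.2 ⟨hv, hv'⟩⟩ (fun h => hcon (Finset.inter_eq_left.1 h))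
  obtain ⟨hZ, hZK⟩ := Finset.mem_filter.1 hZ
  rcases hK'.2.2 Z hZ with h | h
  · exact h1 (Finset.subset_inter hZK h)
  · refine h2 fun z hz => Finset.mem_sdiff.2 ⟨hZK hz, fun hz' => ?_⟩
    exact (Finset.mem_sdiff.1 (h hz)).2 (Finset.mem_inter.1 hz').2

theorem eq_of_mem_components {H : Hypergraph} {K K' : Finset ℕ} (hK : K ∈ H.components)
    (hK' : K' ∈ H.components) {v : ℕ} (hv : v ∈ K) (hv' : v ∈ K') : K = K' :=
  (subset_of_mem_components hK hK' hv hv').antisymm (subset_of_mem_components hK' hK hv' hv)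

theorem nonempty_of_mem_components {H : Hypergraph} {K : Finset ℕ} (hK : K ∈ H.components) :
    K.Nonempty := (mem_components.1 hK).2.1.1

/-- A family of components that covers all vertices consists of all components. -/
theorem components_eq {H : Hypergraph} {F : Finset (Finset ℕ)} (h : ∀ K ∈ F, K ∈ H.components)
    (hF : ∀ v ∈ H.verts, ∃ K ∈ F, v ∈ K) : H.components = F := by
  refine Finset.Subset.antisymm (fun K hK => ?_) h
  obtain ⟨v, hv⟩ := nonempty_of_mem_components hK
  obtain ⟨K', hK', hv'⟩ := hF v ((mem_components.1 hK).1 hv)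
  rwa [eq_of_mem_components hK (h K' hK') hv hv']

theorem restrict_restrict {H : Hypergraph} {A B : Finset ℕ} (h : B ⊆ A) :
    (H.restrict A).restrict B = H.restrict B := by
  ext x
  · simp [restrict]
  · simp only [restrict, Finset.mem_filter, and_assoc]
    exact and_congr_right fun _ => ⟨fun h => h.2, fun h' => ⟨h'.trans h, h'⟩⟩

theorem restrict_verts_pathGraph (V : Finset ℕ) : (pathGraph V).restrict V = pathGraph V := by
  ext x
  · simp [restrict, pathGraph]
  · simp only [restrict, Finset.mem_filter, and_iff_left_iff_imp, mem_edges_pathGraph]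
    rintro ⟨a, b, ha, hb, -, -, rfl⟩
    exact Finset.insert_subset ha (Finset.singleton_subset_iff.2 hb)

/-- A discrete intermediate value argument: if membership in `A` changes between `x` and `y`, it
changes between two neighbours. The induction is on a bound `d` for `y - x`. -/
theorem exists_consecutive {V X A : Finset ℕ}
    (hconv : ∀ a ∈ X, ∀ c ∈ X, ∀ b ∈ V, a < b → b < c → b ∈ X) (d : ℕ) : ∀ x ∈ X, ∀ y ∈ X,
    y ≤ x + d → x < y → (x ∈ A ↔ y ∉ A) → ∃ x ∈ X, ∃ y ∈ X, x < y ∧ (x ∈ A ↔ y ∉ A) ∧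
      ∀ z ∈ V, ¬ (x < z ∧ z < y) := by
  induction d with
  | zero => intro x _ y _ _ _; omega
  | succ d ih =>
    intro x hx y hy hd hxy h
    by_cases hz : ∃ z ∈ V, x < z ∧ z < y
    · obtain ⟨z, hz, h1, h2⟩ := hz
      have hzX := hconv x hx y hy z hz h1 h2
      by_cases h3 : x ∈ A ↔ z ∉ A
      · exact ih x hx z hzX (by omega) h1 h3
      · exact ih z hzX y hy (by omega) h2 (by tauto)
    · push Not at hz
      exact ⟨x, hx, y, hy, hxy, h, fun z hzV h => by have := hz z hzV h.1; omega⟩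

/-- A missing element between two elements of `X` disconnects `X`; conversely, in a convex set, a
partition into two parts is crossed by some edge between neighbours. -/
theorem isConnected_pathGraph_restrict {V X : Finset ℕ} (hXV : X ⊆ V) :
    ((pathGraph V).restrict X).IsConnected ↔
      X.Nonempty ∧ ∀ a ∈ X, ∀ c ∈ X, ∀ b ∈ V, a < b → b < c → b ∈ X := by
  constructor
  · rintro ⟨h1, h2⟩
    refine ⟨h1, fun a ha c hc b hb hab hbc => ?_⟩
    by_contra hbX
    -- The elements below and above the missing `b` form a partition that no edge crosses.
    obtain ⟨Z, hZ, h3, h4⟩ := h2 (X.filter (· < b))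
      (Finset.mem_powerset.2 (Finset.filter_subset _ _)) ⟨a, Finset.mem_filter.2 ⟨ha, hab⟩⟩
      (fun h => by
        have hc' : c ∈ X.filter (· < b) := by rw [h]; exact hc
        exact absurd (Finset.mem_filter.1 hc').2 (by omega))
    obtain ⟨hZ, hZX⟩ := Finset.mem_filter.1 hZ
    obtain ⟨x, y, hx, hy, hxy, hcons, rfl⟩ := mem_edges_pathGraph.1 hZ
    have hxX : x ∈ X := hZX (by simp)
    have hyX : y ∈ X := hZX (by simp)
    have h5 := hcons b hb
    have hxb : x ≠ b := fun h => hbX (h ▸ hxX)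
    have hyb : y ≠ b := fun h => hbX (h ▸ hyX)
    by_cases hyb' : y < b
    · apply h3
      intro z hz
      simp only [Finset.mem_insert, Finset.mem_singleton] at hz
      rcases hz with rfl | rfl
      · exact Finset.mem_filter.2 ⟨hxX, by omega⟩
      · exact Finset.mem_filter.2 ⟨hyX, hyb'⟩
    · apply h4
      intro z hz
      change z ∈ X \ _
      simp only [Finset.mem_insert, Finset.mem_singleton] at hz
      rw [Finset.mem_sdiff, Finset.mem_filter]
      rcases hz with rfl | rfl
      · exact ⟨hxX, by omega⟩
      · exact ⟨hyX, by omega⟩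
  · rintro ⟨h1, hconv⟩
    refine ⟨h1, fun A hA hAne hAX => ?_⟩
    have hA : A ⊆ X := Finset.mem_powerset.1 hA
    obtain ⟨p, hp⟩ := hAne
    obtain ⟨q, hq, hqA⟩ : ∃ q ∈ X, q ∉ A := by
      by_contra hcon
      push Not at hcon
      exact hAX (hA.antisymm hcon)
    have key : ∃ x ∈ X, ∃ y ∈ X, x < y ∧ (x ∈ A ↔ y ∉ A) ∧ ∀ z ∈ V, ¬ (x < z ∧ z < y) := by
      rcases lt_trichotomy p q with h | rfl | h
      · exact exists_consecutive hconv q p (hA hp) q hq (by omega) h (by tauto)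
      · exact absurd hp hqA
      · exact exists_consecutive hconv p q hq p (hA hp) (by omega) h (by tauto)
    obtain ⟨x, hx, y, hy, hxy, hxyA, hcons⟩ := key
    refine ⟨{x, y}, Finset.mem_filter.2 ⟨mem_edges_pathGraph.2
      ⟨x, y, hXV hx, hXV hy, hxy.le, hcons, rfl⟩,
      Finset.insert_subset hx (Finset.singleton_subset_iff.2 hy)⟩, fun h => ?_, fun h => ?_⟩
    · have h3 : x ∈ A := h (by simp)
      have h4 : y ∈ A := h (by simp)
      tauto
    · have h3 : x ∉ A := (Finset.mem_sdiff.1 (h (by simp : x ∈ ({x, y} : Finset ℕ)))).2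
      have h4 : y ∉ A := (Finset.mem_sdiff.1 (h (by simp : y ∈ ({x, y} : Finset ℕ)))).2
      tauto

end Hypergraph
end OInfinity
namespace OInfinity

-- From planar trees to constructs, canonical representatives and `α`.

namespace KeyedList

theorem lookup_eq_none {β : Type*} {l : List (ℕ × β)} {k : ℕ} (h : ∀ p ∈ l, p.1 ≠ k) :
    l.lookup k = none := by
  rw [List.lookup_eq_none_iff]
  intro p hp
  simpa using (h p hp).symm

theorem lookup_eq_some_iff {β : Type*} {l : List (ℕ × β)} (h : (l.map Prod.fst).Nodup) {k : ℕ}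
    {b : β} : l.lookup k = some b ↔ (k, b) ∈ l := by
  induction l with
  | nil => simp
  | cons p l ih =>
    obtain ⟨j, c⟩ := p
    rw [List.map_cons, List.nodup_cons] at h
    rw [List.lookup_cons, List.mem_cons]
    by_cases hjk : k = j
    · subst hjk
      have : (k, b) ∉ l := fun hm => h.1 (List.mem_map.2 ⟨_, hm, rfl⟩)
      simp [this, eq_comm]
    · rw [beq_eq_false_iff_ne.2 hjk]
      simp [hjk, ih h.2]

theorem lookup_perm {β : Type*} {l l' : List (ℕ × β)} (h : l.Perm l')
    (hl : (l'.map Prod.fst).Nodup) (k : ℕ) : l.lookup k = l'.lookup k := by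
  ext b
  rw [lookup_eq_some_iff hl,
    lookup_eq_some_iff ((h.map Prod.fst).nodup_iff.2 hl), h.mem_iff]

/-- This is how `canon` orders children: a list with increasing keys is reproduced. Together with
`lookup_perm` it shows that `canon` sorts the children by their root vertices. -/
theorem filterMap_lookup {β : Type*} {l : List (ℕ × β)} {vs : List ℕ}
    (hl : (l.map Prod.fst).Pairwise (· < ·)) (hvs : vs.Pairwise (· < ·))
    (h : ∀ p ∈ l, p.1 ∈ vs) : (vs.filterMap fun u => l.lookup u) = l.map Prod.snd := by
  induction vs generalizing l with
  | nil =>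
    obtain rfl : l = [] := List.eq_nil_iff_forall_not_mem.2 fun p hp => by simpa using h p hp
    simp
  | cons v vs ih =>
    rw [List.pairwise_cons] at hvs
    cases l with
    | nil => simp
    | cons p l =>
      obtain ⟨k, b⟩ := p
      rw [List.map_cons, List.pairwise_cons] at hl
      have hl1 : ∀ p ∈ l, k < p.1 := fun p hp => hl.1 _ (List.mem_map.2 ⟨p, hp, rfl⟩)
      by_cases hkv : v = k
      · subst hkv
        rw [List.filterMap_cons]
        simp only [List.lookup_cons, beq_self_eq_true, List.map_cons]
        rw [← ih hl.2 hvs.2]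
        · congr 1
          refine List.filterMap_congr fun u hu => ?_
          have := hvs.1 u hu
          rw [beq_eq_false_iff_ne.2 (by omega : u ≠ v)]
        · intro p hp
          refine (List.mem_cons.1 (h p (List.mem_cons_of_mem _ hp))).resolve_left ?_
          have := hl1 p hp
          omega
      · have hkvs : k ∈ vs := (List.mem_cons.1 (h (k, b) List.mem_cons_self)).resolve_left
          fun h => hkv h.symm
        have hvk := hvs.1 k hkvs
        rw [List.filterMap_cons, lookup_eq_none]
        · refine ih (by rw [List.map_cons, List.pairwise_cons]; exact hl) hvs.2 ?_
          intro p hp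
          refine (List.mem_cons.1 (h p hp)).resolve_left ?_
          rcases List.mem_cons.1 hp with rfl | hp
          · exact fun h => hkv h.symm
          · have := hl1 p hp
            omega
        · intro p hp
          rcases List.mem_cons.1 hp with rfl | hp
          · exact fun h => hkv h.symm
          · have := hl1 p hp
            omega

end KeyedList

namespace CTree

/-- The union of all decorations of a list of trees. -/
def suppList (cs : List CTree) : Finset ℕ := (vertsList cs).foldr (· ∪ ·) ∅

theorem supp_node (X : Finset ℕ) (cs : List CTree) : (node X cs).supp = X ∪ suppList cs := by
  simp [supp, suppList, verts]

theorem foldr_union_append (l l' : List (Finset ℕ)) :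
    (l ++ l').foldr (· ∪ ·) ∅ = l.foldr (· ∪ ·) ∅ ∪ l'.foldr (· ∪ ·) ∅ := by
  induction l with
  | nil => simp
  | cons X l ih => simp only [List.cons_append, List.foldr_cons, ih, Finset.union_assoc]

@[simp] theorem suppList_nil : suppList [] = ∅ := by simp [suppList, vertsList]

@[simp] theorem suppList_cons (c : CTree) (cs : List CTree) :
    suppList (c :: cs) = c.supp ∪ suppList cs := by
  rw [suppList, vertsList, foldr_union_append]; rfl

theorem mem_suppList {cs : List CTree} {x : ℕ} : x ∈ suppList cs ↔ ∃ c ∈ cs, x ∈ c.supp := by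
  induction cs with
  | nil => simp
  | cons c cs ih => simp [ih]

theorem canonList_eq_map (T : OTree) (cs : List CTree) :
    canonList T cs = cs.map fun c => (T.rootOf c.supp, canon T c) := by
  induction cs with
  | nil => simp [canonList]
  | cons c cs ih => simp [canonList, ih]

theorem renameList_eq_map (f : ℕ → ℕ) (cs : List CTree) :
    renameList f cs = cs.map (rename f) := by
  induction cs with
  | nil => simp [renameList]
  | cons c cs ih => simp [renameList, ih]

end CTree

namespace PTree

/-- The first leaves of the trees of the list, where leaves are numbered from `o`. -/
def starts : List PTree → ℕ → List ℕ
  | [], _ => []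
  | t :: ts, o => o :: starts ts (o + leaves t)

/-- The first leaves of the trees of the list, except for the first tree. -/
def cuts (ts : List PTree) (o : ℕ) : Finset ℕ := (starts ts o).toFinset.erase o

mutual
/-- The construct of the edge-graph of a linear tree corresponding to a planar tree, the leaves of
which are numbered from `o`. -/
def toC : PTree → ℕ → CTree
  | leaf, _ => .node ∅ []
  | node ts, o => .node (cuts ts o) (toCList ts o)
def toCList : List PTree → ℕ → List CTree
  | [], _ => []
  | t :: ts, o =>
    match t with
    | leaf => toCList ts (o + 1)
    | node us => toC (node us) o :: toCList ts (o + leaves (node us))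
end

mutual
/-- The planar tree with decorated vertices corresponding to a planar tree, the leaves of which are
numbered from `o`. -/
def toA : PTree → ℕ → ATree
  | leaf, o => .leaf o
  | node ts, o => .node (cuts ts o) (toAList ts o)
def toAList : List PTree → ℕ → List ATree
  | [], _ => []
  | t :: ts, o => toA t o :: toAList ts (o + leaves t)
end

/-- The trees of the list that are not leaves, with their first leaves. -/
def kids : List PTree → ℕ → List (ℕ × PTree)
  | [], _ => []
  | t :: ts, o =>
    match t with
    | leaf => kids ts (o + 1)
    | node us => (o, node us) :: kids ts (o + leaves (node us))

theorem toCList_eq_map (ts : List PTree) (o : ℕ) :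
    toCList ts o = (kids ts o).map fun p => toC p.2 p.1 := by
  induction ts generalizing o with
  | nil => simp [toCList, kids]
  | cons t ts ih => cases t <;> simp [toCList, kids, ih]

@[simp] theorem toCList_nil (o : ℕ) : toCList [] o = [] := by rw [toCList]

theorem toCList_cons_leaf (ts : List PTree) (o : ℕ) :
    toCList (.leaf :: ts) o = toCList ts (o + 1) := by rw [toCList]

theorem toCList_cons {t : PTree} (ht : t ≠ .leaf) (ts : List PTree) (o : ℕ) :
    toCList (t :: ts) o = toC t o :: toCList ts (o + leaves t) := by
  cases t with
  | leaf => exact absurd rfl ht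
  | node us => rw [toCList]

theorem kids_cons_leaf (ts : List PTree) (o : ℕ) :
    kids (.leaf :: ts) o = kids ts (o + 1) := by rw [kids]

theorem kids_cons {t : PTree} (ht : t ≠ .leaf) (ts : List PTree) (o : ℕ) :
    kids (t :: ts) o = (o, t) :: kids ts (o + leaves t) := by
  cases t with
  | leaf => exact absurd rfl ht
  | node us => rw [kids]

theorem starts_append (ts us : List PTree) (o : ℕ) :
    starts (ts ++ us) o = starts ts o ++ starts us (o + leavesList ts) := by
  induction ts generalizing o with
  | nil => simp [starts, leavesList]
  | cons t ts ih => simp [starts, leavesList, ih, add_assoc]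

theorem toCList_append (ts us : List PTree) (o : ℕ) :
    toCList (ts ++ us) o = toCList ts o ++ toCList us (o + leavesList ts) := by
  induction ts generalizing o with
  | nil => simp [leavesList]
  | cons t ts ih =>
    cases t with
    | leaf => rw [List.cons_append, toCList_cons_leaf, toCList_cons_leaf, ih, leavesList, leaves,
        add_assoc]
    | node vs => rw [List.cons_append, toCList_cons (by simp), toCList_cons (by simp), ih,
        leavesList, add_assoc, List.cons_append]

theorem toAList_append (ts us : List PTree) (o : ℕ) :
    toAList (ts ++ us) o = toAList ts o ++ toAList us (o + leavesList ts) := by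
  induction ts generalizing o with
  | nil => simp [leavesList, toAList]
  | cons t ts ih => simp [toAList, leavesList, ih, add_assoc]

theorem length_starts (ts : List PTree) (o : ℕ) : (starts ts o).length = ts.length := by
  induction ts generalizing o with
  | nil => rfl
  | cons t ts ih => simp [starts, ih]

variable {ts : List PTree}

theorem bounds_of_mem_starts (h : ∀ t ∈ ts, t.IsReduced) {o x : ℕ} (hx : x ∈ starts ts o) :
    o ≤ x ∧ x < o + leavesList ts := by
  induction ts generalizing o with
  | nil => simp [starts] at hx
  | cons t ts ih =>
    rw [List.forall_mem_cons] at h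
    have := h.1.one_le_leaves
    rw [starts, List.mem_cons] at hx
    rw [leavesList]
    rcases hx with rfl | hx
    · omega
    · have := ih h.2 hx
      omega

theorem pairwise_starts (h : ∀ t ∈ ts, t.IsReduced) (o : ℕ) :
    (starts ts o).Pairwise (· < ·) := by
  induction ts generalizing o with
  | nil => simp [starts]
  | cons t ts ih =>
    rw [List.forall_mem_cons] at h
    have := h.1.one_le_leaves
    rw [starts, List.pairwise_cons]
    refine ⟨fun x hx => ?_, ih h.2 _⟩
    have := bounds_of_mem_starts h.2 hx
    omega

theorem mem_cuts {o x : ℕ} : x ∈ cuts ts o ↔ x ≠ o ∧ x ∈ starts ts o := by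
  simp [cuts]

theorem reduced_of_mem_kids (h : ∀ t ∈ ts, t.IsReduced) {o : ℕ} {p : ℕ × PTree}
    (hp : p ∈ kids ts o) : p.2.IsReduced ∧ p.2 ≠ .leaf ∧ p.2 ∈ ts := by
  induction ts generalizing o with
  | nil => simp [kids] at hp
  | cons t ts ih =>
    rw [List.forall_mem_cons] at h
    cases t with
    | leaf =>
      rw [kids_cons_leaf] at hp
      obtain ⟨h1, h2, h3⟩ := ih h.2 hp
      exact ⟨h1, h2, List.mem_cons_of_mem _ h3⟩
    | node us =>
      rw [kids_cons (by simp), List.mem_cons] at hp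
      rcases hp with rfl | hp
      · exact ⟨h.1, by simp, by simp⟩
      · obtain ⟨h1, h2, h3⟩ := ih h.2 hp
        exact ⟨h1, h2, List.mem_cons_of_mem _ h3⟩

theorem starts_of_mem_kids {o : ℕ} {p : ℕ × PTree} (hp : p ∈ kids ts o) : p.1 ∈ starts ts o ∧
    (p.1 + leaves p.2 ∈ starts ts o ∨ p.1 + leaves p.2 = o + leavesList ts) := by
  induction ts generalizing o with
  | nil => simp [kids] at hp
  | cons t ts ih =>
    have key : p ∈ kids ts (o + leaves t) → p.1 ∈ starts (t :: ts) o ∧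
        (p.1 + leaves p.2 ∈ starts (t :: ts) o ∨ p.1 + leaves p.2 = o + leavesList (t :: ts)) := by
      intro hp
      obtain ⟨h1, h2⟩ := ih hp
      rw [starts, leavesList]
      refine ⟨List.mem_cons_of_mem _ h1, h2.imp (List.mem_cons_of_mem _) ?_⟩
      omega
    cases t with
    | leaf => exact key (by simpa [kids, leaves] using hp)
    | node us =>
      rw [kids_cons (by simp), List.mem_cons] at hp
      rcases hp with rfl | hp
      · rw [starts, leavesList]
        refine ⟨by simp, ?_⟩
        cases ts with
        | nil => simp [leavesList]
        | cons s ss => simp [starts]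
      · exact key hp

theorem pairwise_kids (h : ∀ t ∈ ts, t.IsReduced) (o : ℕ) :
    (kids ts o).Pairwise fun p q => p.1 + leaves p.2 ≤ q.1 := by
  induction ts generalizing o with
  | nil => simp [kids]
  | cons t ts ih =>
    rw [List.forall_mem_cons] at h
    cases t with
    | leaf => rw [kids_cons_leaf]; exact ih h.2 _
    | node us =>
      rw [kids_cons (by simp), List.pairwise_cons]
      exact ⟨fun p hp => (bounds_of_mem_starts h.2 (starts_of_mem_kids hp).1).1, ih h.2 _⟩

theorem pairwise_fst_kids (h : ∀ t ∈ ts, t.IsReduced) (o : ℕ) :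
    ((kids ts o).map Prod.fst).Pairwise (· < ·) := by
  rw [List.pairwise_map]
  refine (pairwise_kids h o).imp_of_mem fun {p q} hp hq hpq => ?_
  have := (reduced_of_mem_kids h hp).1.one_le_leaves
  omega

/-- Every leaf is the first leaf of a tree of the list, or belongs to exactly one tree of the list
that is not a leaf. -/
theorem exists_kid_iff (h : ∀ t ∈ ts, t.IsReduced) {o x : ℕ} :
    (∃ p ∈ kids ts o, p.1 < x ∧ x < p.1 + leaves p.2) ↔
      o ≤ x ∧ x < o + leavesList ts ∧ x ∉ starts ts o := by
  induction ts generalizing o with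
  | nil => simp [kids, leavesList]; omega
  | cons t ts ih =>
    rw [List.forall_mem_cons] at h
    have hb := fun hx => bounds_of_mem_starts h.2 (o := o + leaves t) (x := x) hx
    have h1 := h.1.one_le_leaves
    have h3 := ih h.2 (o := o + leaves t)
    have hkey : (∃ p ∈ kids (t :: ts) o, p.1 < x ∧ x < p.1 + leaves p.2) ↔
        (o < x ∧ x < o + leaves t) ∨ ∃ p ∈ kids ts (o + leaves t), p.1 < x ∧ x < p.1 + leaves p.2 := by
      cases t with
      | leaf =>
        rw [kids_cons_leaf, leaves]
        refine ⟨.inr, Or.rec (fun h => by omega) id⟩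
      | node us => rw [kids_cons (by simp)]; simp
    rw [hkey, h3, starts, leavesList, List.mem_cons]
    by_cases hx : x ∈ starts ts (o + leaves t)
    · have := hb hx
      simp only [hx, not_true, and_false, or_false, or_true]
      clear h3 hkey
      simp only [iff_false]
      omega
    · simp only [hx, or_false, not_false_eq_true, and_true]
      clear h3 hkey
      omega

/-- The gap before the leaf `x` is named `x`. Each gap inside the tree either separates two inputs
of the root or lies inside exactly one of them. -/
theorem supp_toC {t : PTree} (ht : t.IsReduced) (hl : t ≠ .leaf) (o : ℕ) :
    (toC t o).supp = Finset.Icc (o + 1) (o + leaves t - 1) := by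
  induction t using forall_of_node generalizing o with
  | leaf => exact absurd rfl hl
  | node ts ih =>
    rw [isReduced_node_iff] at ht
    ext x
    have h1 : x ∈ CTree.suppList (toCList ts o) ↔
        ∃ p ∈ kids ts o, p.1 < x ∧ x < p.1 + leaves p.2 := by
      rw [CTree.mem_suppList, toCList_eq_map]
      simp only [List.mem_map, exists_exists_and_eq_and]
      refine exists_congr fun p => and_congr_right fun hp => ?_
      obtain ⟨h2, h3, h4⟩ := reduced_of_mem_kids ht.2 hp
      rw [ih p.2 h4 h2 h3, Finset.mem_Icc]
      omega
    rw [toC, CTree.supp_node, Finset.mem_union, h1, exists_kid_iff ht.2, mem_cuts, leaves,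
      Finset.mem_Icc]
    by_cases hx : x ∈ starts ts o
    · have := bounds_of_mem_starts ht.2 hx
      simp only [hx, and_true, not_true, and_false, or_false]
      omega
    · have : x ≠ o := by
        rintro rfl
        refine hx ?_
        cases ts with
        | nil => simp at ht
        | cons t ts => simp [starts]
      simp only [hx, and_false, false_or, not_false_eq_true, and_true]
      omega

theorem mem_suppList_toCList (h : ∀ t ∈ ts, t.IsReduced) {o x : ℕ} :
    x ∈ CTree.suppList (toCList ts o) ↔ o ≤ x ∧ x < o + leavesList ts ∧ x ∉ starts ts o := by
  rw [← exists_kid_iff h, CTree.mem_suppList, toCList_eq_map]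
  simp only [List.mem_map, exists_exists_and_eq_and]
  refine exists_congr fun p => and_congr_right fun hp => ?_
  obtain ⟨h2, h3, h4⟩ := reduced_of_mem_kids h hp
  rw [supp_toC h2 h3, Finset.mem_Icc]
  omega

/-- `D` is the chosen representative of the construct `C` of the edge-graph of the linear tree with
`n` vertices. -/
def Represents (n : ℕ) (C D : CTree) : Prop :=
  C.supp = D.supp ∧ C.canon (OTree.lin n) = D

theorem two_le_leavesList (h : (node ts).IsReduced) : 2 ≤ leavesList ts := by
  have := h.two_le_leaves (by simp)
  rwa [leaves] at this

theorem leavesList_bound_of_mem_kids (h : ∀ t ∈ ts, t.IsReduced) {o : ℕ} {p : ℕ × PTree}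
    (hp : p ∈ kids ts o) : o ≤ p.1 ∧ 2 ≤ leaves p.2 ∧ p.1 + leaves p.2 ≤ o + leavesList ts := by
  obtain ⟨h1, h2, h3⟩ := reduced_of_mem_kids h hp
  obtain ⟨h4, h5⟩ := starts_of_mem_kids hp
  refine ⟨(bounds_of_mem_starts h h4).1, h1.two_le_leaves h2, ?_⟩
  rcases h5 with h5 | h5
  · exact (bounds_of_mem_starts h h5).2.le
  · exact h5.le

/-- The common last step of the comparisons of constructs: the children produced by a grafting or a
splitting may come in any order, because `canon` sorts them by first leaf. Equality of supports is
carried along since `rootOf` depends on it. -/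
theorem represents_node (h : ∀ t ∈ ts, t.IsReduced) {n o : ℕ} (ho : 1 ≤ o)
    (hn : o + leavesList ts ≤ n + 1) {cs cs' : List CTree} (hcs : cs.Perm cs')
    (hcs' : List.Forall₂ (Represents n) cs' (toCList ts o)) {X Y : Finset ℕ} (hXY : X = Y) :
    Represents n (.node X cs) (.node Y (toCList ts o)) := by
  subst hXY
  have h2 : CTree.canonList (OTree.lin n) cs' =
      (kids ts o).map fun p => (p.1, toC p.2 p.1) := by
    rw [CTree.canonList_eq_map]
    have key : ∀ (ds : List CTree) (ps : List (ℕ × PTree)), (∀ p ∈ ps, p ∈ kids ts o) →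
        List.Forall₂ (Represents n) ds (ps.map fun p => toC p.2 p.1) →
        (ds.map fun c => ((OTree.lin n).rootOf c.supp, CTree.canon (OTree.lin n) c)) =
        ps.map fun p => (p.1, toC p.2 p.1) := by
      intro ds ps hps hds
      induction ps generalizing ds with
      | nil => simp_all
      | cons p ps ih =>
        rw [List.map_cons, List.forall₂_cons_right_iff] at hds
        obtain ⟨d, ds', hd, hds', rfl⟩ := hds
        rw [List.forall_mem_cons] at hps
        rw [List.map_cons, List.map_cons, ih _ hps.2 hds', hd.2, hd.1]
        obtain ⟨h3, h4, -⟩ := reduced_of_mem_kids h hps.1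
        have h5 := leavesList_bound_of_mem_kids h hps.1
        rw [supp_toC h3 h4, OTree.rootOf_lin_Icc (by omega) (by omega) (by omega)]
    rw [toCList_eq_map] at hcs'
    exact key _ _ (fun _ h => h) hcs'
  refine ⟨?_, ?_⟩
  · rw [CTree.supp_node, CTree.supp_node]
    congr 1
    ext x
    simp only [CTree.mem_suppList, hcs.mem_iff]
    clear hcs h2 hn
    generalize toCList ts o = ds at hcs' ⊢
    induction hcs' with
    | nil => simp
    | cons h _ ih => simp only [List.exists_mem_cons_iff, ih, h.1]
  · rw [CTree.canon, OTree.vertices_lin, toCList_eq_map]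
    congr 1
    have h3 : ((CTree.canonList (OTree.lin n) cs').map Prod.fst).Pairwise (· < ·) := by
      rw [h2, List.map_map]
      exact pairwise_fst_kids h o
    have h4 : (CTree.canonList (OTree.lin n) cs).Perm (CTree.canonList (OTree.lin n) cs') := by
      rw [CTree.canonList_eq_map, CTree.canonList_eq_map]
      exact hcs.map _
    calc _ = (List.range' 1 n).filterMap fun u => (CTree.canonList (OTree.lin n) cs').lookup u :=
          List.filterMap_congr fun u _ => KeyedList.lookup_perm h4 (h3.imp fun h => h.ne) u
      _ = _ := by
        rw [KeyedList.filterMap_lookup h3 List.pairwise_lt_range', h2, List.map_map]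
        · rfl
        · intro p hp
          rw [h2, List.mem_map] at hp
          obtain ⟨p, hp, rfl⟩ := hp
          have := leavesList_bound_of_mem_kids h hp
          rw [List.mem_range'_1]
          simp only
          omega

theorem represents_toC {t : PTree} (ht : t.IsReduced) (hl : t ≠ .leaf) {n o : ℕ} (ho : 1 ≤ o)
    (hn : o + leaves t ≤ n + 1) : Represents n (toC t o) (toC t o) := by
  induction t using forall_of_node generalizing o with
  | leaf => exact absurd rfl hl
  | node ts ih =>
    rw [isReduced_node_iff] at ht
    rw [leaves] at hn
    rw [toC]
    refine represents_node ht.2 ho hn (List.Perm.refl _) ?_ rfl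
    rw [List.forall₂_same, toCList_eq_map]
    intro c hc
    obtain ⟨p, hp, rfl⟩ := List.mem_map.1 hc
    obtain ⟨h1, h2, h3⟩ := reduced_of_mem_kids ht.2 hp
    have h4 := leavesList_bound_of_mem_kids ht.2 hp
    exact ih _ h3 h1 h2 (by omega) (by omega)

theorem canon_toC {t : PTree} (ht : t.IsReduced) (hl : t ≠ .leaf) {n o : ℕ} (ho : 1 ≤ o)
    (hn : o + leaves t ≤ n + 1) : (toC t o).canon (OTree.lin n) = toC t o :=
  (represents_toC ht hl ho hn).2

theorem eq_of_pairwise_lt {l l' : List ℕ} (h : l.Pairwise (· < ·)) (h' : l'.Pairwise (· < ·))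
    (hm : ∀ x, x ∈ l ↔ x ∈ l') : l = l' :=
  ((List.perm_ext_iff_of_nodup (h.imp fun h => h.ne) (h'.imp fun h => h.ne)).2 hm).eq_of_pairwise
    (fun _ _ _ _ h1 h2 => absurd h1 h2.not_gt) h h'

theorem alphaList_eq_map (T : OTree) (cs : List CTree) :
    alphaList T cs = cs.map fun c => (T.rootOf c.supp, alpha T c) := by
  induction cs with
  | nil => simp [alphaList]
  | cons c cs ih => simp [alphaList, ih]

/-- The inputs that carry no child of the construct are exactly the leaves, where the default value
of the lookup applies. -/
theorem map_lookup_kids (h : ∀ t ∈ ts, t.IsReduced) (o : ℕ) :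
    ((starts ts o).map fun u =>
      (((kids ts o).map fun p => (p.1, toA p.2 p.1)).lookup u).getD (.leaf u)) = toAList ts o := by
  induction ts generalizing o with
  | nil => simp [starts, toAList]
  | cons t ts ih =>
    rw [List.forall_mem_cons] at h
    have h1 := h.1.one_le_leaves
    rw [toAList, ← ih h.2, starts, List.map_cons]
    have hlt : ∀ p ∈ kids ts (o + leaves t), o < p.1 := fun p hp => by
      have := (bounds_of_mem_starts h.2 (starts_of_mem_kids hp).1).1
      omega
    cases t with
    | leaf =>
      rw [kids_cons_leaf, KeyedList.lookup_eq_none, toA]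
      · rfl
      · intro p hp
        obtain ⟨p, hp, rfl⟩ := List.mem_map.1 hp
        exact (hlt p (by rwa [leaves])).ne'
    | node us =>
      rw [kids_cons (by simp)]
      congr 1
      · simp
      · refine List.map_congr_left fun u hu => ?_
        have := bounds_of_mem_starts h.2 hu
        rw [List.map_cons, List.lookup_cons, beq_eq_false_iff_ne.2 (by omega : u ≠ o)]

/-- The inputs of a vertex of `α` are its root vertex and the upper vertices of its edges, that is,
the first leaves of the subtrees. So `α` gives back the planar tree. -/
theorem alpha_toC {t : PTree} (ht : t.IsReduced) (hl : t ≠ .leaf) {n o : ℕ} (ho : 1 ≤ o)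
    (hn : o + leaves t ≤ n + 1) : alpha (OTree.lin n) (toC t o) = toA t o := by
  induction t using forall_of_node generalizing o with
  | leaf => exact absurd rfl hl
  | node ts ih =>
    have h2 := ht.two_le_leaves hl
    have hs := supp_toC ht hl o
    rw [toC] at hs ⊢
    rw [alpha, hs, OTree.rootOf_lin_Icc ho (by omega) (by omega), toA, OTree.vertices_lin]
    rw [isReduced_node_iff] at ht
    rw [leaves] at hn
    have h3 : ((List.range' 1 n).filter fun u => u = o ∨ u ∈ cuts ts o) = starts ts o := by
      refine eq_of_pairwise_lt ((List.pairwise_lt_range').sublist List.filter_sublist)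
        (pairwise_starts ht.2 o) fun x => ?_
      have ho' : o ∈ starts ts o := by
        cases ts with
        | nil => simp at ht
        | cons t ts => simp [starts]
      simp only [List.mem_filter, List.mem_range'_1, decide_eq_true_eq, mem_cuts]
      by_cases hx : x ∈ starts ts o
      · have := bounds_of_mem_starts ht.2 hx
        simp only [hx, and_true, iff_true]
        omega
      · have : x ≠ o := by rintro rfl; exact hx ho'
        simp [hx, this]
    rw [h3, ← map_lookup_kids ht.2 o]
    congr 3
    funext u
    congr 2
    rw [alphaList_eq_map, toCList_eq_map, List.map_map]
    refine List.map_congr_left fun p hp => ?_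
    obtain ⟨h5, h6, h7⟩ := reduced_of_mem_kids ht.2 hp
    have h4 := leavesList_bound_of_mem_kids ht.2 hp
    simp only [Function.comp]
    rw [supp_toC h5 h6, OTree.rootOf_lin_Icc (by omega) (by omega) (by omega),
      ih _ h7 h5 h6 (by omega) (by omega)]

end PTree
end OInfinity
namespace OInfinity

-- Every construct of a path comes from a planar tree.

namespace Hypergraph

theorem restrict_compl (H : Hypergraph) (A X : Finset ℕ) :
    (H.restrict A).restrict ((H.restrict A).verts \ X) = H.restrict (A \ X) :=
  restrict_restrict (A := A) (B := A \ X) Finset.sdiff_subset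

/-- The maximal intervals avoiding a set `X` are components of the complement of `X` in a path. -/
theorem Icc_mem_components {n a b x y : ℕ} {X : Finset ℕ} (ha : 1 ≤ a) (hb : b ≤ n)
    (hX : X ⊆ Finset.Icc (a + 1) b) (hx : x = a ∨ x ∈ X) (hy : y = b + 1 ∨ y ∈ X) (hxy : x + 1 < y)
    (h : ∀ z ∈ X, ¬ (x < z ∧ z < y)) :
    Finset.Icc (x + 1) (y - 1) ∈
      ((pathGraph (Finset.Icc 2 n)).restrict (Finset.Icc (a + 1) b \ X)).components := by
  have hax : a ≤ x := by
    rcases hx with rfl | hx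
    · exact le_rfl
    · have := Finset.mem_Icc.1 (hX hx); omega
  have hyb : y ≤ b + 1 := by
    rcases hy with rfl | hy
    · exact le_rfl
    · have := Finset.mem_Icc.1 (hX hy); omega
  have hsub : Finset.Icc (x + 1) (y - 1) ⊆ Finset.Icc (a + 1) b \ X := by
    intro z hz
    rw [Finset.mem_Icc] at hz
    rw [Finset.mem_sdiff, Finset.mem_Icc]
    refine ⟨by omega, fun hzX => h z hzX (by omega)⟩
  rw [mem_components]
  refine ⟨hsub, ?_, ?_⟩
  · rw [restrict_restrict hsub, isConnected_pathGraph_restrict]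
    · refine ⟨⟨x + 1, Finset.mem_Icc.2 (by omega)⟩, ?_⟩
      intro p hp q hq r _ h1 h2
      rw [Finset.mem_Icc] at *
      omega
    · intro z hz
      rw [Finset.mem_Icc] at *
      omega
  · intro Z hZ
    obtain ⟨hZ, hZX⟩ := Finset.mem_filter.1 hZ
    obtain ⟨p, q, hp, hq, hpq, hcons, rfl⟩ := mem_edges_pathGraph.1 hZ
    have hp' : p ∈ Finset.Icc (a + 1) b \ X := hZX (by simp)
    have hq' : q ∈ Finset.Icc (a + 1) b \ X := hZX (by simp)
    rw [Finset.mem_sdiff, Finset.mem_Icc] at hp' hq'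
    rw [Finset.mem_Icc] at hp hq
    have hpx : p ≠ x := by
      rintro rfl
      rcases hx with rfl | hx
      · omega
      · exact hp'.2 hx
    have hqy : q ≠ y := by
      rintro rfl
      rcases hy with rfl | hy
      · omega
      · exact hq'.2 hy
    have h1 := fun h => hcons x (Finset.mem_Icc.2 h)
    have h2 := fun h => hcons y (Finset.mem_Icc.2 h)
    by_cases hpK : x < p ∧ p < y
    · left
      intro z hz
      simp only [Finset.mem_insert, Finset.mem_singleton] at hz
      rw [Finset.mem_Icc]
      rcases hz with rfl | rfl <;> omega
    · right
      intro z hz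
      rw [Finset.mem_sdiff]
      refine ⟨hZX hz, ?_⟩
      simp only [Finset.mem_insert, Finset.mem_singleton] at hz
      rw [Finset.mem_Icc]
      rcases hz with rfl | rfl <;> omega

end Hypergraph

namespace PTree

variable {ts : List PTree}

theorem cuts_subset (h : (node ts).IsReduced) {o : ℕ} :
    cuts ts o ⊆ Finset.Icc (o + 1) (o + leavesList ts - 1) := by
  rw [isReduced_node_iff] at h
  intro x hx
  rw [mem_cuts] at hx
  have := bounds_of_mem_starts h.2 hx.2
  rw [Finset.mem_Icc]
  omega

theorem start_mem {o : ℕ} (h : ts ≠ []) : o ∈ starts ts o := by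
  cases ts with
  | nil => simp at h
  | cons t ts => simp [starts]

theorem not_mem_starts_of_mem_kids (h : ∀ t ∈ ts, t.IsReduced) {o : ℕ} {p : ℕ × PTree}
    (hp : p ∈ kids ts o) {z : ℕ} (h1 : p.1 < z) (h2 : z < p.1 + leaves p.2) : z ∉ starts ts o :=
  ((exists_kid_iff h).1 ⟨p, hp, h1, h2⟩).2.2

theorem nodup_map_supp (h : ∀ t ∈ ts, t.IsReduced) (o : ℕ) :
    ((toCList ts o).map CTree.supp).Nodup := by
  rw [toCList_eq_map, List.map_map, List.Nodup, List.pairwise_map]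
  refine (pairwise_kids h o).imp_of_mem fun {p q} hp hq hpq heq => ?_
  obtain ⟨h1, h2, -⟩ := reduced_of_mem_kids h hp
  obtain ⟨h3, h4, -⟩ := reduced_of_mem_kids h hq
  simp only [Function.comp] at heq
  rw [supp_toC h1 h2, supp_toC h3 h4] at heq
  have h5 := h1.two_le_leaves h2
  have : p.1 + 1 ∈ Finset.Icc (p.1 + 1) (p.1 + leaves p.2 - 1) := by
    rw [Finset.mem_Icc]; omega
  rw [heq, Finset.mem_Icc] at this
  omega

/-- Between two neighbouring cuts lie the gaps of one input of the root. There are none if the input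
is a leaf; otherwise they form a component, and these intervals cover everything. -/
theorem components_toC (h : (node ts).IsReduced) {n o : ℕ} (ho : 1 ≤ o)
    (hn : o + leavesList ts ≤ n + 1) :
    ((pathGraph (Finset.Icc 2 n)).restrict
      (Finset.Icc (o + 1) (o + leavesList ts - 1) \ cuts ts o)).components.val =
      ((toCList ts o).map CTree.supp : List (Finset ℕ)) := by
  have hsub := cuts_subset (o := o) h
  have hL := two_le_leavesList h
  rw [isReduced_node_iff] at h
  have hne : ts ≠ [] := by rintro rfl; simp at h
  rw [Hypergraph.components_eq (F := ((toCList ts o).map CTree.supp).toFinset),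
    List.toFinset_val, (nodup_map_supp h.2 o).dedup]
  · intro K hK
    rw [List.mem_toFinset, toCList_eq_map, List.map_map, List.mem_map] at hK
    obtain ⟨p, hp, rfl⟩ := hK
    obtain ⟨h1, h2, -⟩ := reduced_of_mem_kids h.2 hp
    obtain ⟨h3, h4⟩ := starts_of_mem_kids hp
    have h5 := leavesList_bound_of_mem_kids h.2 hp
    simp only [Function.comp]
    rw [supp_toC h1 h2]
    refine Hypergraph.Icc_mem_components ho (by omega) hsub ?_ ?_ (by omega) ?_
    · rw [mem_cuts]
      by_cases hpo : p.1 = o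
      · exact .inl hpo
      · exact .inr ⟨hpo, h3⟩
    · rw [mem_cuts]
      rcases h4 with h4 | h4
      · exact .inr ⟨by omega, h4⟩
      · left; omega
    · intro z hz h6
      exact not_mem_starts_of_mem_kids h.2 hp h6.1 h6.2 (mem_cuts.1 hz).2
  · intro v hv
    change v ∈ _ \ _ at hv
    rw [Finset.mem_sdiff, Finset.mem_Icc, mem_cuts] at hv
    have : v ∈ CTree.suppList (toCList ts o) :=
      (mem_suppList_toCList h.2).2 ⟨by omega, by omega, fun hs => hv.2 ⟨by omega, hs⟩⟩
    obtain ⟨c, hc, hcv⟩ := CTree.mem_suppList.1 this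
    exact ⟨c.supp, List.mem_toFinset.2 (List.mem_map.2 ⟨c, hc, rfl⟩), hcv⟩

theorem isConstruct_toC {t : PTree} (ht : t.IsReduced) (hl : t ≠ .leaf) {n o : ℕ} (ho : 1 ≤ o)
    (hn : o + leaves t ≤ n + 1) :
    CTree.IsConstruct ((pathGraph (Finset.Icc 2 n)).restrict
      (Finset.Icc (o + 1) (o + leaves t - 1))) (toC t o) := by
  induction t using forall_of_node generalizing o with
  | leaf => exact absurd rfl hl
  | node ts ih =>
    have hsub := cuts_subset (o := o) ht
    have hcomp := components_toC ht ho (by rwa [leaves] at hn)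
    rw [isReduced_node_iff] at ht
    rw [leaves] at hn ⊢
    rw [toC]
    refine .node _ _ _ ?_ hsub ?_ ?_
    · obtain ⟨t, ts, rfl⟩ := List.exists_cons_of_length_pos (by omega : 0 < ts.length)
      rw [List.forall_mem_cons] at ht
      have h1 := ht.2.1.one_le_leaves
      refine ⟨o + leaves t, mem_cuts.2 ⟨by omega, ?_⟩⟩
      rw [starts]
      refine List.mem_cons_of_mem _ (start_mem ?_)
      rintro rfl
      simp at ht
    · rw [Hypergraph.restrict_compl]
      exact hcomp.symm
    · intro c hc
      rw [toCList_eq_map] at hc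
      obtain ⟨p, hp, rfl⟩ := List.mem_map.1 hc
      obtain ⟨h1, h2, h3⟩ := reduced_of_mem_kids ht.2 hp
      have h4 := leavesList_bound_of_mem_kids ht.2 hp
      rw [supp_toC h1 h2, Hypergraph.restrict_restrict]
      · exact ih _ h3 h1 h2 (by omega) (by omega)
      · intro z hz
        rw [Finset.mem_Icc] at *
        omega

/-- Assembles the inputs of a vertex: if each stretch between neighbouring starts can be filled by a
tree, the trees form a list with the prescribed starts. The property `Q` records where each tree
comes from. -/
theorem exists_list_of_starts {e : ℕ} {Q : ℕ → PTree → Prop} (xs : List ℕ) (x : ℕ)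
    (hx : (x :: xs).Pairwise (· < ·)) (hlt : ∀ z ∈ x :: xs, z < e)
    (H : ∀ z ∈ x :: xs, ∀ y, (y ∈ xs ∨ y = e) → z < y → (∀ w ∈ xs, ¬ (z < w ∧ w < y)) →
      ∃ t : PTree, t.IsReduced ∧ z + leaves t = y ∧ Q z t) :
    ∃ ts : List PTree, ts.length = xs.length + 1 ∧ (∀ t ∈ ts, t.IsReduced) ∧
      starts ts x = x :: xs ∧ x + leavesList ts = e ∧ ∀ p ∈ kids ts x, Q p.1 p.2 := by
  induction xs generalizing x with
  | nil =>
    obtain ⟨t, h1, h2, h3⟩ := H x (by simp) e (.inr rfl) (hlt x (by simp)) (by simp)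
    refine ⟨[t], rfl, by simpa using h1, rfl, by simpa [leavesList] using h2, ?_⟩
    cases t with
    | leaf => simp [kids]
    | node us => simpa [kids] using h3
  | cons y ys ih =>
    rw [List.pairwise_cons] at hx
    have hxy := hx.1 y (by simp)
    obtain ⟨ts, h1, h2, h3, h4, h5⟩ := ih y hx.2 (fun z hz => hlt z (by simp_all)) (by
      intro z hz w hw hzw h
      refine H z (List.mem_cons_of_mem _ hz) w (hw.imp (List.mem_cons_of_mem _) id) hzw ?_
      intro v hv
      rcases List.mem_cons.1 hv with rfl | hv
      · rcases List.mem_cons.1 hz with rfl | hz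
        · omega
        · have := (List.pairwise_cons.1 hx.2).1 z hz
          omega
      · exact h v hv)
    obtain ⟨t, h6, h7, h8⟩ := H x (by simp) y (.inl (by simp)) hxy (by
      intro w hw
      rcases List.mem_cons.1 hw with rfl | hw
      · omega
      · have := (List.pairwise_cons.1 hx.2).1 w hw
        omega)
    refine ⟨t :: ts, by simp [h1], List.forall_mem_cons.2 ⟨h6, h2⟩, by rw [starts, h7, h3], ?_, ?_⟩
    · rw [leavesList]; omega
    · cases t with
      | leaf =>
        rw [kids_cons_leaf]
        rw [leaves] at h7
        rwa [h7]
      | node us =>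
        rw [kids_cons (by simp), List.forall_mem_cons, h7]
        exact ⟨h8, h5⟩

/-- Surjectivity, by induction on constructs. The root decoration cuts the interval into stretches;
each is a single leaf or supports one component, which carries a planar tree by induction. -/
theorem exists_represents {n : ℕ} {H : Hypergraph} {C : CTree} (hC : CTree.IsConstruct H C) :
    ∀ a b, 1 ≤ a → b ≤ n → H = (pathGraph (Finset.Icc 2 n)).restrict (Finset.Icc (a + 1) b) →
    ∃ t : PTree, t.IsReduced ∧ t ≠ .leaf ∧ a + leaves t = b + 1 ∧ Represents n C (toC t a) := by
  induction hC with
  | node H X cs hX hXH hcomp hcs ih =>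
    rintro a b ha hb rfl
    have hXH : X ⊆ Finset.Icc (a + 1) b := hXH
    rw [Hypergraph.restrict_compl] at hcomp
    -- Components are distinct, so a child is determined by its support; this is used at the end to
    -- identify children.
    have hnd : (cs.map CTree.supp).Nodup := by
      have := Finset.nodup ((pathGraph (Finset.Icc 2 n)).restrict
        (Finset.Icc (a + 1) b \ X)).components
      rwa [← hcomp] at this
    have hab : a < b := by
      obtain ⟨x, hx⟩ := hX
      have := Finset.mem_Icc.1 (hXH hx)
      omega
    have hmem : ∀ z, z ∈ X.sort ↔ z ∈ X := fun z => Finset.mem_sort _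
    obtain ⟨ts, h1, h2, h3, h4, h5⟩ := exists_list_of_starts (e := b + 1)
      (Q := fun z t => t ≠ .leaf → ∃ c ∈ cs, Represents n c (toC t z)) X.sort a (by
        rw [List.pairwise_cons]
        refine ⟨fun z hz => ?_, (Finset.sortedLT_sort X).pairwise⟩
        have := Finset.mem_Icc.1 (hXH ((hmem z).1 hz))
        omega) (by
        intro z hz
        rcases List.mem_cons.1 hz with rfl | hz
        · omega
        · have := Finset.mem_Icc.1 (hXH ((hmem z).1 hz))
          omega) (by
        intro z hz y hy hzy h
        simp only [List.mem_cons, hmem] at hz hy h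
        by_cases hzy' : y = z + 1
        · exact ⟨.leaf, .leaf, by rw [leaves, hzy'], fun h => absurd rfl h⟩
        · have hK := Hypergraph.Icc_mem_components ha hb hXH hz hy.symm (by omega) h
          have hz' : a ≤ z := by
            rcases hz with rfl | hz
            · exact le_rfl
            · have := Finset.mem_Icc.1 (hXH hz); omega
          have hy' : y ≤ b + 1 := by
            rcases hy with hy | rfl
            · have := Finset.mem_Icc.1 (hXH hy); omega
            · exact le_rfl
          rw [← Finset.mem_val, ← hcomp, Multiset.mem_coe, List.mem_map] at hK
          obtain ⟨c, hc, hcK⟩ := hK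
          obtain ⟨t, h6, h7, h8, h9⟩ := ih c hc z (y - 1) (by omega) (by omega) (by
            rw [hcK]
            refine Hypergraph.restrict_restrict ?_
            intro w hw
            rw [Finset.mem_Icc] at *
            omega)
          exact ⟨t, h6, by omega, fun _ => ⟨c, hc, h9⟩⟩)
    have hred : (PTree.node ts).IsReduced := by
      rw [isReduced_node_iff]
      refine ⟨?_, h2⟩
      rw [h1, Finset.length_sort]
      have := hX.card_pos
      omega
    have hcuts : cuts ts a = X := by
      ext z
      rw [mem_cuts, h3, List.mem_cons, hmem]
      constructor
      · tauto
      · intro hz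
        have := Finset.mem_Icc.1 (hXH hz)
        exact ⟨by omega, .inr hz⟩
    refine ⟨.node ts, hred, by simp, by rw [leaves]; omega, ?_⟩
    rw [toC]
    have hcomp' := components_toC hred ha (n := n) (by omega)
    rw [show a + leavesList ts - 1 = b by omega, hcuts, ← hcomp, Multiset.coe_eq_coe] at hcomp'
    -- Both lists of children have the same supports up to order; this reorders those of the given
    -- construct accordingly.
    obtain ⟨ds, hds, hperm⟩ := List.perm_comp_forall₂ (r := fun K c => CTree.supp c = K)
      hcomp'.symm (List.forall₂_map_left_iff.2 (List.forall₂_same.2 fun c _ => rfl))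
    refine represents_node h2 ha (by omega) hperm.symm ?_ hcuts.symm
    rw [List.forall₂_map_left_iff] at hds
    rw [List.forall₂_iff_get] at hds ⊢
    refine ⟨hds.1.symm, fun i hi hi' => ?_⟩
    have h6 := hds.2 i hi' hi
    have h7 : ds.get ⟨i, hi⟩ ∈ cs := hperm.subset (List.get_mem _ _)
    have h8 : (toCList ts a).get ⟨i, hi'⟩ ∈ toCList ts a := List.get_mem _ _
    generalize ds.get ⟨i, hi⟩ = d at *
    generalize (toCList ts a).get ⟨i, hi'⟩ = d' at *
    rw [toCList_eq_map, List.mem_map] at h8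
    obtain ⟨p, hp, rfl⟩ := h8
    obtain ⟨c, hc, hcr⟩ := h5 p hp (reduced_of_mem_kids h2 hp).2.1
    have : c.supp = d.supp := hcr.1.trans h6.symm
    rwa [← List.inj_on_of_nodup_map hnd hc h7 this]

mutual
/-- Forget the decorations. -/
def ofATree : ATree → PTree
  | .leaf _ => leaf
  | .node _ ts => node (ofATreeList ts)
def ofATreeList : List ATree → List PTree
  | [] => []
  | t :: ts => ofATree t :: ofATreeList ts
end

theorem ofATree_toA (t : PTree) (o : ℕ) : ofATree (toA t o) = t := by
  induction t using forall_of_node generalizing o with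
  | leaf => simp [toA, ofATree]
  | node ts ih =>
    rw [toA, ofATree]
    congr 1
    induction ts generalizing o with
    | nil => simp [toAList, ofATreeList]
    | cons t ts ih' =>
      rw [List.forall_mem_cons] at ih
      rw [toAList, ofATreeList, ih.1, ih' ih.2]

/-- The constructs of the edge-graph of the linear tree with `n` vertices. -/
theorem isConstruct_lin_iff {n : ℕ} {C : CTree} :
    (1 ≤ n ∧ CTree.IsConstruct (OTree.lin n).edgeGraph C ∧ C.canon (OTree.lin n) = C) ↔
      ∃ t : PTree, t.IsReduced ∧ t ≠ .leaf ∧ leaves t = n ∧ C = toC t 1 := by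
  rw [OTree.edgeGraph_lin]
  constructor
  · rintro ⟨h1, h2, h3⟩
    obtain ⟨t, h4, h5, h6, h7⟩ := exists_represents h2 1 n le_rfl le_rfl
      (Hypergraph.restrict_verts_pathGraph _).symm
    exact ⟨t, h4, h5, by omega, h3.symm.trans h7.2⟩
  · rintro ⟨t, h1, h2, rfl, rfl⟩
    have := isConstruct_toC h1 h2 (n := leaves t) (o := 1) le_rfl (by omega)
    rw [Nat.add_sub_cancel_left, show 1 + 1 = 2 from rfl,
      Hypergraph.restrict_verts_pathGraph] at this
    exact ⟨h1.one_le_leaves, this, canon_toC h1 h2 le_rfl (by omega)⟩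

end PTree
end OInfinity
namespace OInfinity

-- Substitution of linear trees and composition of constructs.

namespace OTree

theorem relabel_chain (f : ℕ → ℕ) (vs : List ℕ) : (chain vs).relabel f = chain (vs.map f) := by
  induction vs with
  | nil => simp [chain, relabel]
  | cons v vs ih => simp [chain, relabel, relabelList, ih]

theorem fill_chain (us : List ℕ) (S : OTree) (ws : List ℕ) (hS : S = chain ws) :
    fill (chain us) [S] = (chain (us ++ ws), []) := by
  induction us with
  | nil => simp [chain, fill, hS]
  | cons v vs ih => simp [chain, fill, fillList, ih]

theorem replace_chain (i : ℕ) (f : ℕ → ℕ) (us vs : List ℕ) :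
    replace i f (chain us) (chain vs) =
      chain (vs.flatMap fun v => if v = i then us else [f v]) := by
  induction vs with
  | nil => simp [chain, replace]
  | cons v vs ih =>
    rw [chain, replace, replaceList, replaceList, ih, List.flatMap_cons]
    split_ifs with h
    · rw [fill_chain _ _ _ rfl]
    · rfl

theorem subst_lin {m l i : ℕ} (hi : 1 ≤ i) (him : i ≤ m) (hl : 1 ≤ l) :
    (lin m).subst i (lin l) = lin (m + l - 1) := by
  rw [subst, vertices_lin, List.length_range', lin, lin, relabel_chain, replace_chain, lin]
  congr 1
  have h1 : List.range' 1 m = List.range' 1 (i - 1) ++ (i :: List.range' (i + 1) (m - i)) := by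
    obtain ⟨c, rfl⟩ := Nat.exists_eq_add_of_le hi
    rw [← List.range'_succ, Nat.add_sub_cancel_left, List.range'_append_1]
    congr 1; omega
  have h2 : (List.range' 1 l).map (inner i) = List.range' i l := by
    obtain ⟨c, rfl⟩ := Nat.exists_eq_add_of_le hi
    rw [show inner (1 + c) = (c + ·) by funext v; simp only [inner]; omega, List.map_add_range',
      add_comm c 1]
  have h3 : (List.range' (i + 1) (m - i)).flatMap
      (fun v => if v = i then (List.range' 1 l).map (inner i) else [outer i l v]) =
      List.range' (i + l) (m - i) := by
    conv_rhs => rw [show i + l = l - 1 + (i + 1) by omega,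
      ← List.map_add_range' (i + 1) (m - i) 1, ← List.flatMap_singleton' (List.map _ _),
      List.flatMap_map]
    refine List.flatMap_congr fun v hv => ?_
    rw [List.mem_range'_1] at hv
    rw [if_neg (by omega), outer, if_neg (by omega)]
    congr 1; omega
  have h4 : (List.range' 1 (i - 1)).flatMap
      (fun v => if v = i then (List.range' 1 l).map (inner i) else [outer i l v]) =
      List.range' 1 (i - 1) := by
    conv_rhs => rw [← List.flatMap_singleton' (List.range' 1 (i - 1))]
    refine List.flatMap_congr fun v hv => ?_
    rw [List.mem_range'_1] at hv
    rw [if_neg (by omega), outer, if_pos (by omega)]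
  rw [h1, List.flatMap_append, List.flatMap_cons, h3, h4, if_pos rfl, h2, List.range'_append_1]
  obtain ⟨c, rfl⟩ := Nat.exists_eq_add_of_le hi
  rw [Nat.add_sub_cancel_left, List.range'_append_1]
  congr 1; omega

/-- The bottom vertex of the inserted chain receives the index `i`, so the edge below it keeps its
name, and only the edges above it are shifted. -/
theorem edgeName_lin {i l : ℕ} (hi : 1 ≤ i) (hl : 1 ≤ l) (e : ℕ) :
    edgeName i (lin l) e = if e ≤ i then e else e + l - 1 := by
  have : (lin l).root? = some 1 := by
    obtain ⟨l, rfl⟩ := Nat.exists_eq_add_of_le' hl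
    rw [lin, List.range'_succ, chain, root?]
  rw [edgeName, this, vertices_lin, List.length_range', outer, inner, Option.getD_some]
  split_ifs <;> omega

end OTree

namespace PTree

variable {ts : List PTree}

theorem starts_add (ts : List PTree) (o d : ℕ) :
    starts ts (o + d) = (starts ts o).map (· + d) := by
  induction ts generalizing o with
  | nil => rfl
  | cons t ts ih => rw [starts, starts, List.map_cons, ← ih, add_right_comm]

theorem cuts_add (ts : List PTree) (o d : ℕ) : cuts ts (o + d) = (cuts ts o).image (· + d) := by
  rw [cuts, cuts, starts_add, Finset.image_erase (add_left_injective d)]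
  congr 1
  ext x
  simp

/-- Only the gaps strictly inside the tree occur in its decorations, so `f` need be a translation
only there. -/
theorem rename_toC {t : PTree} (ht : t.IsReduced) (hl : t ≠ .leaf) {f : ℕ → ℕ} {o d : ℕ}
    (h : ∀ x, o < x → x < o + leaves t → f x = x + d) :
    (toC t o).rename f = toC t (o + d) := by
  induction t using forall_of_node generalizing o with
  | leaf => exact absurd rfl hl
  | node ts ih =>
    rw [toC, CTree.rename, toC, CTree.renameList_eq_map]
    have hc := cuts_subset (o := o) ht
    rw [isReduced_node_iff] at ht
    rw [leaves] at h
    congr 1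
    · rw [cuts_add]
      refine Finset.image_congr fun x hx => ?_
      have := Finset.mem_Icc.1 (hc hx)
      exact h x (by omega) (by omega)
    · replace ht := ht.2
      clear hc hl
      induction ts generalizing o with
      | nil => rfl
      | cons t ts ih' =>
        rw [List.forall_mem_cons] at ht ih
        rw [leavesList] at h
        have key := ih' ih.2 (o := o + leaves t) (fun x h1 h2 => h x (by omega) (by omega)) ht.2
        cases t with
        | leaf =>
          rw [toCList_cons_leaf, toCList_cons_leaf, add_right_comm]
          exact key
        | node us =>
          rw [toCList_cons (by simp), toCList_cons (by simp), List.map_cons, key,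
            add_right_comm, ih.1 ht.1 (by simp) fun x h1 h2 => h x h1 (by omega)]

theorem map_rename_toCList (h : ∀ t ∈ ts, t.IsReduced) {f : ℕ → ℕ} {o d : ℕ}
    (hf : ∀ x, o < x → x < o + leavesList ts → f x = x + d) :
    (toCList ts o).map (CTree.rename f) = toCList ts (o + d) := by
  induction ts generalizing o with
  | nil => rfl
  | cons t ts ih =>
    rw [List.forall_mem_cons] at h
    rw [leavesList] at hf
    have key := ih h.2 (o := o + leaves t) fun x h1 h2 => hf x (by omega) (by omega)
    cases t with
    | leaf =>
      rw [toCList_cons_leaf, toCList_cons_leaf, add_right_comm]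
      exact key
    | node us =>
      rw [toCList_cons (by simp), toCList_cons (by simp), List.map_cons, key, add_right_comm,
        rename_toC h.1 (by simp) fun x h1 h2 => hf x h1 (by omega)]

theorem represents_toCList (h : ∀ t ∈ ts, t.IsReduced) {n o : ℕ} (ho : 1 ≤ o)
    (hn : o + leavesList ts ≤ n + 1) :
    List.Forall₂ (Represents n) (toCList ts o) (toCList ts o) := by
  rw [List.forall₂_same, toCList_eq_map]
  intro c hc
  obtain ⟨p, hp, rfl⟩ := List.mem_map.1 hc
  obtain ⟨h1, h2, h3⟩ := reduced_of_mem_kids h hp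
  have h4 := leavesList_bound_of_mem_kids h hp
  exact represents_toC h1 h2 (by omega) (by omega)

theorem span_supp_toC {t : PTree} (ht : t.IsReduced) (hl : t ≠ .leaf) {n o : ℕ} (ho : 1 ≤ o)
    (hn : o + leaves t ≤ n + 1) :
    (OTree.lin n).span (toC t o).supp = Finset.Icc o (o + leaves t - 1) := by
  have := ht.two_le_leaves hl
  rw [supp_toC ht hl, OTree.span_lin_Icc ho (by omega) (by omega)]

theorem graftList_of_notMem (T : OTree) (i : ℕ) (f : ℕ → ℕ) (D : CTree) (cs : List CTree)
    (h : ∀ c ∈ cs, i ∉ T.span c.supp) :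
    CTree.graftList T i f D cs = cs.map (CTree.rename f) ++ [D] := by
  induction cs with
  | nil => simp [CTree.graftList]
  | cons c cs ih =>
    rw [List.forall_mem_cons] at h
    rw [CTree.graftList, if_neg h.1, ih h.2]
    rfl

section bullet

variable {s : PTree} {m i : ℕ} {f : ℕ → ℕ}

/-- With leaves numbered from `o`, the leaf with label `i` is the one in position `i + 1 - o`. First
leaves up to `i` stay in place; later ones move by `leaves s - 1`. -/
theorem starts_graftList (h : ∀ t ∈ ts, t.IsReduced)
    (hf : ∀ e, f e = if e ≤ i then e else e + leaves s - 1) (hs : s.IsReduced) {o : ℕ}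
    (ho : o ≤ i) (hi : i < o + leavesList ts) :
    starts (graftList (i + 1 - o) s ts) o = (starts ts o).map f := by
  have hs1 := hs.one_le_leaves
  induction ts generalizing o with
  | nil => simp [starts]
  | cons t ts ih =>
    rw [List.forall_mem_cons] at h
    have h1 := h.1.one_le_leaves
    rw [leavesList] at hi
    rw [graftList_cons]
    split_ifs with hit
    · have h2 := leaves_graft s t (i := i + 1 - o) (by omega) hit
      rw [starts, starts, List.map_cons, hf o, if_pos ho,
        show o + (graft (i + 1 - o) s t).leaves = o + leaves t + (leaves s - 1) by omega,
        starts_add]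
      congr 1
      refine List.map_congr_left fun x hx => ?_
      have := bounds_of_mem_starts h.2 hx
      rw [hf, if_neg (by omega)]
      omega
    · rw [starts, starts, List.map_cons, hf o, if_pos ho,
        show i + 1 - o - leaves t = i + 1 - (o + leaves t) by omega,
        ih h.2 (by omega) (by omega)]

/-- The subtrees on the left of the leaf `i` are unchanged and those on the right are translated.
The subtree at `i` either is a leaf and becomes `s`, or is treated by the hypothesis `IH`. -/
theorem represents_graftList (hs : s.IsReduced) (hs' : s ≠ .leaf)
    (hf : ∀ e, f e = if e ≤ i then e else e + leaves s - 1) (h : ∀ t ∈ ts, t.IsReduced)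
    (IH : ∀ t ∈ ts, ∀ o, t.IsReduced → t ≠ .leaf → 1 ≤ o → o ≤ i → i < o + leaves t →
      o + leaves t ≤ m + 1 → Represents (m + leaves s - 1)
        (CTree.graft (OTree.lin m) i f (toC s i) (toC t o)) (toC (graft (i + 1 - o) s t) o)) {o : ℕ}
    (ho : 1 ≤ o) (hoi : o ≤ i) (hi : i < o + leavesList ts) (hm : o + leavesList ts ≤ m + 1) :
    ∃ cs, (CTree.graftList (OTree.lin m) i f (toC s i) (toCList ts o)).Perm cs ∧
      List.Forall₂ (Represents (m + leaves s - 1)) cs (toCList (graftList (i + 1 - o) s ts) o) := by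
  have hs1 := hs.two_le_leaves hs'
  induction ts generalizing o with
  | nil => simp [leavesList] at hi; omega
  | cons t ts ih =>
    rw [List.forall_mem_cons] at h IH
    have h1 := h.1.one_le_leaves
    rw [leavesList] at hi hm
    have hren : i < o + leaves t → (toCList ts (o + leaves t)).map (CTree.rename f) =
        toCList ts (o + leaves t + (leaves s - 1)) := fun hio =>
      map_rename_toCList h.2 fun x h1 h2 => by rw [hf, if_neg (by omega)]; omega
    have hrep : List.Forall₂ (Represents (m + leaves s - 1))
        (toCList ts (o + leaves t + (leaves s - 1))) (toCList ts (o + leaves t + (leaves s - 1))) :=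
      represents_toCList h.2 (by omega) (by omega)
    by_cases hio : i < o + leaves t
    · have h2 := leaves_graft s t (i := i + 1 - o) (by omega) (by omega)
      rw [graftList_cons, if_pos (by omega)]
      cases t with
      | leaf =>
        rw [leaves] at hio
        obtain rfl : i = o := by omega
        rw [toCList_cons_leaf, graftList_of_notMem, graft_leaf, toCList_cons hs']
        -- No child contains the vertex `i`, so `graftList` appends the new construct at the end; in
        -- the planar tree it comes first among the remaining subtrees.
        · refine ⟨_, List.perm_append_singleton _ _, ?_⟩
          rw [show i + leaves s = i + leaves .leaf + (leaves s - 1) by rw [leaves]; omega]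
          refine List.Forall₂.cons (represents_toC hs hs' ho (by omega)) ?_
          rw [← hren (by rw [leaves]; omega)] at hrep ⊢
          rwa [leaves] at hrep ⊢
        · intro c hc
          rw [toCList_eq_map] at hc
          obtain ⟨p, hp, rfl⟩ := List.mem_map.1 hc
          obtain ⟨h5, h6, h7⟩ := reduced_of_mem_kids h.2 hp
          have h4 := leavesList_bound_of_mem_kids h.2 hp
          rw [leaves] at hm
          rw [span_supp_toC h5 h6 (by omega) (by omega), Finset.mem_Icc]
          omega
      | node us =>
        rw [toCList_cons (by simp), CTree.graftList, if_pos, toCList_cons (by simp)]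
        · refine ⟨_, List.Perm.refl _, List.Forall₂.cons ?_ ?_⟩
          · exact IH.1 o h.1 (by simp) ho hoi hio (by omega)
          · rw [CTree.renameList_eq_map, hren hio]
            rwa [show o + leaves (graft (i + 1 - o) s (node us)) =
              o + leaves (node us) + (leaves s - 1) by omega]
        · rw [span_supp_toC h.1 (by simp) ho (by omega), Finset.mem_Icc]
          omega
    · rw [graftList_cons, if_neg (by omega),
        show i + 1 - o - leaves t = i + 1 - (o + leaves t) by omega]
      obtain ⟨cs, h2, h3⟩ := ih h.2 IH.2 (o := o + leaves t) (by omega) (by omega) (by omega)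
        (by omega)
      cases t with
      | leaf => rw [toCList_cons_leaf, toCList_cons_leaf]; exact ⟨cs, h2, h3⟩
      | node us =>
        rw [toCList_cons (by simp), toCList_cons (by simp), CTree.graftList, if_neg]
        · refine ⟨_, h2.cons _, List.Forall₂.cons ?_ h3⟩
          rw [rename_toC h.1 (by simp) (d := 0)]
          · exact represents_toC h.1 (by simp) ho (by omega)
          · intro x hx1 hx2
            rw [hf, if_pos (by omega), add_zero]
        · rw [span_supp_toC h.1 (by simp) ho (by omega), Finset.mem_Icc]
          omega

theorem represents_graft (hs : s.IsReduced) (hs' : s ≠ .leaf)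
    (hf : ∀ e, f e = if e ≤ i then e else e + leaves s - 1) (t : PTree) : ∀ o, t.IsReduced →
    t ≠ .leaf → 1 ≤ o → o ≤ i → i < o + leaves t → o + leaves t ≤ m + 1 →
    Represents (m + leaves s - 1) (CTree.graft (OTree.lin m) i f (toC s i) (toC t o))
      (toC (graft (i + 1 - o) s t) o) := by
  have hs1 := hs.two_le_leaves hs'
  induction t using forall_of_node with
  | leaf => exact fun o _ h => absurd rfl h
  | node ts ih =>
    intro o ht hl ho hoi hi hm
    have hg := isReduced_graft hs (i + 1 - o) ht
    have hlg := leaves_graft s (node ts) (i := i + 1 - o) (by omega) (by omega)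
    rw [graft_node] at hg hlg ⊢
    rw [isReduced_node_iff] at ht hg
    rw [leaves] at hi hm
    rw [leaves, leaves] at hlg
    obtain ⟨cs, h1, h2⟩ := represents_graftList hs hs' hf ht.2 ih ho hoi hi hm
    rw [toC, toC, CTree.graft]
    refine represents_node hg.2 ho (by omega) h1 h2 ?_
    have hinj : Function.Injective f := by
      intro x y hxy
      rw [hf, hf] at hxy
      split_ifs at hxy <;> omega
    rw [cuts, cuts, starts_graftList ht.2 hf hs hoi hi, Finset.image_erase hinj, hf o, if_pos hoi]
    congr 1
    ext x
    simp

/-- Under the correspondence between planar trees and constructs, the composition of constructs is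
grafting. -/
theorem bullet_toC {s t : PTree} {i : ℕ} (hs : s.IsReduced) (hs' : s ≠ .leaf) (ht : t.IsReduced)
    (ht' : t ≠ .leaf) (hi : 1 ≤ i) (hit : i ≤ leaves t) :
    CTree.bullet (OTree.lin (leaves t)) (toC t 1) i (OTree.lin (leaves s)) (toC s 1) =
      toC (graft i s t) 1 := by
  have hs1 := hs.two_le_leaves hs'
  rw [CTree.bullet, OTree.subst_lin hi hit (by omega), rename_toC hs hs' (d := i - 1),
    show 1 + (i - 1) = i by omega]
  · have := (represents_graft (m := leaves t) hs hs' (OTree.edgeName_lin hi (by omega)) t 1 ht ht'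
      le_rfl hi (by omega) (by omega)).2
    rwa [Nat.add_sub_cancel] at this
  · intro x _ _
    rw [OTree.inner]
    omega

end bullet

end PTree
end OInfinity
-- Comparison of the sign conventions.
namespace OInfinity

theorem negOnePow_eq_of_zmod {a b : ℤ} (h : (a : ZMod 2) = b) : a.negOnePow = b.negOnePow := by
  rw [Int.negOnePow_eq_iff, ← ZMod.intCast_eq_zero_iff_even]
  push_cast
  rw [h, sub_self]

namespace PTree

mutual
/-- The exponent of the sign relating the orders in which the vertices of a planar tree, and the
edges and leaves of the corresponding tree `α`, are read: every vertex is moved past the siblings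
on the right of its ancestors. -/
def shift : PTree → ℤ
  | leaf => 0
  | node ts => shiftList ts
def shiftList : List PTree → ℤ
  | [] => 0
  | t :: ts => shift t + degree t * ts.length + shiftList ts
end

/-- A vertex with `n` inputs accounts for `n` edges or leaves above it, and its degree is `n - 2`;
the extra one is the root. -/
theorem size_toA (t : PTree) : ∀ o, (((toA t o).size : ℕ) : ZMod 2) = (degree t : ℤ) + 1 := by
  induction t using forall_of_node with
  | leaf => simp [toA, ATree.size]
  | node ts ih =>
    intro o
    have key : ∀ o, ((ATree.sizeList (toAList ts o) : ℕ) : ZMod 2) =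
        (degreeList ts : ℤ) + (ts.length : ℕ) := by
      induction ts with
      | nil => simp [toAList, ATree.sizeList]
      | cons t ts ih' =>
        rw [List.forall_mem_cons] at ih
        intro o
        rw [toAList, ATree.sizeList, degreeList_cons, List.length_cons]
        push_cast
        rw [ih.1, ih' ih.2]
        ring
    rw [toA, ATree.size, degree_node]
    push_cast
    rw [key]
    grind

theorem sizeList_toAList (ts : List PTree) (o : ℕ) : ((ATree.sizeList (toAList ts o) : ℕ) : ZMod 2) =
    (degreeList ts : ℤ) + (ts.length : ℕ) := by
  induction ts generalizing o with
  | nil => simp [toAList, ATree.sizeList]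
  | cons t ts ih =>
    rw [toAList, ATree.sizeList, degreeList_cons, List.length_cons]
    push_cast
    rw [size_toA, ih]
    ring

theorem mem_leaves_toA {i : ℕ} (t : PTree) : ∀ o, i ∈ (toA t o).leaves ↔ o ≤ i ∧ i < o + leaves t := by
  induction t using forall_of_node with
  | leaf => intro o; simp [toA, ATree.leaves]; omega
  | node ts ih =>
    intro o
    rw [toA, ATree.leaves, leaves]
    induction ts generalizing o with
    | nil => simp [toAList, ATree.leavesList]
    | cons t ts ih' =>
      rw [List.forall_mem_cons] at ih
      rw [toAList, ATree.leavesList, List.mem_append, ih.1, ih' ih.2, leavesList]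
      omega

/-- The sign `shift` compares the two conventions for compositions: `A_∞` weighs `|s|` by the degree
read after the leaf `i`, `O_∞` by the number of edges and leaves on its right. Inserting `s` into a
subtree changes `shift` by `|s|` times the number of later siblings; their sizes are this number
plus their degrees modulo two. -/
theorem shift_graft (s : PTree) (i : ℕ) (t : PTree) : ∀ o, o ≤ i → i < o + leaves t →
    ((shift (graft (i + 1 - o) s t) : ℤ) : ZMod 2) = (shift t : ℤ) + (shift s : ℤ) +
      (degree s : ℤ) * ((degreeAfter (i + 1 - o) t : ℤ) + ((toA t o).right i : ℕ)) := by
  induction t using forall_of_node with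
  | leaf => intro o _ _; simp [shift, toA, ATree.right]
  | node ts ih =>
    intro o ho hi
    rw [graft_node, shift, shift, degreeAfter_node, toA, ATree.right]
    rw [leaves] at hi
    induction ts generalizing o with
    | nil => simp [leavesList] at hi; omega
    | cons t ts ih' =>
      rw [List.forall_mem_cons] at ih
      rw [leavesList] at hi
      rw [graftList_cons, degreeAfterList_cons, toAList, ATree.rightList]
      by_cases hit : i < o + leaves t
      · have h1 := ih.1 o ho hit
        have h2 := degree_graft s t (i := i + 1 - o) (by omega) (by omega)
        rw [if_pos (by omega), if_pos (by omega), if_pos ((mem_leaves_toA t o).2 ⟨ho, hit⟩),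
          shiftList, shiftList, h2]
        push_cast
        rw [h1, sizeList_toAList]
        grind
      · rw [if_neg (by omega), if_neg (by omega), if_neg (fun h => hit ((mem_leaves_toA t o).1 h).2),
          shiftList, shiftList, length_graftList,
          show i + 1 - o - leaves t = i + 1 - (o + leaves t) by omega]
        push_cast
        rw [ih' ih.2 _ (by omega) (by omega)]
        grind

mutual
/-- The number of vertices. -/
def nodeCount : PTree → ℕ
  | leaf => 0
  | node ts => 1 + nodeCountList ts
def nodeCountList : List PTree → ℕ
  | [] => 0
  | t :: ts => nodeCount t + nodeCountList ts
end

/-- Both sides count the gaps between leaves, since a vertex with `n` inputs separates them by `n -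
1` gaps. It identifies the grading by `n - 2` with the grading of constructs. -/
theorem degree_add_nodeCount (t : PTree) : degree t + nodeCount t = leaves t - 1 := by
  induction t using forall_of_node with
  | leaf => simp [nodeCount]
  | node ts ih =>
    have key : degreeList ts + nodeCountList ts = leavesList ts - ts.length := by
      induction ts with
      | nil => simp [nodeCountList]
      | cons t ts ih' =>
        rw [List.forall_mem_cons] at ih
        have h1 := ih' ih.2
        have h2 := ih.1
        rw [degreeList_cons, nodeCountList, leavesList, List.length_cons]
        push_cast
        linarith
    rw [degree_node, nodeCount, leaves]
    push_cast
    linarith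

theorem length_verts_toC {t : PTree} (ht : t ≠ .leaf) : ∀ o, (toC t o).verts.length = nodeCount t := by
  induction t using forall_of_node with
  | leaf => exact absurd rfl ht
  | node ts ih =>
    intro o
    rw [toC, CTree.verts, nodeCount, List.length_cons, add_comm]
    congr 1
    clear ht
    induction ts generalizing o with
    | nil => simp [CTree.vertsList, nodeCountList]
    | cons t ts ih' =>
      rw [List.forall_mem_cons] at ih
      cases t with
      | leaf => rw [toCList_cons_leaf, nodeCountList, nodeCount, zero_add, ih' ih.2]
      | node us =>
        rw [toCList_cons (by simp), CTree.vertsList, List.length_append, nodeCountList,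
          ih.1 (by simp), ih' ih.2]

/-- The degree of a construct of the edge-graph of a linear tree. -/
theorem edges_sub_verts_toC {t : PTree} (ht : t ≠ .leaf) (hl : 1 ≤ leaves t) :
    ((OTree.lin (leaves t)).edges.length : ℤ) - ((toC t 1).verts.length : ℤ) = degree t := by
  have := degree_add_nodeCount t
  rw [length_verts_toC ht, OTree.edges_lin, List.length_map, List.length_range']
  omega

end PTree
end OInfinity
-- Splittings of the vertices of a construct as intervals of gaps.
namespace OInfinity

/-- `Y` is a non-empty proper subset of `W`, consisting of consecutive elements. -/
structure IsInterval (W Y : Finset ℕ) : Prop where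
  subset : Y ⊆ W
  nonempty : Y.Nonempty
  compl_nonempty : (W \ Y).Nonempty
  convex : ∀ a ∈ Y, ∀ c ∈ Y, ∀ b ∈ W, a < b → b < c → b ∈ Y

namespace Hypergraph

theorem components_restrict_empty (H : Hypergraph) : (H.restrict ∅).components = ∅ := by
  refine Finset.eq_empty_of_forall_notMem fun K hK => ?_
  have h1 := nonempty_of_mem_components hK
  have h2 : K ⊆ ∅ := (mem_components.1 hK).1
  exact h1.ne_empty (Finset.subset_empty.1 h2)

theorem components_restrict_eq_singleton_iff {H : Hypergraph} {Y : Finset ℕ} :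
    (H.restrict Y).components = {Y} ↔ (H.restrict Y).IsConnected := by
  constructor
  · intro h
    have : Y ∈ (H.restrict Y).components := by rw [h]; simp
    have := (mem_components.1 this).2.1
    rwa [restrict_restrict subset_rfl] at this
  · intro h
    refine components_eq (fun K hK => ?_) fun v hv => ⟨Y, Finset.mem_singleton_self Y, hv⟩
    obtain rfl := Finset.mem_singleton.1 hK
    refine mem_components.2 ⟨subset_rfl, ?_, fun Z hZ => .inl (Finset.mem_filter.1 hZ).2⟩
    rwa [restrict_restrict subset_rfl]

/-- For `X{Y}` to be a construct, `Y` must be the only component of the complement of `X`; in a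
path, connected means convex. -/
theorem isConstruct_pair_iff {W Y : Finset ℕ} (hY : Y ⊆ W) :
    CTree.IsConstruct (pathGraph W) (.node (W \ Y) [.node Y []]) ↔ IsInterval W Y := by
  have hsub : W \ (W \ Y) = Y := by
    rw [sdiff_sdiff_right_self]; exact Finset.inter_eq_right.2 hY
  have hsupp : (CTree.node Y []).supp = Y := by rw [CTree.supp_node]; simp
  have hcomp : (([CTree.node Y []].map CTree.supp : List (Finset ℕ)) : Multiset (Finset ℕ)) =
      ((pathGraph W).restrict ((pathGraph W).verts \ (W \ Y))).components.val ↔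
        ((pathGraph W).restrict Y).IsConnected := by
    change _ = ((pathGraph W).restrict (W \ (W \ Y))).components.val ↔ _
    rw [hsub, ← components_restrict_eq_singleton_iff, List.map_singleton, hsupp, eq_comm,
      ← Finset.val_inj]
    rfl
  constructor
  · rintro ⟨-, -, -, hX, -, hc, hcs⟩
    obtain ⟨h1, h2⟩ := (isConnected_pathGraph_restrict hY).1 (hcomp.1 hc)
    exact ⟨hY, h1, hX, h2⟩
  · rintro ⟨-, h2, h3, h4⟩
    refine .node _ _ _ h3 Finset.sdiff_subset
      (hcomp.2 ((isConnected_pathGraph_restrict hY).2 ⟨h2, h4⟩)) ?_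
    simp only [List.mem_singleton, forall_eq, hsupp]
    refine .node _ _ _ h2 subset_rfl ?_ (by simp)
    rw [restrict_compl, sdiff_self]
    exact (congrArg Finset.val (components_restrict_empty _)).symm

end Hypergraph

/-- Passes from convexity to positions, which is how the differential of `A_∞` is indexed. -/
theorem exists_drop_take_iff {l : List ℕ} (hl : l.Pairwise (· < ·)) {Y : Finset ℕ} :
    IsInterval l.toFinset Y ↔
      ∃ p k, 1 ≤ k ∧ k < l.length ∧ p + k ≤ l.length ∧ Y = ((l.drop p).take k).toFinset := by
  constructor
  · rintro ⟨h1, h2, ⟨w, hw⟩, h4⟩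
    have hmem : ∀ z, z ∈ Y ↔ z ∈ l ∧ Y.min' h2 ≤ z ∧ z ≤ Y.max' h2 := by
      intro z
      constructor
      · exact fun h => ⟨List.mem_toFinset.1 (h1 h), Finset.min'_le _ _ h, Finset.le_max' _ _ h⟩
      · rintro ⟨h5, h6, h7⟩
        rcases h6.eq_or_lt with h6 | h6
        · rw [← h6]; exact Finset.min'_mem _ _
        rcases h7.eq_or_lt with h7 | h7
        · rw [h7]; exact Finset.max'_mem _ _
        exact h4 _ (Finset.min'_mem _ h2) _ (Finset.max'_mem _ h2) z (List.mem_toFinset.2 h5) h6 h7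
    have hle : Y.min' h2 ≤ Y.max' h2 := Finset.min'_le _ _ (Finset.max'_mem _ _)
    generalize Y.min' h2 = a at *
    generalize Y.max' h2 = c at *
    -- With `a` and `c` the least and greatest elements of `Y`, the list falls into the parts below,
    -- in and above `Y`.
    have hsplit : l = l.filter (· < a) ++ (l.filter (fun z => a ≤ z ∧ z ≤ c) ++ l.filter (c < ·)) := by
      refine PTree.eq_of_pairwise_lt hl ?_ fun z => ?_
      · simp only [List.pairwise_append, List.mem_filter, List.mem_append, decide_eq_true_eq]
        refine ⟨hl.sublist List.filter_sublist, ⟨hl.sublist List.filter_sublist,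
          hl.sublist List.filter_sublist, ?_⟩, ?_⟩
        · rintro x ⟨_, hx⟩ y ⟨_, hy⟩; omega
        · rintro x ⟨_, hx⟩ y (⟨_, hy⟩ | ⟨_, hy⟩) <;> omega
      · simp only [List.mem_filter, List.mem_append, decide_eq_true_eq]
        by_cases hz : z ∈ l
        · simp only [hz, true_and, true_iff]; omega
        · simp [hz]
    have hY : Y = (l.filter (fun z => a ≤ z ∧ z ≤ c)).toFinset := by
      ext z
      rw [hmem z, List.mem_toFinset, List.mem_filter, decide_eq_true_eq]
    refine ⟨(l.filter (· < a)).length, (l.filter (fun z => a ≤ z ∧ z ≤ c)).length, ?_, ?_, ?_, ?_⟩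
    · obtain ⟨y, hy⟩ := h2
      rw [hY, List.mem_toFinset] at hy
      exact List.length_pos_of_mem hy
    · refine lt_of_le_of_ne (List.length_filter_le _ _) fun h => ?_
      rw [List.length_filter_eq_length_iff] at h
      rw [Finset.mem_sdiff, List.mem_toFinset] at hw
      exact hw.2 ((hmem w).2 ⟨hw.1, by simpa using h w hw.1⟩)
    · have := congrArg List.length hsplit
      rw [List.length_append, List.length_append] at this
      omega
    · generalize l.filter (· < a) = A at hsplit ⊢
      generalize l.filter (fun z => a ≤ z ∧ z ≤ c) = B at hsplit hY ⊢
      rw [hsplit, List.drop_left, List.take_left]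
      exact hY
  · rintro ⟨p, k, h1, h2, h3, rfl⟩
    obtain ⟨A, B, C, rfl, rfl, rfl⟩ : ∃ A B C : List ℕ, l = A ++ (B ++ C) ∧ A.length = p ∧
        B.length = k :=
      ⟨l.take p, (l.drop p).take k, (l.drop p).drop k, by simp, by simp; omega, by simp; omega⟩
    rw [List.drop_left, List.take_left]
    simp only [List.pairwise_append, List.mem_append] at hl
    obtain ⟨h4, ⟨h5, h6, h7⟩, h8⟩ := hl
    have hB : ∀ x ∈ B, x ∉ A ∧ x ∉ C := fun x hx =>
      ⟨fun h => (h8 x h x (.inl hx)).ne rfl, fun h => (h7 x hx x h).ne rfl⟩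
    refine ⟨?_, ?_, ?_, ?_⟩
    · intro x hx
      rw [List.mem_toFinset] at hx
      simp [hx]
    · obtain ⟨x, hx⟩ := List.exists_mem_of_length_pos h1
      exact ⟨x, List.mem_toFinset.2 hx⟩
    · rw [List.length_append, List.length_append] at h2
      obtain ⟨x, hx⟩ := List.exists_mem_of_length_pos (l := A ++ C) (by rw [List.length_append]; omega)
      rw [List.mem_append] at hx
      refine ⟨x, ?_⟩
      rw [Finset.mem_sdiff, List.mem_toFinset, List.mem_toFinset, List.mem_append, List.mem_append]
      exact ⟨by tauto, fun h => by have := hB x h; tauto⟩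
    · intro a ha c hc b hb hab hbc
      rw [List.mem_toFinset, List.mem_append, List.mem_append] at hb
      rw [List.mem_toFinset] at *
      rcases hb with hb | hb | hb
      · have := h8 b hb a (.inl ha); omega
      · exact hb
      · have := h7 c hc b hb; omega

namespace PTree

/-- The pairs of sets that index the splittings of the root of the construct `toC (node ts) o`. -/
def rootSplits (ts : List PTree) (o : ℕ) : List (Finset ℕ × Finset ℕ) :=
  (splitIndex ts.length).map fun pq =>
    (cuts ts o, (((starts ts o).tail.drop pq.1).take (pq.2 - 1)).toFinset)

mutual
/-- The pairs `(W, Y)` such that the vertex `W` of the construct `toC t o` can be split into the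
edge `(W ∖ Y){Y}`. -/
def splits : PTree → ℕ → List (Finset ℕ × Finset ℕ)
  | leaf, _ => []
  | node ts, o => rootSplits ts o ++ splitsList ts o
def splitsList : List PTree → ℕ → List (Finset ℕ × Finset ℕ)
  | [], _ => []
  | t :: ts, o => splits t o ++ splitsList ts (o + leaves t)
end

variable {ts : List PTree}

theorem cuts_eq (h : ∀ t ∈ ts, t.IsReduced) (o : ℕ) :
    cuts ts o = (starts ts o).tail.toFinset := by
  cases ts with
  | nil => rfl
  | cons t ts =>
    have := pairwise_starts h o
    rw [starts, List.pairwise_cons] at this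
    ext x
    rw [mem_cuts, starts, List.tail_cons, List.mem_cons, List.mem_toFinset]
    constructor
    · tauto
    · intro hx
      exact ⟨(this.1 x hx).ne', .inr hx⟩

/-- A block of `q` consecutive inputs corresponds to the `q - 1` gaps between them. So `2 ≤ q < n`
says that the interval is non-empty and proper in the `n - 1` gaps of the root. -/
theorem mem_rootSplits (h : (node ts).IsReduced) {o : ℕ} {W Y : Finset ℕ} :
    (W, Y) ∈ rootSplits ts o ↔ W = cuts ts o ∧ IsInterval W Y := by
  rw [isReduced_node_iff] at h
  have hlen : (starts ts o).tail.length = ts.length - 1 := by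
    rw [List.length_tail, length_starts]
  have key := exists_drop_take_iff (l := (starts ts o).tail) (Y := Y)
    ((pairwise_starts h.2 o).sublist (List.tail_sublist _))
  rw [← cuts_eq h.2, hlen] at key
  simp only [rootSplits, List.mem_map, Prod.exists, mem_splitIndex, Prod.mk.injEq]
  constructor
  · rintro ⟨p, q, h1, rfl, hY⟩
    exact ⟨rfl, key.2 ⟨p, q - 1, by omega, by omega, by omega, hY.symm⟩⟩
  · rintro ⟨rfl, hY⟩
    obtain ⟨p, k, h1, h2, h3, h4⟩ := key.1 hY
    exact ⟨p, k + 1, by clear key; omega, rfl, by rw [Nat.add_sub_cancel]; exact h4.symm⟩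

/-- A non-empty block of an increasing list determines its length and its first element, hence `q`
and `p`. -/
theorem nodup_rootSplits (h : (node ts).IsReduced) (o : ℕ) : (rootSplits ts o).Nodup := by
  rw [isReduced_node_iff] at h
  refine (List.nodup_map_iff_inj_on (nodup_splitIndex _)).2 ?_
  rintro ⟨p, q⟩ hpq ⟨p', q'⟩ hpq' heq
  rw [mem_splitIndex] at hpq hpq'
  rw [Prod.mk.injEq] at heq
  replace heq := heq.2
  have hlen : (starts ts o).tail.length = ts.length - 1 := by
    rw [List.length_tail, length_starts]
  have hp := (pairwise_starts h.2 o).sublist (List.tail_sublist _)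
  generalize (starts ts o).tail = l at *
  have hsub : ∀ p q, ((l.drop p).take q).Sublist l := fun p q =>
    (List.take_sublist _ _).trans (List.drop_sublist _ _)
  have heq' : (l.drop p).take (q - 1) = (l.drop p').take (q' - 1) :=
    eq_of_pairwise_lt (hp.sublist (hsub _ _)) (hp.sublist (hsub _ _)) fun x => by
      rw [← List.mem_toFinset, ← List.mem_toFinset]
      exact Finset.ext_iff.1 heq x
  have h1 := congrArg List.length heq'
  simp only [List.length_take, List.length_drop] at h1
  have h2 := congrArg (fun l => l[0]?) heq'
  simp only [List.getElem?_take, List.getElem?_drop, add_zero] at h2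
  rw [if_pos (by omega), if_pos (by omega)] at h2
  have h3 := (List.getElem?_inj (by omega) (hp.imp fun h => h.ne)).1 h2
  simp only [Prod.mk.injEq]
  omega

theorem subset_supp_of_mem_verts {C : CTree} {W : Finset ℕ} (h : W ∈ C.verts) : W ⊆ C.supp := by
  rw [CTree.supp]
  generalize C.verts = l at *
  induction l with
  | nil => simp at h
  | cons X l ih =>
    rcases List.mem_cons.1 h with rfl | h
    · exact Finset.subset_union_left
    · exact (ih h).trans Finset.subset_union_right

theorem subset_suppList_of_mem_vertsList {cs : List CTree} {W : Finset ℕ}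
    (h : W ∈ CTree.vertsList cs) : W ⊆ CTree.suppList cs := by
  induction cs with
  | nil => simp [CTree.vertsList] at h
  | cons c cs ih =>
    rw [CTree.vertsList, List.mem_append] at h
    rw [CTree.suppList_cons]
    rcases h with h | h
    · exact (subset_supp_of_mem_verts h).trans Finset.subset_union_left
    · exact (ih h).trans Finset.subset_union_right

theorem bounds_of_mem_verts {t : PTree} (ht : t.IsReduced) {o : ℕ} {W : Finset ℕ}
    (hW : W ∈ (toC t o).verts) {x : ℕ} (hx : x ∈ W) : o < x ∧ x < o + leaves t := by
  by_cases hl : t = leaf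
  · subst hl
    simp only [toC, CTree.verts, CTree.vertsList, List.mem_singleton] at hW
    subst hW
    simp at hx
  · have := subset_supp_of_mem_verts hW hx
    rw [supp_toC ht hl, Finset.mem_Icc] at this
    omega

theorem bounds_of_mem_vertsList (h : ∀ t ∈ ts, t.IsReduced) {o : ℕ} {W : Finset ℕ}
    (hW : W ∈ CTree.vertsList (toCList ts o)) {x : ℕ} (hx : x ∈ W) :
    o ≤ x ∧ x < o + leavesList ts ∧ x ∉ starts ts o :=
  (mem_suppList_toCList h).1 (subset_suppList_of_mem_vertsList hW hx)

theorem mem_splits {W Y : Finset ℕ} {t : PTree} (ht : t.IsReduced) :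
    ∀ o, (W, Y) ∈ splits t o ↔ W ∈ (toC t o).verts ∧ IsInterval W Y := by
  induction t using forall_of_node with
  | leaf =>
    intro o
    simp only [splits, toC, CTree.verts, CTree.vertsList, List.mem_singleton, List.not_mem_nil,
      false_iff, not_and]
    rintro rfl ⟨-, -, ⟨x, hx⟩, -⟩
    simp at hx
  | node ts ih =>
    intro o
    rw [splits, List.mem_append, mem_rootSplits ht, toC, CTree.verts, List.mem_cons, or_and_right]
    refine or_congr_right ?_
    rw [isReduced_node_iff] at ht
    replace ht := ht.2
    induction ts generalizing o with
    | nil => simp [splitsList, CTree.vertsList]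
    | cons t ts ih' =>
      rw [List.forall_mem_cons] at ht ih
      have key : (W, Y) ∈ splitsList ts (o + leaves t) ↔ _ := ih' ih.2 (o + leaves t) ht.2
      rw [splitsList, List.mem_append, ih.1 ht.1, key]
      cases t with
      | leaf =>
        rw [toCList_cons_leaf, leaves]
        refine ⟨Or.rec ?_ id, .inr⟩
        simp only [toC, CTree.verts, CTree.vertsList, List.mem_singleton]
        rintro ⟨rfl, -, -, ⟨x, hx⟩, -⟩
        simp at hx
      | node us =>
        rw [toCList_cons (by simp), CTree.vertsList, List.mem_append, or_and_right]

theorem mem_splitsList (ht : ∀ t ∈ ts, t.IsReduced) {W Y : Finset ℕ} {o : ℕ}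
    (h : (W, Y) ∈ splitsList ts o) :
    W ∈ CTree.vertsList (toCList ts o) ∧ IsInterval W Y := by
  induction ts generalizing o with
  | nil => simp [splitsList] at h
  | cons t ts ih =>
    rw [List.forall_mem_cons] at ht
    rw [splitsList, List.mem_append, mem_splits ht.1] at h
    cases t with
    | leaf =>
      rw [toCList_cons_leaf]
      rcases h with h | h
      · obtain ⟨h, -, -, ⟨x, hx⟩, -⟩ := h
        simp only [toC, CTree.verts, CTree.vertsList, List.mem_singleton] at h
        simp [h] at hx
      · exact ih ht.2 h
    | node us =>
      rw [toCList_cons (by simp), CTree.vertsList, List.mem_append]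
      rcases h with h | h
      · exact ⟨.inl h.1, h.2⟩
      · have := ih ht.2 h
        exact ⟨.inr this.1, this.2⟩

/-- Distinct vertices have disjoint decorations and `Y` is non-empty, so a splitting determines its
vertex. This allows the sum over the list to be read as the sum over a finite set in `OInfD`. -/
theorem nodup_splits {t : PTree} (ht : t.IsReduced) : ∀ o, (splits t o).Nodup := by
  induction t using forall_of_node with
  | leaf => simp [splits]
  | node ts ih =>
    intro o
    have h' := (isReduced_node_iff ts).1 ht
    rw [splits, List.nodup_append']
    refine ⟨nodup_rootSplits ht o, ?_, ?_⟩
    · replace h' := h'.2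
      clear ht
      induction ts generalizing o with
      | nil => simp [splitsList]
      | cons t ts ih' =>
        rw [List.forall_mem_cons] at h' ih
        rw [splitsList, List.nodup_append']
        refine ⟨ih.1 h'.1 o, ih' ih.2 _ h'.2, ?_⟩
        rintro ⟨W, Y⟩ h1 h2
        rw [mem_splits h'.1] at h1
        have h3 := mem_splitsList h'.2 h2
        obtain ⟨x, hx⟩ := h1.2.nonempty
        have h4 := bounds_of_mem_verts h'.1 h1.1 (h1.2.subset hx)
        have h5 := bounds_of_mem_vertsList h'.2 h3.1 (h1.2.subset hx)
        omega
    · rintro ⟨W, Y⟩ h1 h2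
      rw [mem_rootSplits ht] at h1
      have h3 := mem_splitsList h'.2 h2
      obtain ⟨x, hx⟩ := h1.2.nonempty
      have h4 := h1.2.subset hx
      have h5 := bounds_of_mem_vertsList h'.2 h3.1 h4
      rw [h1.1, mem_cuts] at h4
      exact h5.2.2 h4.2

end PTree
end OInfinity
-- Matching the terms of the two differentials.
namespace OInfinity

namespace PTree

variable {ts : List PTree}

theorem nodesList_toAList_iff (h : ∀ t ∈ ts, ∀ (X : Finset ℕ) (o : ℕ), X.Nonempty →
      (X ∈ (toA t o).nodes ↔ X ∈ (toC t o).verts)) {X : Finset ℕ} (o : ℕ) (hX : X.Nonempty) :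
    X ∈ ATree.nodesList (toAList ts o) ↔ X ∈ CTree.vertsList (toCList ts o) := by
  induction ts generalizing o with
  | nil => simp [toAList, ATree.nodesList, CTree.vertsList]
  | cons t ts ih =>
    rw [List.forall_mem_cons] at h
    have key := ih h.2 (o + leaves t)
    rw [toAList, ATree.nodesList, List.mem_append, key]
    cases t with
    | leaf =>
      rw [toCList_cons_leaf, toA, ATree.nodes]
      simp [leaves]
    | node us => rw [toCList_cons (by simp), CTree.vertsList, List.mem_append, h.1 X o hX]

/-- Non-emptiness excludes the dummy decoration `∅` that `toC` assigns to a leaf. -/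
theorem mem_nodes_toA (t : PTree) : ∀ (X : Finset ℕ) (o : ℕ), X.Nonempty →
    (X ∈ (toA t o).nodes ↔ X ∈ (toC t o).verts) := by
  induction t using forall_of_node with
  | leaf =>
    intro X o hX
    simp [toA, ATree.nodes, toC, CTree.verts, CTree.vertsList, hX.ne_empty]
  | node ts ih =>
    intro X o hX
    rw [toA, ATree.nodes, toC, CTree.verts, List.mem_cons, List.mem_cons,
      nodesList_toAList_iff ih o hX]

theorem leftBelowList_append {Y : Finset ℕ} (as us : List ATree) (h : Y ∉ ATree.nodesList as) :
    ATree.leftBelowList Y (as ++ us) = ATree.sizeList as + ATree.leftBelowList Y us := by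
  induction as with
  | nil => simp [ATree.sizeList]
  | cons a as ih =>
    rw [ATree.nodesList, List.mem_append, not_or] at h
    have hr : ATree.root? a ≠ some Y := by
      cases a with
      | leaf v => simp [ATree.root?]
      | node X us =>
        rw [ATree.nodes, List.mem_cons, not_or] at h
        simpa [ATree.root?, eq_comm] using h.1.1
    rw [List.cons_append, ATree.leftBelowList, if_neg hr, if_neg h.1, ih h.2, ATree.sizeList,
      add_assoc]

mutual
theorem splitAux_of_notMem (T : OTree) (W X Y : Finset ℕ) : ∀ C : CTree, W ∉ C.verts →
    CTree.splitAux T W X Y C = C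
  | .node Z cs => fun h => by
    rw [CTree.verts, List.mem_cons, not_or] at h
    rw [CTree.splitAux, if_neg (fun h' => h.1 h'.symm), splitAuxList_of_notMem T W X Y cs h.2]
theorem splitAuxList_of_notMem (T : OTree) (W X Y : Finset ℕ) : ∀ cs : List CTree,
    W ∉ CTree.vertsList cs → CTree.splitAuxList T W X Y cs = cs
  | [] => fun _ => rfl
  | c :: cs => fun h => by
    rw [CTree.vertsList, List.mem_append, not_or] at h
    rw [CTree.splitAuxList, splitAux_of_notMem T W X Y c h.1,
      splitAuxList_of_notMem T W X Y cs h.2]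
end

/-- The signed tree `st` is the term of the differential of `t` that corresponds to the splitting
`wy` of a vertex of the construct `toC t o`. -/
structure Matches (n o : ℕ) (t : PTree) (st : ℤˣ × PTree) (wy : Finset ℕ × Finset ℕ) : Prop where
  represents : Represents n (CTree.splitAux (OTree.lin n) wy.1 (wy.1 \ wy.2) wy.2 (toC t o))
    (toC st.2 o)
  mem_nodes : wy.2 ∈ (toA st.2 o).nodes
  root_ne : (toA st.2 o).root? ≠ some wy.2
  sign : ∃ e : ℤ, st.1 = e.negOnePow ∧ (e : ZMod 2) + (shift st.2 : ℤ) =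
    (shift t : ℤ) + ((toA st.2 o).leftBelow wy.2 : ℕ)

/-- The analogue of `Matches` for lists of trees. -/
structure MatchesList (n o : ℕ) (ts : List PTree) (st : ℤˣ × List PTree)
    (wy : Finset ℕ × Finset ℕ) : Prop where
  represents : List.Forall₂ (Represents n)
    (CTree.splitAuxList (OTree.lin n) wy.1 (wy.1 \ wy.2) wy.2 (toCList ts o)) (toCList st.2 o)
  starts_eq : starts st.2 o = starts ts o
  mem_nodes : wy.2 ∈ ATree.nodesList (toAList st.2 o)
  sign : ∃ e : ℤ, st.1 = e.negOnePow ∧ (e : ZMod 2) + (shiftList st.2 : ℤ) =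
    (shiftList ts : ℤ) + (ATree.leftBelowList wy.2 (toAList st.2 o) : ℕ) + (ts.length : ℕ)

theorem disjoint_span_lin {n : ℕ} {K Y : Finset ℕ} (hK : K ⊆ Finset.Icc 2 n)
    (hY : Y ⊆ Finset.Icc 2 n) : Disjoint ((OTree.lin n).span K) ((OTree.lin n).span Y) ↔
      ∀ z, (z ∈ K ∨ z + 1 ∈ K) → ¬ (z ∈ Y ∨ z + 1 ∈ Y) := by
  rw [Finset.disjoint_left]
  simp only [OTree.mem_span_lin hK, OTree.mem_span_lin hY]

theorem shiftList_append (as bs : List PTree) : shiftList (as ++ bs) =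
    shiftList as + degreeList as * bs.length + shiftList bs := by
  induction as with
  | nil => simp [shiftList]
  | cons a as ih =>
    rw [List.cons_append, shiftList, ih, shiftList, degreeList_cons, List.length_append]
    push_cast
    ring

theorem cuts_nonempty (h : (node ts).IsReduced) (o : ℕ) : (cuts ts o).Nonempty := by
  rw [isReduced_node_iff] at h
  rw [cuts_eq h.2]
  obtain ⟨x, hx⟩ := List.exists_mem_of_length_pos (l := (starts ts o).tail)
    (by rw [List.length_tail, length_starts]; omega)
  exact ⟨x, List.mem_toFinset.2 hx⟩

/-- Moving the block `bs` to a new vertex splits off the gaps between the trees of `bs`. The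
children of the construct inside `bs` touch these gaps and follow the new vertex, the others stay;
the new edge has only the trees of `as` on its left. -/
theorem matches_root {as bs cs : List PTree} (h : (node (as ++ (bs ++ cs))).IsReduced)
    (hbs : 2 ≤ bs.length) {n o : ℕ} (ho : 1 ≤ o)
    (hn : o + leavesList (as ++ (bs ++ cs)) ≤ n + 1) :
    Matches n o (node (as ++ (bs ++ cs)))
      (((as.length : ℤ) + (bs.length : ℤ) * cs.length +
        ((bs.length : ℤ) - 2) * degreeList as).negOnePow, node (as ++ node bs :: cs))
      (cuts (as ++ (bs ++ cs)) o, cuts bs (o + leavesList as)) := by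
  rw [isReduced_node_iff] at h
  have has : ∀ t ∈ as, t.IsReduced := fun t ht => h.2 t (by simp [ht])
  have hcs : ∀ t ∈ cs, t.IsReduced := fun t ht => h.2 t (by simp [ht])
  have hbs' : (node bs).IsReduced := by
    rw [isReduced_node_iff]
    exact ⟨hbs, fun t ht => h.2 t (by simp [ht])⟩
  have hb2 : ∀ t ∈ bs, t.IsReduced := fun t ht => h.2 t (by simp [ht])
  have hb3 := two_le_leavesList hbs'
  have hbsne : bs ≠ [] := by rintro rfl; simp at hbs
  rw [leavesList_append, leavesList_append] at hn
  have hne := cuts_nonempty hbs' (o + leavesList as)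
  have hsub := cuts_subset (o := o + leavesList as) hbs'
  have hsub' : cuts bs (o + leavesList as) ⊆ Finset.Icc 2 n := by
    intro z hz
    have := Finset.mem_Icc.1 (hsub hz)
    rw [Finset.mem_Icc]; omega
  have hred : ∀ t ∈ as ++ node bs :: cs, t.IsReduced := by
    intro t ht
    simp only [List.mem_append, List.mem_cons] at ht
    rcases ht with ht | rfl | ht
    · exact has t ht
    · exact hbs'
    · exact hcs t ht
  have hY : ∀ z, z ∈ cuts bs (o + leavesList as) →
      o + leavesList as < z ∧ z < o + leavesList as + leavesList bs := by
    intro z hz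
    have := Finset.mem_Icc.1 (hsub hz)
    omega
  have hmemsub : ∀ ts : List PTree, (∀ t ∈ ts, t.IsReduced) → ∀ p, 1 ≤ p → p + leavesList ts ≤ n + 1 →
      ∀ c ∈ toCList ts p, ∃ q : ℕ × PTree, q ∈ kids ts p ∧ 2 ≤ leaves q.2 ∧
        c.supp = Finset.Icc (q.1 + 1) (q.1 + leaves q.2 - 1) ∧ c.supp ⊆ Finset.Icc 2 n ∧
        p ≤ q.1 ∧ q.1 + leaves q.2 ≤ p + leavesList ts := by
    intro ts hts p hp hpn c hc
    rw [toCList_eq_map] at hc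
    obtain ⟨q, hq, rfl⟩ := List.mem_map.1 hc
    obtain ⟨h1, h2, -⟩ := reduced_of_mem_kids hts hq
    have h3 := leavesList_bound_of_mem_kids hts hq
    refine ⟨q, hq, h3.2.1, supp_toC h1 h2 _, ?_, h3.1, h3.2.2⟩
    rw [supp_toC h1 h2]
    intro z hz
    rw [Finset.mem_Icc] at *
    omega
  have hnYa : cuts bs (o + leavesList as) ∉ ATree.nodesList (toAList as o) := by
    intro hmem
    rw [nodesList_toAList_iff (fun t _ => mem_nodes_toA t) o hne] at hmem
    obtain ⟨z, hz⟩ := hne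
    have h1 := bounds_of_mem_vertsList has hmem hz
    have h2 := hY z hz
    omega
  refine ⟨?_, ?_, ?_, ?_⟩
  · simp only
    rw [toC, toC, CTree.splitAux, if_pos rfl]
    have hfilter : ∀ c ∈ toCList as o ++ toCList cs (o + leavesList as + leavesList bs),
        Disjoint ((OTree.lin n).span c.supp)
          ((OTree.lin n).span (cuts bs (o + leavesList as))) := by
      intro c hc
      rw [List.mem_append] at hc
      rcases hc with hc | hc
      · obtain ⟨q, -, h2, h3, h4, h5, h6⟩ := hmemsub as has o ho (by omega) c hc
        rw [disjoint_span_lin h4 hsub', h3]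
        intro z hz hz'
        rw [Finset.mem_Icc, Finset.mem_Icc] at hz
        rcases hz' with hz' | hz' <;> have := hY _ hz' <;> omega
      · obtain ⟨q, -, h2, h3, h4, h5, h6⟩ := hmemsub cs hcs _ (by omega) (by omega) c hc
        rw [disjoint_span_lin h4 hsub', h3]
        intro z hz hz'
        rw [Finset.mem_Icc, Finset.mem_Icc] at hz
        rcases hz' with hz' | hz' <;> have := hY _ hz' <;> omega
    have hfilter' : ∀ c ∈ toCList bs (o + leavesList as),
        ¬ Disjoint ((OTree.lin n).span c.supp)
          ((OTree.lin n).span (cuts bs (o + leavesList as))) := by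
      intro c hc
      obtain ⟨q, h1, h2, h3, h4, h5, h6⟩ := hmemsub bs hb2 _ (by omega) (by omega) c hc
      rw [disjoint_span_lin h4 hsub', h3]
      intro hcon
      -- Since `bs` has at least two trees, each of them has a gap of `Y` at its beginning or at its
      -- end.
      obtain ⟨h7, h8⟩ := starts_of_mem_kids h1
      have h9 : q.1 ∈ cuts bs (o + leavesList as) ∨
          q.1 + leaves q.2 ∈ cuts bs (o + leavesList as) := by
        rw [mem_cuts, mem_cuts]
        by_cases hq : q.1 = o + leavesList as
        · rcases h8 with h8 | h8
          · exact .inr ⟨by omega, h8⟩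
          · exfalso
            obtain ⟨z, hz⟩ := hne
            have h9 := hY z hz
            exact not_mem_starts_of_mem_kids hb2 h1 (z := z) (by omega) (by omega) (mem_cuts.1 hz).2
        · exact .inl ⟨hq, h7⟩
      -- The shared vertex is the first leaf of the child if the gap is at its beginning, and its
      -- last leaf otherwise.
      rcases h9 with h9 | h9
      · refine hcon q.1 (.inr ?_) (.inl h9)
        rw [Finset.mem_Icc]; omega
      · refine hcon (q.1 + leaves q.2 - 1) (.inl ?_) (.inr ?_)
        · rw [Finset.mem_Icc]; omega
        · rwa [Nat.sub_add_cancel (by omega)]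
    rw [toCList_append, toCList_append, List.filter_append, List.filter_append, List.filter_append,
      List.filter_append]
    rw [(List.filter_eq_nil_iff (l := toCList as o)).2 (by
        intro c hc
        simpa using hfilter c (by simp [hc])),
      (List.filter_eq_nil_iff (l := toCList cs (o + leavesList as + leavesList bs))).2 (by
        intro c hc
        simpa using hfilter c (by simp [hc])),
      (List.filter_eq_self (l := toCList bs (o + leavesList as))).2 (by
        intro c hc
        simpa using hfilter' c hc),
      (List.filter_eq_self (l := toCList as o)).2 (by
        intro c hc
        simpa using hfilter c (by simp [hc])),
      (List.filter_eq_self (l := toCList cs (o + leavesList as + leavesList bs))).2 (by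
        intro c hc
        simpa using hfilter c (by simp [hc])),
      (List.filter_eq_nil_iff (l := toCList bs (o + leavesList as))).2 (by
        intro c hc
        simpa using hfilter' c hc), List.nil_append, List.nil_append, List.append_nil]
    have hlist : toCList (as ++ node bs :: cs) o = toCList as o ++
        (toC (node bs) (o + leavesList as) :: toCList cs (o + leavesList as + leavesList bs)) := by
      rw [toCList_append, toCList_cons (by simp), leaves]
    -- `splitAux` lists the new vertex first; its place in the planar order is between the children
    -- in `as` and those in `cs`.
    have hperm : (CTree.node (cuts bs (o + leavesList as)) (toCList bs (o + leavesList as)) ::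
        (toCList as o ++ toCList cs (o + leavesList as + leavesList bs))).Perm
        (toCList (as ++ node bs :: cs) o) := by
      rw [hlist, toC]
      exact List.perm_middle.symm
    refine represents_node hred ho ?_ hperm (represents_toCList hred ho ?_) ?_
    · rw [leavesList_append, leavesList_cons, leaves]; omega
    · rw [leavesList_append, leavesList_cons, leaves]; omega
    · ext x
      simp only [Finset.mem_sdiff, mem_cuts, starts_append, starts, List.mem_append, List.mem_cons,
        leaves]
      have h1 := fun hx => bounds_of_mem_starts has (o := o) (x := x) hx
      have h2 := fun hx => bounds_of_mem_starts hb2 (o := o + leavesList as) (x := x) hx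
      have h3 := fun hx => bounds_of_mem_starts hcs (o := o + leavesList as + leavesList bs)
        (x := x) hx
      have h4 := start_mem (o := o + leavesList as) hbsne
      by_cases ha : x ∈ starts as o
      · have := h1 ha
        simp only [ha, true_or, and_true]
        have : x ≠ o + leavesList as := by omega
        have hb : x ∉ starts bs (o + leavesList as) := fun h => by have := h2 h; omega
        simp [hb]
      · by_cases hc : x ∈ starts cs (o + leavesList as + leavesList bs)
        · have := h3 hc
          have hb : x ∉ starts bs (o + leavesList as) := fun h => by have := h2 h; omega
          simp [hb, hc]
        · by_cases hx : x = o + leavesList as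
          · subst hx
            simp [h4]
          · simp only [ha, hc, hx]
            tauto
  · simp only
    rw [toA, ATree.nodes, toAList_append, toAList, toA]
    refine List.mem_cons_of_mem _ ?_
    have : ∀ l l' : List ATree, ATree.nodesList (l ++ l') = ATree.nodesList l ++ ATree.nodesList l' := by
      intro l l'
      induction l with
      | nil => simp [ATree.nodesList]
      | cons a l ih => simp [ATree.nodesList, ih]
    rw [this, List.mem_append, ATree.nodesList, List.mem_append, ATree.nodes]
    exact .inr (.inl (by simp))
  · simp only
    rw [toA, ATree.root?, Ne, Option.some.injEq]
    intro heq
    obtain ⟨z, hz⟩ := hne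
    have h1 := hz
    rw [← heq, mem_cuts, starts_append, List.mem_append, starts, List.mem_cons] at h1
    have h2 := hY z hz
    rcases h1.2 with h3 | h3 | h3
    · have := bounds_of_mem_starts has h3; omega
    · omega
    · have := bounds_of_mem_starts hcs h3
      rw [leaves] at this
      omega
  · refine ⟨_, rfl, ?_⟩
    simp only
    rw [toA, ATree.leftBelow, toAList_append, leftBelowList_append _ _ hnYa, toAList,
      ATree.leftBelowList, toA, ATree.root?, if_pos rfl, shift, shift, shiftList_append,
      shiftList_append, shiftList_append, shiftList, shift, degree_node]
    simp only [List.length_append, List.length_cons]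
    push_cast
    rw [sizeList_toAList]
    grind

end PTree
end OInfinity
namespace OInfinity

theorem forall₂_imp_of_mem {α β : Type*} {R S : α → β → Prop} {l : List α} {l' : List β}
    (h : List.Forall₂ R l l') (H : ∀ a ∈ l, ∀ b ∈ l', R a b → S a b) : List.Forall₂ S l l' := by
  induction h with
  | nil => exact .nil
  | cons h _ ih =>
    exact .cons (H _ (by simp) _ (by simp) h) (ih fun a ha b hb =>
      H a (List.mem_cons_of_mem _ ha) b (List.mem_cons_of_mem _ hb))

namespace PTree

variable {ts : List PTree}

theorem matches_rootTerms (h : (node ts).IsReduced) {n o : ℕ} (ho : 1 ≤ o)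
    (hn : o + leavesList ts ≤ n + 1) :
    List.Forall₂ (Matches n o (node ts)) (rootTerms ts) (rootSplits ts o) := by
  rw [rootTerms_eq, rootSplits, List.forall₂_map_left_iff, List.forall₂_map_right_iff,
    List.forall₂_same]
  rintro ⟨p, q⟩ hpq
  rw [mem_splitIndex] at hpq
  obtain ⟨as, bs, cs, rfl, rfl, rfl⟩ := exists_append hpq.2.2
  have hbs : ∀ t ∈ bs, t.IsReduced := fun t ht => ((isReduced_node_iff _).1 h).2 t (by simp [ht])
  -- After the first start is removed, dropping `as.length` entries also removes the start of the
  -- block `bs` itself, which stays a gap of the root or is no gap at all.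
  have hY : (((starts (as ++ (bs ++ cs)) o).tail.drop as.length).take (bs.length - 1)).toFinset =
      cuts bs (o + leavesList as) := by
    rw [cuts_eq hbs, starts_append, starts_append, ← List.drop_one, List.drop_drop, add_comm,
      ← List.drop_drop, ← length_starts as o, List.drop_left, List.drop_one,
      List.tail_append_of_ne_nil, ← length_starts bs (o + leavesList as), ← List.length_tail,
      List.take_left]
    intro h0
    have := congrArg List.length h0
    rw [length_starts, List.length_nil] at this
    omega
  simp only
  rw [hY, rootTerm_append]
  exact matches_root h hpq.1 ho hn

/-- The split vertex lies in a subtree, so the root decoration does not change. The summand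
`ts.length` in `MatchesList.sign` is compensated by the degree `ts.length - 2` of the root, which
the differential passes. -/
theorem MatchesList.matches_node (h : (node ts).IsReduced) {n o : ℕ} (ho : 1 ≤ o)
    (hn : o + leavesList ts ≤ n + 1) {st : ℤˣ × List PTree} {wy : Finset ℕ × Finset ℕ}
    (hst : st ∈ dTermsList ts) (hwy : wy ∈ splitsList ts o) (H : MatchesList n o ts st wy) :
    Matches n o (node ts) (((ts.length : ℤ) - 2).negOnePow * st.1, node st.2) wy := by
  have hc := cuts_nonempty h o
  rw [isReduced_node_iff] at h
  obtain ⟨hW, hint⟩ := mem_splitsList h.2 (W := wy.1) (Y := wy.2) hwy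
  have hcuts : cuts st.2 o = cuts ts o := by rw [cuts, cuts, H.starts_eq]
  have hYc : cuts ts o ≠ wy.2 := by
    intro heq
    obtain ⟨x, hx⟩ := hint.nonempty
    have := bounds_of_mem_vertsList h.2 hW (hint.subset hx)
    rw [← heq, mem_cuts] at hx
    exact this.2.2 hx.2
  refine ⟨?_, ?_, ?_, ?_⟩
  · simp only
    rw [toC, toC, CTree.splitAux, if_neg]
    · refine represents_node (dTermsList_isReduced ts h.2 st hst) ho ?_ (List.Perm.refl _)
        H.represents hcuts.symm
      rwa [(dTermsList_spec ts st hst).1]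
    · intro heq
      obtain ⟨x, hx⟩ := hint.nonempty
      have h1 := hint.subset hx
      have := bounds_of_mem_vertsList h.2 hW h1
      rw [← heq, mem_cuts] at h1
      exact this.2.2 h1.2
  · simp only
    rw [toA, ATree.nodes]
    exact List.mem_cons_of_mem _ H.mem_nodes
  · simp only
    rw [toA, ATree.root?, hcuts]
    simpa using hYc
  · obtain ⟨e, h1, h2⟩ := H.sign
    refine ⟨(ts.length : ℤ) - 2 + e, by rw [Int.negOnePow_add, h1], ?_⟩
    simp only
    rw [shift, shift, toA, ATree.leftBelow]
    push_cast
    grind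

/-- Lowering the degree of the first tree by one changes its contribution to `shift` by the number
of later trees; together with the internal edge below the splitting this gives `ts.length + 1`. The
condition `root_ne` ensures that this edge is counted. -/
theorem Matches.matchesList_cons {t : PTree} (ht : t.IsReduced) (hts : ∀ t ∈ ts, t.IsReduced)
    {n o : ℕ} (ho : 1 ≤ o) (hn : o + (leaves t + leavesList ts) ≤ n + 1) {st : ℤˣ × PTree}
    {wy : Finset ℕ × Finset ℕ} (hst : st ∈ dTerms t) (hwy : wy ∈ splits t o)
    (H : Matches n o t st wy) : MatchesList n o (t :: ts) (st.1, st.2 :: ts) wy := by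
  have hl : t ≠ .leaf := by rintro rfl; simp at hst
  have hl' := dTerms_ne_leaf t st hst
  obtain ⟨h1, h2⟩ := dTerms_spec t st hst
  obtain ⟨hW, hint⟩ := (mem_splits (W := wy.1) (Y := wy.2) ht o).1 hwy
  have hnot : wy.1 ∉ CTree.vertsList (toCList ts (o + leaves t)) := by
    intro hmem
    obtain ⟨x, hx⟩ := hint.nonempty
    have h3 := bounds_of_mem_verts ht hW (hint.subset hx)
    have h4 := bounds_of_mem_vertsList hts hmem (hint.subset hx)
    omega
  refine ⟨?_, ?_, ?_, ?_⟩
  · simp only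
    rw [toCList_cons hl, toCList_cons hl', CTree.splitAuxList, splitAuxList_of_notMem _ _ _ _ _ hnot,
      h1]
    exact .cons H.represents (represents_toCList hts (by omega) (by omega))
  · simp only
    rw [starts, starts, h1]
  · simp only
    rw [toAList, ATree.nodesList, List.mem_append]
    exact .inl H.mem_nodes
  · obtain ⟨e, h3, h4⟩ := H.sign
    refine ⟨e, h3, ?_⟩
    simp only
    rw [shiftList, shiftList, toAList, ATree.leftBelowList, if_neg H.root_ne, if_pos H.mem_nodes,
      h2, List.length_cons]
    push_cast
    grind

/-- In `O_∞` the unchanged first tree lies on the left and contributes its size, which is its degree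
plus one; in `A_∞` it contributes its degree, and the extra one is the growth of the length. -/
theorem MatchesList.cons {t : PTree} (ht : t.IsReduced) (hts : ∀ t ∈ ts, t.IsReduced)
    {n o : ℕ} (ho : 1 ≤ o) (hn : o + (leaves t + leavesList ts) ≤ n + 1) {st : ℤˣ × List PTree}
    {wy : Finset ℕ × Finset ℕ} (hst : st ∈ dTermsList ts) (hwy : wy ∈ splitsList ts (o + leaves t))
    (H : MatchesList n (o + leaves t) ts st wy) :
    MatchesList n o (t :: ts) ((degree t).negOnePow * st.1, t :: st.2) wy := by
  obtain ⟨h1, h2, h3⟩ := dTermsList_spec ts st hst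
  obtain ⟨hW, hint⟩ := mem_splitsList (W := wy.1) (Y := wy.2) hts hwy
  obtain ⟨x, hx⟩ := hint.nonempty
  have hb := bounds_of_mem_vertsList hts hW (hint.subset hx)
  have hnot : wy.1 ∉ (toC t o).verts := fun hmem => by
    have := bounds_of_mem_verts ht hmem (hint.subset hx)
    omega
  have hnot' : wy.2 ∉ (toA t o).nodes := fun hmem => by
    rw [mem_nodes_toA t _ _ hint.nonempty] at hmem
    have := bounds_of_mem_verts ht hmem hx
    omega
  refine ⟨?_, ?_, ?_, ?_⟩
  · simp only
    cases t with
    | leaf =>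
      rw [toCList_cons_leaf, toCList_cons_leaf]
      exact H.represents
    | node us =>
      rw [toCList_cons (by simp), toCList_cons (by simp), CTree.splitAuxList,
        splitAux_of_notMem _ _ _ _ _ hnot]
      exact .cons (represents_toC ht (by simp) ho (by omega)) H.represents
  · simp only
    rw [starts, starts, H.starts_eq]
  · simp only
    rw [toAList, ATree.nodesList, List.mem_append]
    exact .inr H.mem_nodes
  · obtain ⟨e, h4, h5⟩ := H.sign
    refine ⟨degree t + e, by rw [Int.negOnePow_add, h4], ?_⟩
    simp only
    have h6 := leftBelowList_append (Y := wy.2) [toA t o] (toAList st.2 (o + leaves t))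
      (by simpa [ATree.nodesList] using hnot')
    rw [List.singleton_append] at h6
    rw [shiftList, shiftList, toAList, h6, h3, List.length_cons, ATree.sizeList, ATree.sizeList]
    push_cast
    rw [size_toA]
    grind

/-- The lists `dTerms` and `splits` follow the same recursion, so their entries correspond position
by position. -/
theorem matches_dTerms {t : PTree} (ht : t.IsReduced) {n : ℕ} : ∀ o, 1 ≤ o →
    o + leaves t ≤ n + 1 → List.Forall₂ (Matches n o t) (dTerms t) (splits t o) := by
  induction t using forall_of_node with
  | leaf => intro o _ _; rw [dTerms_leaf, splits]; exact .nil
  | node ts ih =>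
    intro o ho hn
    have h' := (isReduced_node_iff ts).1 ht
    rw [leaves] at hn
    rw [dTerms_node, splits]
    refine List.rel_append (matches_rootTerms ht ho hn) ?_
    rw [List.forall₂_map_left_iff]
    have key : List.Forall₂ (MatchesList n o ts) (dTermsList ts) (splitsList ts o) := by
      replace h' := h'.2
      clear ht
      induction ts generalizing o with
      | nil => rw [dTermsList_nil, splitsList]; exact .nil
      | cons t ts ih' =>
        rw [List.forall_mem_cons] at h' ih
        rw [leavesList] at hn
        rw [dTermsList_cons, splitsList]
        refine List.rel_append ?_ ?_
        · rw [List.forall₂_map_left_iff]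
          exact forall₂_imp_of_mem (ih.1 h'.1 o ho (by omega)) fun st hst wy hwy H =>
            H.matchesList_cons h'.1 h'.2 ho hn hst hwy
        · rw [List.forall₂_map_left_iff]
          exact forall₂_imp_of_mem (ih' ih.2 (o + leaves t) (by omega) (by omega) h'.2)
            fun st hst wy hwy H => H.cons h'.1 h'.2 ho hn hst hwy
    exact forall₂_imp_of_mem key fun st hst wy hwy H => H.matches_node ht ho hn hst hwy

-- The signed comparison map on basis elements.

section

variable (𝕜 : Type u) [Field 𝕜]

/-- The basis element of `O_∞` corresponding to a planar tree, with its sign. -/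
noncomputable def toOInf (t : PTree) : OInfV 𝕜 :=
  (shift t).negOnePow • Finsupp.single (OTree.lin (leaves t), toC t 1) (1 : 𝕜)

variable {𝕜} in
theorem map₂_units_smul {M N P : Type*} [AddCommGroup M] [Module 𝕜 M] [AddCommGroup N] [Module 𝕜 N]
    [AddCommGroup P] [Module 𝕜 P] (f : M →ₗ[𝕜] N →ₗ[𝕜] P) (u v : ℤˣ) (x : M) (y : N) :
    f (u • x) (v • y) = (v * u) • f x y := by
  rw [map_units_smul', ← LinearMap.flip_apply, map_units_smul', LinearMap.flip_apply, smul_smul]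

theorem neg_one_pow_smul_single {α : Type*} (k : ℕ) (a : α) :
    (Finsupp.single a ((-1 : 𝕜) ^ k)) = (k : ℤ).negOnePow • Finsupp.single a (1 : 𝕜) := by
  rw [Units.smul_def, Int.negOnePow_def, ← Int.cast_smul_eq_zsmul 𝕜, Finsupp.smul_single,
    smul_eq_mul, mul_one]
  simp

/-- `bullet_toC` identifies the basis elements. For the sign, the size of `α` without the root has
the parity of `|s|`, and `shift_graft` exchanges the count on the right for `degreeAfter`. -/
theorem OInfComp_toOInf {s t : PTree} {i : ℕ} (hs : s.IsReduced) (hs' : s ≠ .leaf)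
    (ht : t.IsReduced) (ht' : t ≠ .leaf) (hi : 1 ≤ i) (hit : i ≤ leaves t) :
    OInfComp 𝕜 i (toOInf 𝕜 t) (toOInf 𝕜 s) =
      (s.degree * t.degreeAfter i).negOnePow • toOInf 𝕜 (graft i s t) := by
  have hs1 := hs.one_le_leaves
  rw [toOInf, toOInf, map₂_units_smul, OInfComp,
    Finsupp.linearCombination_single, one_smul, Finsupp.linearCombination_single, one_smul,
    bullet_toC hs hs' ht ht' hi hit, OTree.subst_lin hi hit hs1, alpha_toC ht ht' le_rfl (by omega),
    alpha_toC hs hs' le_rfl (by omega), neg_one_pow_smul_single, toOInf, smul_smul, smul_smul,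
    ← Int.negOnePow_add, ← Int.negOnePow_add, ← Int.negOnePow_add]
  have hl := leaves_graft s t hi hit
  have hlt : leaves (graft i s t) = leaves t + leaves s - 1 := by omega
  rw [hlt]
  congr 1
  apply negOnePow_eq_of_zmod
  have h1 := shift_graft s i t 1 hi (by omega)
  rw [Nat.add_sub_cancel] at h1
  have h2 := size_toA s 1
  have h3 : 1 ≤ (toA s 1).size := by
    cases s with
    | leaf => exact absurd rfl hs'
    | node us => rw [toA, ATree.size]; omega
  obtain ⟨k, hk⟩ := Nat.exists_eq_add_of_le' h3
  rw [hk] at h2 ⊢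
  push_cast at h2 ⊢
  rw [h1]
  grind

theorem OInfD_toOInf {t : PTree} (ht : t.IsReduced) (ht' : t ≠ .leaf) :
    OInfD 𝕜 (toOInf 𝕜 t) = ((dTerms t).map fun st => st.1 • toOInf 𝕜 st.2).sum := by
  have hl := ht.two_le_leaves ht'
  rw [toOInf, map_units_smul', OInfD, Finsupp.linearCombination_single, one_smul]
  -- Term by term, `Matches` supplies the construct and the sign.
  have key : ((dTerms t).map fun st => st.1 • toOInf 𝕜 st.2) = (splits t 1).map fun wy =>
      (shift t).negOnePow • Finsupp.single (OTree.lin (leaves t),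
        (toC t 1).split (OTree.lin (leaves t)) wy.1 (wy.1 \ wy.2) wy.2)
        ((-1 : 𝕜) ^ (alpha (OTree.lin (leaves t)) ((toC t 1).split (OTree.lin (leaves t))
          wy.1 (wy.1 \ wy.2) wy.2)).leftBelow wy.2) := by
    have hm := matches_dTerms ht (n := leaves t) 1 le_rfl (by omega)
    rw [← List.forall₂_eq_eq_eq, List.forall₂_map_left_iff, List.forall₂_map_right_iff]
    refine forall₂_imp_of_mem hm fun st hst wy hwy H => ?_
    obtain ⟨h1, -⟩ := dTerms_spec t st hst
    rw [CTree.split, H.represents.2, alpha_toC (dTerms_isReduced t ht st hst)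
      (dTerms_ne_leaf t st hst) le_rfl (by omega), toOInf, h1, neg_one_pow_smul_single]
    obtain ⟨e, h2, h3⟩ := H.sign
    rw [h2, smul_smul, smul_smul, ← Int.negOnePow_add, ← Int.negOnePow_add]
    congr 1
    apply negOnePow_eq_of_zmod
    push_cast
    exact h3
  rw [key, ← List.sum_toFinset _ (nodup_splits ht 1), ← Finset.smul_sum, Finset.sum_sigma']
  congr 1
  have hsub : ∀ W ∈ (toC t 1).verts, W ⊆ Finset.Icc 2 (leaves t) := by
    intro W hW x hx
    have := bounds_of_mem_verts ht hW hx
    rw [Finset.mem_Icc]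
    omega
  -- `OInfD` is indexed by the lower part `X` of the split vertex, `splits` by the upper part `Y`;
  -- complementation inside `W` translates.
  refine Finset.sum_nbij' (fun wx => (wx.1, wx.1 \ wx.2)) (fun wy => ⟨wy.1, wy.1 \ wy.2⟩)
    ?_ ?_ ?_ ?_ ?_
  · rintro ⟨W, X⟩ h
    simp only [Finset.mem_sigma, Finset.mem_filter, List.mem_toFinset, Finset.mem_powerset] at h ⊢
    obtain ⟨⟨h1, h2⟩, h3, h4⟩ := h
    rw [mem_splits ht]
    refine ⟨h1, (Hypergraph.isConstruct_pair_iff Finset.sdiff_subset).1 ?_⟩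
    rw [OTree.edgeGraph_contract_lin (by omega) (hsub W h1)] at h4
    rwa [Finset.sdiff_sdiff_eq_self h3]
  · rintro ⟨W, Y⟩ h
    simp only [Finset.mem_sigma, Finset.mem_filter, List.mem_toFinset, Finset.mem_powerset] at h ⊢
    rw [mem_splits ht] at h
    obtain ⟨h1, h2⟩ := h
    refine ⟨⟨h1, ?_⟩, Finset.sdiff_subset, ?_⟩
    · have h3 := Finset.card_sdiff_add_card_eq_card h2.subset
      have h4 := h2.nonempty.card_pos
      have h5 := h2.compl_nonempty.card_pos
      omega
    · rw [OTree.edgeGraph_contract_lin (by omega) (hsub W h1), Finset.sdiff_sdiff_eq_self h2.subset]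
      exact (Hypergraph.isConstruct_pair_iff h2.subset).2 h2
  · rintro ⟨W, X⟩ h
    simp only [Finset.mem_sigma, Finset.mem_filter, Finset.mem_powerset] at h
    simp only [Finset.sdiff_sdiff_eq_self h.2.1]
  · rintro ⟨W, Y⟩ h
    rw [List.mem_toFinset, mem_splits ht] at h
    simp only [Finset.sdiff_sdiff_eq_self h.2.subset]
  · rintro ⟨W, X⟩ h
    simp only [Finset.mem_sigma, Finset.mem_filter, Finset.mem_powerset] at h
    simp only [Finset.sdiff_sdiff_eq_self h.2.1]

end

end PTree
end OInfinity
namespace OInfinity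

-- Transport of structure along an isomorphism.

namespace OperadData

variable {𝕜 : Type u} [Field 𝕜]

/-- `Φ` and `Ψ` restrict to mutually inverse isomorphisms in all arities, and `Φ` is compatible with
the compositions and the differential. -/
structure IsEquivalence (P Q : OperadData 𝕜) (Φ : P.V →ₗ[𝕜] Q.V) (Ψ : Q.V →ₗ[𝕜] P.V) : Prop where
  map_obj : ∀ {n : ℕ} {x : P.V}, x ∈ P.obj n → Φ x ∈ Q.obj n
  symm_obj : ∀ {n : ℕ} {x : Q.V}, x ∈ Q.obj n → Ψ x ∈ P.obj n
  left_inv : ∀ {n : ℕ} {x : P.V}, x ∈ P.obj n → Ψ (Φ x) = x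
  right_inv : ∀ {n : ℕ} {x : Q.V}, x ∈ Q.obj n → Φ (Ψ x) = x
  map_deg : ∀ {n : ℕ} {a : ℤ} {x : P.V}, x ∈ P.obj n ⊓ P.deg a → Φ x ∈ Q.deg a
  symm_deg : ∀ {n : ℕ} {a : ℤ} {x : Q.V}, x ∈ Q.obj n ⊓ Q.deg a → Ψ x ∈ P.deg a
  map_comp : ∀ {m n i : ℕ} {x y : P.V}, 1 ≤ i → i ≤ m → x ∈ P.obj m → y ∈ P.obj n →
    Φ (P.comp i x y) = Q.comp i (Φ x) (Φ y)
  map_d : ∀ {n : ℕ} {x : P.V}, x ∈ P.obj n → Φ (P.d x) = Q.d (Φ x)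

theorem IsGradedHom.comp {P Q R : OperadData 𝕜} {g : ∀ n, Q.obj n →ₗ[𝕜] R.obj n}
    {f : ∀ n, P.obj n →ₗ[𝕜] Q.obj n} (hg : IsGradedHom Q R g) (hf : IsGradedHom P Q f) :
    IsGradedHom P R fun n => g n ∘ₗ f n where
  map_deg x hx := hg.map_deg _ (hf.map_deg x hx)
  map_comp x y z hi him hz := hg.map_comp _ _ _ hi him (hf.map_comp x y z hi him hz)

theorem IsDGHom.comp {P Q R : OperadData 𝕜} {g : ∀ n, Q.obj n →ₗ[𝕜] R.obj n}
    {f : ∀ n, P.obj n →ₗ[𝕜] Q.obj n} (hg : IsDGHom Q R g) (hf : IsDGHom P Q f) :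
    IsDGHom P R fun n => g n ∘ₗ f n where
  toIsGradedHom := hg.toIsGradedHom.comp hf.toIsGradedHom
  map_d x y hy := hg.map_d _ _ (hf.map_d x y hy)

namespace IsEquivalence

variable {P Q : OperadData 𝕜} {Φ : P.V →ₗ[𝕜] Q.V} {Ψ : Q.V →ₗ[𝕜] P.V}

theorem exists_eq (h : IsEquivalence P Q Φ Ψ) {n : ℕ} {x : Q.V} (hx : x ∈ Q.obj n) :
    ∃ y ∈ P.obj n, Φ y = x := ⟨Ψ x, h.symm_obj hx, h.right_inv hx⟩

theorem exists_eq_deg (h : IsEquivalence P Q Φ Ψ) {n : ℕ} {a : ℤ} {x : Q.V}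
    (hx : x ∈ Q.obj n ⊓ Q.deg a) : ∃ y ∈ P.obj n ⊓ P.deg a, Φ y = x :=
  ⟨Ψ x, ⟨h.symm_obj hx.1, h.symm_deg hx⟩, h.right_inv hx.1⟩

/-- The maps are inverse only on the arity components, so the axioms of `P` are needed to know that
composites and differentials stay inside them. -/
theorem symm (h : IsEquivalence P Q Φ Ψ) (hP : P.IsDGOperad) : IsEquivalence Q P Ψ Φ where
  map_obj := h.symm_obj
  symm_obj := h.map_obj
  left_inv := h.right_inv
  right_inv := h.left_inv
  map_deg := h.symm_deg
  symm_deg := h.map_deg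
  map_comp hi him hx hy := by
    obtain ⟨x, hx', rfl⟩ := h.exists_eq hx
    obtain ⟨y, hy', rfl⟩ := h.exists_eq hy
    rw [← h.map_comp hi him hx' hy', h.left_inv (hP.comp_mem hi him hx' hy'), h.left_inv hx',
      h.left_inv hy']
  map_d hx := by
    obtain ⟨x, hx', rfl⟩ := h.exists_eq hx
    rw [← h.map_d hx', h.left_inv (hP.d_mem hx'), h.left_inv hx']

theorem isDGOperad (h : IsEquivalence P Q Φ Ψ) (hP : P.IsDGOperad)
    (hQ : ∀ n, Q.obj n ≤ ⨆ a, Q.obj n ⊓ Q.deg a) (hQ' : ∀ n, iSupIndep fun a => Q.obj n ⊓ Q.deg a) :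
    Q.IsDGOperad where
  le_iSup_deg := hQ
  independent := hQ'
  comp_mem hi him hx hy := by
    obtain ⟨x, hx', rfl⟩ := h.exists_eq hx
    obtain ⟨y, hy', rfl⟩ := h.exists_eq hy
    rw [← h.map_comp hi him hx' hy']
    exact h.map_obj (hP.comp_mem hi him hx' hy')
  comp_deg hi him hx hy := by
    obtain ⟨x, hx', rfl⟩ := h.exists_eq_deg hx
    obtain ⟨y, hy', rfl⟩ := h.exists_eq_deg hy
    rw [← h.map_comp hi him hx'.1 hy'.1]
    exact h.map_deg ⟨hP.comp_mem hi him hx'.1 hy'.1, hP.comp_deg hi him hx' hy'⟩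
  comp_seq := by
    intro m n p i j x y z hi him hj hjn hx hy hz
    obtain ⟨x, hx', rfl⟩ := h.exists_eq hx
    obtain ⟨y, hy', rfl⟩ := h.exists_eq hy
    obtain ⟨z, hz', rfl⟩ := h.exists_eq hz
    rw [← h.map_comp hi him hx' hy', ← h.map_comp hj hjn hy' hz',
      ← h.map_comp (m := m + n - 1) (by omega) (by omega) (hP.comp_mem hi him hx' hy') hz',
      ← h.map_comp hi him hx' (hP.comp_mem hj hjn hy' hz'), hP.comp_seq hi him hj hjn hx' hy' hz']
  comp_par := by
    intro m n p i j b c x y z hi hij hj hx hy hz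
    obtain ⟨x, hx', rfl⟩ := h.exists_eq hx
    obtain ⟨y, hy', rfl⟩ := h.exists_eq_deg hy
    obtain ⟨z, hz', rfl⟩ := h.exists_eq_deg hz
    have h1 := hP.comp_mem hi (by omega) hx' hy'.1
    have h2 := hP.comp_mem (i := j) (by omega) hj hx' hz'.1
    rw [← h.map_comp hi (by omega) hx' hy'.1, ← h.map_comp (m := m) (i := j) (by omega) hj hx' hz'.1]
    rw [← h.map_comp (m := m + n - 1) (by omega) (by omega) h1 hz'.1,
      ← h.map_comp (m := m + p - 1) hi (by omega) h2 hy'.1,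
      hP.comp_par hi hij hj hx' hy' hz', map_units_smul']
  d_mem hx := by
    obtain ⟨x, hx', rfl⟩ := h.exists_eq hx
    rw [← h.map_d hx']
    exact h.map_obj (hP.d_mem hx')
  d_deg hx := by
    obtain ⟨x, hx', rfl⟩ := h.exists_eq_deg hx
    rw [← h.map_d hx'.1]
    exact h.map_deg ⟨hP.d_mem hx'.1, hP.d_deg hx'⟩
  d_d hx := by
    obtain ⟨x, hx', rfl⟩ := h.exists_eq hx
    rw [← h.map_d hx', ← h.map_d (hP.d_mem hx'), hP.d_d hx', map_zero]
  d_comp := by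
    intro m n i a x y hi him hx hy
    obtain ⟨x, hx', rfl⟩ := h.exists_eq_deg hx
    obtain ⟨y, hy', rfl⟩ := h.exists_eq hy
    rw [← h.map_comp hi him hx'.1 hy', ← h.map_d (hP.comp_mem hi him hx'.1 hy'), ← h.map_d hx'.1,
      ← h.map_d hy', ← h.map_comp hi him (hP.d_mem hx'.1) hy',
      ← h.map_comp hi him hx'.1 (hP.d_mem hy'), hP.d_comp hi him hx' hy', map_add, map_units_smul']

/-- The isomorphisms between the components. -/
noncomputable def equiv (h : IsEquivalence P Q Φ Ψ) (n : ℕ) : P.obj n ≃ₗ[𝕜] Q.obj n where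
  toLinearMap := Φ.restrict fun _ hx => h.map_obj hx
  invFun x := ⟨Ψ x, h.symm_obj x.2⟩
  left_inv x := Subtype.ext (h.left_inv x.2)
  right_inv x := Subtype.ext (h.right_inv x.2)

theorem isDGHom (h : IsEquivalence P Q Φ Ψ) :
    IsDGHom P Q fun n => (h.equiv n : P.obj n →ₗ[𝕜] Q.obj n) where
  map_deg x hx := h.map_deg ⟨x.2, hx⟩
  map_comp x y z hi him hz := by
    change Φ z = Q.comp _ (Φ x) (Φ y)
    rw [hz, h.map_comp hi him x.2 y.2]
  map_d x y hy := by
    change Φ y = Q.d (Φ x)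
    rw [hy, h.map_d x.2]

theorem isomorphic (h : IsEquivalence P Q Φ Ψ) : Isomorphic P Q :=
  ⟨_, h.isDGHom, fun n => (h.equiv n).bijective⟩

/-- A family of values on the image generators is pulled back along `Φ`, extended over `P` by
freeness, and precomposed with the inverse; uniqueness is reduced to that for `P` in the same way.
-/
theorem isFreeOn (h : IsEquivalence P Q Φ Ψ) (hP : P.IsDGOperad) {E : ℕ → Submodule 𝕜 P.V}
    (hE : P.IsFreeOn E) : Q.IsFreeOn fun n => (E n).map Φ := by
  obtain ⟨h1, h2, h3⟩ := hE
  refine ⟨?_, ?_, ?_⟩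
  · rintro n _ ⟨x, hx, rfl⟩
    exact h.map_obj (h1 n hx)
  · intro n
    refine (Submodule.map_mono (h2 n)).trans ?_
    rw [Submodule.map_iSup]
    refine iSup_mono fun a => ?_
    rintro _ ⟨x, hx, rfl⟩
    exact ⟨⟨x, hx.1, rfl⟩, h.map_deg ⟨h1 n hx.1, hx.2⟩⟩
  · intro R hR g hg
    obtain ⟨f, ⟨hf1, hf2⟩, hf3⟩ := h3 R hR
      (fun n => g n ∘ₗ Φ.restrict fun x hx => ⟨x, hx, rfl⟩)
      (fun n a x hx => hg n a _ (h.map_deg ⟨h1 n x.2, hx⟩))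
    have hs := (h.symm hP).isDGHom.toIsGradedHom
    refine ⟨_, ⟨hf1.comp hs, ?_⟩, ?_⟩
    · rintro n x ⟨e, ⟨y, hy, rfl⟩⟩ hxe
      change f n ((h.symm hP).equiv n x) = _
      refine hf2 n _ ⟨y, hy⟩ ?_
      change Ψ x = y
      rw [hxe]
      exact h.left_inv (h1 n hy)
    · rintro f' ⟨hf'1, hf'2⟩
      have := hf3 _ ⟨hf'1.comp h.isDGHom.toIsGradedHom, ?_⟩
      · rw [← this]
        funext n
        ext1 x
        change f' n x = f' n (h.equiv n ((h.symm hP).equiv n x))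
        congr 1
        exact Subtype.ext (h.right_inv x.2).symm
      · intro n x e hxe
        refine hf'2 n _ _ ?_
        change Φ x = Φ e
        rw [hxe]

theorem map_decomposables (h : IsEquivalence P Q Φ Ψ) {n : ℕ} {x : P.V}
    (hx : x ∈ P.decomposables n) : Φ x ∈ Q.decomposables n := by
  rw [decomposables] at hx
  induction hx using Submodule.span_induction with
  | mem x hx =>
    obtain ⟨m, l, i, x, y, h1, h2, h3, hx, hy, rfl⟩ := hx
    rw [h.map_comp h2 h3 hx hy]
    exact Submodule.subset_span ⟨m, l, i, _, _, h1, h2, h3, h.map_obj hx, h.map_obj hy, rfl⟩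
  | zero => rw [map_zero]; exact zero_mem _
  | add x y _ _ hx hy => rw [map_add]; exact add_mem hx hy
  | smul c x _ hx => rw [map_smul]; exact Submodule.smul_mem _ c hx

theorem isQuasiIso_comp (h : IsEquivalence P Q Φ Ψ) (hP : P.IsDGOperad) {R : OperadData 𝕜}
    {g : ∀ n, P.obj n →ₗ[𝕜] R.obj n} (hg : IsQuasiIso P R g) :
    IsQuasiIso Q R fun n => g n ∘ₗ ((h.symm hP).equiv n : Q.obj n →ₗ[𝕜] P.obj n) := by
  intro n
  obtain ⟨h1, h2⟩ := hg n
  refine ⟨fun x hx hgx => ?_, fun y hy => ?_⟩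
  · have hc : Ψ x ∈ P.cycles n := by
      refine ⟨h.symm_obj x.2, ?_⟩
      change P.d (Ψ x) = 0
      rw [← (h.symm hP).map_d x.2, LinearMap.mem_ker.1 hx.2, map_zero]
    obtain ⟨z, hz, hzx⟩ := h1 ((h.symm hP).equiv n x) hc hgx
    refine ⟨Φ z, h.map_obj hz, ?_⟩
    rw [← h.map_d hz, hzx]
    exact h.right_inv x.2
  · obtain ⟨x, hx, hxy⟩ := h2 y hy
    refine ⟨h.equiv n x, ⟨h.map_obj x.2, ?_⟩, ?_⟩
    · change Q.d (Φ x) = 0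
      rw [← h.map_d x.2, LinearMap.mem_ker.1 hx.2, map_zero]
    · have : (h.symm hP).equiv n (h.equiv n x) = x := Subtype.ext (h.left_inv x.2)
      change y - (g n ((h.symm hP).equiv n (h.equiv n x)) : R.V) ∈ _
      rwa [this]

end IsEquivalence

end OperadData
end OInfinity
namespace OInfinity

-- The isomorphism and the minimal model.

section Comparison

variable (𝕜 : Type u) [Field 𝕜]

/-- The operadic trees and constructs that form the basis of `LinearOInf` in arity `n`. -/
def linearBasis (n : ℕ) : Set (OTree × CTree) := {b : OTree × CTree |
  b.1.IsLinear n ∧ CTree.IsConstruct b.1.edgeGraph b.2 ∧ b.2.canon b.1 = b.2}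

/-- There is only one linear tree in each arity, so a basis element amounts to a construct of a
path, hence to a planar tree. -/
theorem mem_linearBasis {n : ℕ} {b : OTree × CTree} : b ∈ linearBasis n ↔
    ∃ t ∈ basisTrees n, b = (OTree.lin n, PTree.toC t 1) := by
  obtain ⟨T, C⟩ := b
  have key := PTree.isConstruct_lin_iff (n := n) (C := C)
  constructor
  · rintro ⟨h1, h2, h3⟩
    obtain ⟨hn, rfl⟩ := OTree.isLinear_iff.1 h1
    obtain ⟨t, h4, h5, h6, rfl⟩ := key.1 ⟨hn, h2, h3⟩
    exact ⟨t, ⟨h4, h5, h6⟩, rfl⟩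
  · rintro ⟨t, ⟨h4, h5, h6⟩, h7⟩
    obtain ⟨rfl, rfl⟩ := Prod.mk.inj h7
    obtain ⟨hn, h2, h3⟩ := key.2 ⟨t, h4, h5, h6, rfl⟩
    exact ⟨OTree.isLinear_lin hn, h2, h3⟩

/-- The linear extension of `PTree.toOInf`. -/
noncomputable def toOInfLin : (PTree →₀ 𝕜) →ₗ[𝕜] OInfV 𝕜 :=
  Finsupp.linearCombination 𝕜 (PTree.toOInf 𝕜)

/-- The inverse of `toOInfLin`. -/
noncomputable def ofOInfLin : OInfV 𝕜 →ₗ[𝕜] (PTree →₀ 𝕜) :=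
  Finsupp.linearCombination 𝕜 fun b : OTree × CTree =>
    (PTree.shift (PTree.ofATree (alpha b.1 b.2))).negOnePow •
      Finsupp.single (PTree.ofATree (alpha b.1 b.2)) (1 : 𝕜)

variable {𝕜}

theorem toOInfLin_single (t : PTree) :
    toOInfLin 𝕜 (Finsupp.single t 1) = PTree.toOInf 𝕜 t := by
  simp [toOInfLin]

theorem toOInf_eq {n : ℕ} {t : PTree} (ht : t ∈ basisTrees n) : PTree.toOInf 𝕜 t =
    (PTree.shift t).negOnePow • Finsupp.single (OTree.lin n, PTree.toC t 1) (1 : 𝕜) := by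
  rw [PTree.toOInf, ht.2.2]

theorem ofOInfLin_single {n : ℕ} {t : PTree} (ht : t ∈ basisTrees n) :
    ofOInfLin 𝕜 (Finsupp.single (OTree.lin n, PTree.toC t 1) 1) =
      (PTree.shift t).negOnePow • Finsupp.single t (1 : 𝕜) := by
  obtain ⟨h1, h2, rfl⟩ := ht
  rw [ofOInfLin, Finsupp.linearCombination_single, one_smul]
  simp only
  rw [PTree.alpha_toC h1 h2 le_rfl (by omega), PTree.ofATree_toA]

theorem negOnePow_mul_self_smul {M : Type*} [AddCommGroup M] (e : ℤ) (x : M) :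
    e.negOnePow • e.negOnePow • x = x := by
  rw [smul_smul, Int.units_mul_self, one_smul]

theorem ofOInfLin_toOInf {n : ℕ} {t : PTree} (ht : t ∈ basisTrees n) :
    ofOInfLin 𝕜 (PTree.toOInf 𝕜 t) = Finsupp.single t 1 := by
  rw [toOInf_eq ht, map_units_smul', ofOInfLin_single ht, negOnePow_mul_self_smul]

theorem toOInfLin_signedSum (l : List (ℤˣ × PTree)) :
    toOInfLin 𝕜 (signedSum l) = (l.map fun st => st.1 • PTree.toOInf 𝕜 st.2).sum := by
  induction l with
  | nil => simp
  | cons st l ih =>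
    rw [signedSum_cons, map_add, ih, map_units_smul', toOInfLin_single, List.map_cons,
      List.sum_cons]

theorem toOInf_mem {n : ℕ} {t : PTree} (ht : t ∈ basisTrees n) :
    PTree.toOInf 𝕜 t ∈ Finsupp.supported 𝕜 𝕜 (linearBasis n) := by
  rw [toOInf_eq ht]
  exact units_smul_mem _ _ (Finsupp.single_mem_supported _ _ (mem_linearBasis.2 ⟨t, ht, rfl⟩))

theorem toOInf_mem_deg {n : ℕ} {t : PTree} (ht : t ∈ basisTrees n) :
    PTree.toOInf 𝕜 t ∈ OInfDeg 𝕜 t.degree := by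
  have := ht.1.one_le_leaves
  exact units_smul_mem _ _ (Finsupp.single_mem_supported _ _
    (PTree.edges_sub_verts_toC ht.2.1 this))

theorem toOInfLin_mem {n : ℕ} {x : PTree →₀ 𝕜}
    (hx : x ∈ Finsupp.supported 𝕜 𝕜 (basisTrees n)) :
    toOInfLin 𝕜 x ∈ Finsupp.supported 𝕜 𝕜 (linearBasis n) := by
  induction hx using supported_induction with
  | zero => rw [map_zero]; exact zero_mem _
  | add x y _ _ h h' => rw [map_add]; exact add_mem h h'
  | smul c x _ h => rw [map_smul]; exact Submodule.smul_mem _ c h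
  | single t ht => rw [toOInfLin_single]; exact toOInf_mem ht

theorem ofOInfLin_mem {n : ℕ} {x : OInfV 𝕜}
    (hx : x ∈ Finsupp.supported 𝕜 𝕜 (linearBasis n)) :
    ofOInfLin 𝕜 x ∈ Finsupp.supported 𝕜 𝕜 (basisTrees n) := by
  induction hx using supported_induction with
  | zero => rw [map_zero]; exact zero_mem _
  | add x y _ _ h h' => rw [map_add]; exact add_mem h h'
  | smul c x _ h => rw [map_smul]; exact Submodule.smul_mem _ c h
  | single b hb =>
    obtain ⟨t, ht, rfl⟩ := mem_linearBasis.1 hb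
    rw [ofOInfLin_single ht]
    exact units_smul_mem _ _ (Finsupp.single_mem_supported _ _ ht)

theorem ofOInfLin_toOInfLin {n : ℕ} {x : PTree →₀ 𝕜}
    (hx : x ∈ Finsupp.supported 𝕜 𝕜 (basisTrees n)) : ofOInfLin 𝕜 (toOInfLin 𝕜 x) = x := by
  induction hx using supported_induction with
  | zero => rw [map_zero, map_zero]
  | add x y _ _ h h' => rw [map_add, map_add, h, h']
  | smul c x _ h => rw [map_smul, map_smul, h]
  | single t ht => rw [toOInfLin_single, ofOInfLin_toOInf ht]

theorem toOInfLin_ofOInfLin {n : ℕ} {x : OInfV 𝕜}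
    (hx : x ∈ Finsupp.supported 𝕜 𝕜 (linearBasis n)) : toOInfLin 𝕜 (ofOInfLin 𝕜 x) = x := by
  induction hx using supported_induction with
  | zero => rw [map_zero, map_zero]
  | add x y _ _ h h' => rw [map_add, map_add, h, h']
  | smul c x _ h => rw [map_smul, map_smul, h]
  | single b hb =>
    obtain ⟨t, ht, rfl⟩ := mem_linearBasis.1 hb
    rw [ofOInfLin_single ht, map_units_smul', toOInfLin_single, toOInf_eq ht,
      negOnePow_mul_self_smul]

theorem toOInfLin_deg {n : ℕ} {a : ℤ} {x : PTree →₀ 𝕜}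
    (hx : x ∈ Finsupp.supported 𝕜 𝕜 (basisTreesDeg n a)) : toOInfLin 𝕜 x ∈ OInfDeg 𝕜 a := by
  induction hx using supported_induction with
  | zero => rw [map_zero]; exact zero_mem _
  | add x y _ _ h h' => rw [map_add]; exact add_mem h h'
  | smul c x _ h => rw [map_smul]; exact Submodule.smul_mem _ c h
  | single t ht =>
    obtain ⟨ht, rfl⟩ := ht
    rw [toOInfLin_single]
    exact toOInf_mem_deg ht

theorem LinearOInf_obj_inf_deg (n : ℕ) (a : ℤ) :
    (LinearOInf 𝕜).obj n ⊓ (LinearOInf 𝕜).deg a = Finsupp.supported 𝕜 𝕜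
      (linearBasis n ∩ {b | (b.1.edges.length : ℤ) - (b.2.verts.length : ℤ) = a}) :=
  (Finsupp.supported_inter _ _).symm

theorem ofOInfLin_deg {n : ℕ} {a : ℤ} {x : OInfV 𝕜} (hx : x ∈ Finsupp.supported 𝕜 𝕜
      (linearBasis n ∩ {b | (b.1.edges.length : ℤ) - (b.2.verts.length : ℤ) = a})) :
    ofOInfLin 𝕜 x ∈ Finsupp.supported 𝕜 𝕜 {t : PTree | t.degree = a} := by
  induction hx using supported_induction with
  | zero => rw [map_zero]; exact zero_mem _
  | add x y _ _ h h' => rw [map_add]; exact add_mem h h'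
  | smul c x _ h => rw [map_smul]; exact Submodule.smul_mem _ c h
  | single b hb =>
    obtain ⟨hb, rfl⟩ := hb
    obtain ⟨t, ht, rfl⟩ := mem_linearBasis.1 hb
    rw [ofOInfLin_single ht]
    obtain ⟨h1, h2, rfl⟩ := ht
    refine units_smul_mem _ _ (Finsupp.single_mem_supported _ _ ?_)
    exact (PTree.edges_sub_verts_toC h2 h1.one_le_leaves).symm

theorem toOInfLin_treeComp {m n i : ℕ} {x y : PTree →₀ 𝕜} (hi : 1 ≤ i) (him : i ≤ m)
    (hx : x ∈ Finsupp.supported 𝕜 𝕜 (basisTrees m))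
    (hy : y ∈ Finsupp.supported 𝕜 𝕜 (basisTrees n)) :
    toOInfLin 𝕜 (treeComp 𝕜 i x y) = OInfComp 𝕜 i (toOInfLin 𝕜 x) (toOInfLin 𝕜 y) := by
  induction hx using supported_induction with
  | zero => simp only [map_zero, LinearMap.zero_apply]
  | add x y _ _ h h' => simp only [map_add, LinearMap.add_apply, h, h']
  | smul c x _ h => simp only [map_smul, LinearMap.smul_apply, h]
  | single t ht =>
    induction hy using supported_induction with
    | zero => simp only [map_zero]
    | add x y _ _ h h' => simp only [map_add, h, h']
    | smul c x _ h => simp only [map_smul, h]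
    | single s hs =>
      obtain ⟨h1, h2, rfl⟩ := ht
      rw [treeComp_single, map_units_smul', toOInfLin_single, toOInfLin_single, toOInfLin_single,
        PTree.OInfComp_toOInf 𝕜 hs.1 hs.2.1 h1 h2 hi him]

theorem toOInfLin_treeD {n : ℕ} {x : PTree →₀ 𝕜}
    (hx : x ∈ Finsupp.supported 𝕜 𝕜 (basisTrees n)) :
    toOInfLin 𝕜 (treeD 𝕜 x) = OInfD 𝕜 (toOInfLin 𝕜 x) := by
  induction hx using supported_induction with
  | zero => simp only [map_zero]
  | add x y _ _ h h' => simp only [map_add, h, h']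
  | smul c x _ h => simp only [map_smul, h]
  | single t ht =>
    rw [treeD_single, toOInfLin_single, PTree.OInfD_toOInf 𝕜 ht.1 ht.2.1, toOInfLin_signedSum]

variable (𝕜)

theorem isEquivalence_toOInfLin :
    OperadData.IsEquivalence (AInf 𝕜) (LinearOInf 𝕜) (toOInfLin 𝕜) (ofOInfLin 𝕜) where
  map_obj := toOInfLin_mem
  symm_obj := ofOInfLin_mem
  left_inv := ofOInfLin_toOInfLin
  right_inv := toOInfLin_ofOInfLin
  map_deg {n a _} hx := toOInfLin_deg ((AInf_obj_inf_deg 𝕜 n a).le hx)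
  symm_deg {n a _} hx := ofOInfLin_deg ((LinearOInf_obj_inf_deg n a).le hx)
  map_comp := toOInfLin_treeComp
  map_d := toOInfLin_treeD

theorem LinearOInf_isDGOperad : (LinearOInf 𝕜).IsDGOperad :=
  (isEquivalence_toOInfLin 𝕜).isDGOperad (AInf_isDGOperad 𝕜)
    (fun n => supported_le_iSup (linearBasis n)
      fun b => (b.1.edges.length : ℤ) - (b.2.verts.length : ℤ))
    (fun n => iSupIndep_supported (linearBasis n)
      fun b => (b.1.edges.length : ℤ) - (b.2.verts.length : ℤ))

theorem AInf_d_mem_decomposables (n : ℕ) (x : (AInf 𝕜).V)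
    (hx : x ∈ (if 2 ≤ n then Submodule.span 𝕜 {AInf.t 𝕜 n} else ⊥ : Submodule 𝕜 (AInf 𝕜).V)) :
    (AInf 𝕜).d x ∈ (AInf 𝕜).decomposables n := by
  split_ifs at hx with hn
  · obtain ⟨c, rfl⟩ := Submodule.mem_span_singleton.1 hx
    rw [map_smul, AInf_d_t]
    refine Submodule.smul_mem _ c (Submodule.sum_mem _ fun q hq => Submodule.sum_mem _ fun p hp =>
      Submodule.smul_mem _ _ (Submodule.subset_span ?_))
    rw [Finset.mem_Ico] at hq
    rw [Finset.mem_range] at hp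
    exact ⟨n - q + 1, q, p + 1, _, _, by omega, by omega, by omega,
      (AInf_t_mem 𝕜 (by omega)).1, (AInf_t_mem 𝕜 hq.1).1, rfl⟩
  · rw [(Submodule.mem_bot 𝕜).1 hx, map_zero]
    exact zero_mem _

/-- The generating collection is the image of the span of the corollas, and the quasi-isomorphism is
the one from `A_∞` preceded by the inverse of the comparison map. -/
theorem LinearOInf_isMinimalModel : OperadData.IsMinimalModel (LinearOInf 𝕜) (As 𝕜) := by
  have h := isEquivalence_toOInfLin 𝕜
  have hA := AInf_isDGOperad 𝕜
  refine ⟨LinearOInf_isDGOperad 𝕜, As_isDGOperad 𝕜, ⟨_, h.isFreeOn hA (AInf_isFreeOn 𝕜), ?_⟩, _,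
    (augHom_isDGHom 𝕜).comp (h.symm hA).isDGHom, h.isQuasiIso_comp hA (augHom_isQuasiIso 𝕜)⟩
  rintro n _ ⟨x, hx, rfl⟩
  rw [← h.map_d ((AInf_isFreeOn 𝕜).1 n hx)]
  exact h.map_decomposables (AInf_d_mem_decomposables 𝕜 n x hx)

end Comparison

end OInfinity
open OInfinity in
theorem mainTheorem3 (𝕜 : Type u) [Field 𝕜] [CharZero 𝕜] :
    -- the linear operadic trees span a monochrome suboperad, on faces of associahedra
    (∀ k, (LinearOInf 𝕜).obj k ≤ OInfObj 𝕜 (List.replicate k 1) 1) ∧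
    (∀ (k : ℕ) (T : OTree), T.IsLinear k → T.edgeGraph = linearGraph k) ∧
    (LinearOInf 𝕜).IsDGOperad ∧
    -- the operad `A_∞` is quasi-free on the generators `t_n`, with the standard differential
    (AInf 𝕜).IsDGOperad ∧
    (AInf 𝕜).IsFreeOn (fun n => if 2 ≤ n then Submodule.span 𝕜 {AInf.t 𝕜 n} else ⊥) ∧
    (∀ n, 2 ≤ n → AInf.t 𝕜 n ∈ (AInf 𝕜).obj n ∧ AInf.t 𝕜 n ∈ (AInf 𝕜).deg (n - 2)) ∧
    (∀ n, 2 ≤ n → (AInf 𝕜).d (AInf.t 𝕜 n) =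
      ∑ q ∈ Finset.Ico 2 n, ∑ p ∈ Finset.range (n - q + 1),
        ((-1 : 𝕜) ^ (p + q * (n - p - q))) •
          (AInf 𝕜).comp (p + 1) (AInf.t 𝕜 (n - q + 1)) (AInf.t 𝕜 q)) ∧
    -- the isomorphism, and the minimal model
    OperadData.Isomorphic (LinearOInf 𝕜) (AInf 𝕜) ∧
    OperadData.IsMinimalModel (LinearOInf 𝕜) (As 𝕜) := by
  refine ⟨fun k => Finsupp.supported_mono ?_, fun k T hT => hT.edgeGraph_eq,
    LinearOInf_isDGOperad 𝕜, AInf_isDGOperad 𝕜, AInf_isFreeOn 𝕜, fun n hn => AInf_t_mem 𝕜 hn,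
    fun n _ => AInf_d_t 𝕜, ((isEquivalence_toOInfLin 𝕜).symm (AInf_isDGOperad 𝕜)).isomorphic,
    LinearOInf_isMinimalModel 𝕜⟩
  exact fun b hb => ⟨hb.1.1, hb.2.1, hb.2.2⟩
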